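/- Let $t^{1/4}\in\mathbb{C}^*$ with $(t^{1/2}+1)(t+1)\neq 0$ (that is, the loop weights $-(t^{1/2}+t^{-1/2})$ and $t^{1/4}+t^{-1/4}$ are nonzero), and let $q,c_n\in\mathbb{C}^*$ $(n\ge 1)$ and $c_0\in\mathbb{C}$. **Link pattern tower (twist parameter $v=1$).** Let $\mathcal{L}_n$ be the set of punctured link patterns of size $n$: isotopy classes of non-crossing perfect matchings, inside the punctured disc, of $n$ marked boundary points (numbered counterclockwise), where for odd $n$ one boundary point is joined to the puncture (by the defect line). Let $V_n=\mathbb{C}[\mathcal{L}_n]$ with its usual diagrammatic action of the extended affine Temperley–Lieb algebra with generators $e_i,\rho^{\pm1}$ ($\mathbb{C}[X]$ for $n=0$): null-homotopic loops have weight $-(t^{1/2}+t^{-1/2})$, loops around the puncture have weight $t^{1/4}+t^{-1/4}$ (in particular $X$ acts on $V_0=\mathbb{C}$ by $t^{1/4}+t^{-1/4}$), and $\rho$ rotates by one marked point counterclockwise. Let $\phi_n:V_n\to V_{n+1}$ be the linear map which inserts a new marked point between point $n$ and point $1$, and a new line from it straight to the puncture underneath all arches it meets. The crossings are resolved by the Kauffman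 skein relation: with weight $t^{1/4}$ the outer part of the new line is joined to the clockwise end of the arch and the inner part to its counterclockwise end, and with weight $t^{-1/4}$ the other way round. For even $n$ the new line ends in the puncture. For odd $n$ it is joined at the puncture to the old defect line in the two possible ways: with coefficient $1$ as the arch for which the boundary segment running counterclockwise from the end of the new line to the end of the defect line is separated from the puncture, and with coefficient $t^{1/4}$ as the arch for which the complementary segment is separated from the puncture. Let $L_\cap\in\mathcal{L}_n$ be the fully nested diagram, in which the points $i$ and $n+1-i$ are joined $(1\le i\le\lfloor n/2\rfloor)$ by arches separating the boundary segment between the points $n$ and $1$ from the puncture (and, for odd $n$, the middle point is joined to the puncture). **Solutions.** For $n\ge 1$ let $\mathrm{Sol}_n(V_n;q,c)$ be the space of $f\in V_n[z_1,\dots,z_n]$ with $$R_i(z_{i+1}/z_i)\,f(\dots,z_{i+1},z_i,\dots)=f(\mathbf z)\quad(1\le i<n),\qquad \rho\, f(z_2,\dots,z_n,q^{-1}z_1)=c\,f(\mathbf z),$$ $$R_i(x)=\frac{x-1}{t^{1/2}-t^{-1/2}x}\,e_i+\frac{xt^{1/2}-t^{-1/2}}{t^{1/2}-t^{-1/2}x},$$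 and let $\mathrm{Sol}_0(V_0;q,c)$ be the $c$-eigenspace of $X$ in $V_0$. A $\lambda$-recursion factor $(\lambda\in\mathbb{C}^*)$ is a symmetric polynomial $h$ in $z_1,\dots,z_n$ with $h(z_2,\dots,z_n,q^{-1}z_1)=\lambda h(\mathbf z)$; for $n=0$ it is a constant, which has to be $0$ if $\lambda\ne1$. A family $(f^{(n)})_{n\ge0}$ is a qKZ tower of solutions relative to $\{(V_n,\phi_n)\}_{n\geq 0}$ (with twist parameters $c_n$) if $0\ne f^{(n)}\in \mathrm{Sol}_n(V_n;q,c_n)$ for all $n\ge0$, $c_0=t^{1/4}c_1+t^{-1/4}c_1^{-1}$, and there are $\lambda_n$-recursion factors $h^{(n)}$ $(n\ge0)$ such that for all $n\ge 0$ $$0\not\equiv f^{(n+1)}(z_1,\dots,z_n,0)=h^{(n)}(z_1,\dots,z_n)\,\phi_n\bigl(f^{(n)}(z_1,\dots,z_n)\bigr).$$ **Lemma.** Suppose that for every $n\ge1$ there is given $g^{(n)}\in\mathrm{Sol}_n(V_n;q,c_n)$ whose coefficient at $L_\cap$ is $\prod_{1\le i<j\le n}(t^{1/2}z_j-t^{-1/2}z_i)$,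 and put $g^{(0)}=1\in V_0$. Then $(g^{(n)})_{n\ge0}$ is a qKZ tower of solutions relative to the link pattern tower $\{(V_n,\phi_n)\}_{n\ge 0}$ if and only if $$q=t^{3/2},\qquad c_n=(-t^{-3/4})^{n-1}\ (n\ge1),\qquad c_0=t^{1/4}+t^{-1/4}.$$ If these equivalent conditions hold, then necessarily $\lambda_0=1$, $h^{(0)}=1$, and for $n\ge1$ $$\lambda_n=q^{-1},\qquad h^{(n)}(\mathbf z)=(-1)^n\,t^{\frac14(\lfloor n/2\rfloor-2n)}\,z_1z_2\cdots z_n;$$ in other words, for all $n\ge0$, $$g^{(n+1)}(z_1,\dots,z_n,0)=(-1)^n\,t^{\frac14(\lfloor n/2\rfloor-2n)}\,z_1\cdots z_n\,\phi_n\bigl(g^{(n)}(z_1,\dots,z_n)\bigr).$$ -/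

import Mathlib

noncomputable section

namespace QKZ

open MvPolynomial

/-! ### Punctured link patterns

The universal cover of the punctured disc with `n` marked boundary points is a half plane whose
boundary line carries the marked points `x : ℤ`; the integers congruent to `i` modulo `n`
(for `0 ≤ i < n`) lie over the `(i+1)`-st marked point of the disc, and increasing order is the
counterclockwise order.  A punctured link pattern is recorded by its lift: `σ x` is the other end
of the lifted arc starting at `x`, and `σ x = x` means that `x` lies over the end point of the
defect line (the line from the puncture to the boundary).  So, for `x < y = σ x`, the arch and the
part of the boundary that runs counterclockwise from (the point below) `x` to (the point below) `y`
bound a region that does not contain the puncture; `x` is the opening point and `y` the closing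
point of this arch. -/

/-- `σ` is the lift of a punctured link pattern of size `n`: an `n`-periodic involution of `ℤ`
whose arches do not cross each other and do not pass over the defect line, with no defect line for
even `n` and one defect line for odd `n`.  For `n = 0` there are no marked points, and the empty
pattern is recorded by the identity. -/
structure IsLinkPattern (n : ℕ) (σ : ℤ → ℤ) : Prop where
  empty : n = 0 → ∀ x, σ x = x
  invol : ∀ x, σ (σ x) = x
  periodic : ∀ x, σ (x + n) = σ x + n
  noncrossing : ∀ x y, x < y → y < σ x → x < σ y ∧ σ y < σ x ∧ σ y ≠ y
  defects : ((Finset.range n).filter (fun x : ℕ => σ x = x)).card = n % 2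

/-- The set `𝓛ₙ` of punctured link patterns of size `n`. -/
def LinkPattern (n : ℕ) : Type := {σ : ℤ → ℤ // IsLinkPattern n σ}

/-- The free `R`-module on the punctured link patterns of size `n`: for `R = ℂ` this is the link
pattern module `Vₙ = ℂ[𝓛ₙ]`, for `R = ℂ[z₁, …, zₙ]` it is `Vₙ[z]`, and for `R = ℂ(z₁, …, zₙ)` it
is `Vₙ(z)`. -/
abbrev LinkModule (R : Type) [CommRing R] (n : ℕ) : Type := LinkPattern n →₀ R

/-- The lift of the fully nested diagram: with marked points `0, …, n - 1`, the points `r` and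
`n - 1 - r` are joined by an arch running counterclockwise from the larger one to the smaller one,
and for odd `n` the middle point is joined to the puncture. -/
def nestedFun (n : ℕ) (x : ℤ) : ℤ :=
  if n = 0 then x
  else if 2 * (x % n) + 1 < n then n * (x / n) - 1 - x % n
  else if 2 * (x % n) + 1 = n then x
  else n * (x / n) + 2 * n - 1 - x % n

section nested

theorem nestedFun_of_lt {n : ℕ} {r k : ℤ} (h0 : 0 ≤ r) (h1 : 2 * r + 1 < n) :
    nestedFun n (n * k + r) = n * k - 1 - r := by
  have hn : (0 : ℤ) < n := by omega
  have hr : (n * k + r) % (n : ℤ) = r := by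
    rw [Int.mul_add_emod_self_left]; exact Int.emod_eq_of_lt h0 (by omega)
  have hk : (n * k + r) / (n : ℤ) = k := by
    rw [Int.mul_add_ediv_left _ _ hn.ne', Int.ediv_eq_zero_of_lt h0 (by omega)]; simp
  have : n ≠ 0 := by omega
  simp [nestedFun, hr, hk, h1, this]

theorem nestedFun_of_eq {n : ℕ} {r k : ℤ} (h0 : 0 ≤ r) (h1 : 2 * r + 1 = n) :
    nestedFun n (n * k + r) = n * k + r := by
  have hr : (n * k + r) % (n : ℤ) = r := by
    rw [Int.mul_add_emod_self_left]; exact Int.emod_eq_of_lt h0 (by omega)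
  simp [nestedFun, hr, h1]

theorem nestedFun_of_gt {n : ℕ} {r k : ℤ} (h0 : r < n) (h1 : (n : ℤ) < 2 * r + 1) :
    nestedFun n (n * k + r) = n * k + 2 * n - 1 - r := by
  have hn : (0 : ℤ) < n := by omega
  have hr : (n * k + r) % (n : ℤ) = r := by
    rw [Int.mul_add_emod_self_left]; exact Int.emod_eq_of_lt (by omega) h0
  have hk : (n * k + r) / (n : ℤ) = k := by
    rw [Int.mul_add_ediv_left _ _ hn.ne', Int.ediv_eq_zero_of_lt (by omega) h0]; simp
  have : n ≠ 0 := by omega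
  simp [nestedFun, hr, hk, h1.not_gt, h1.ne', this]

theorem isLinkPattern_nestedFun (n : ℕ) : IsLinkPattern n (nestedFun n) := by
  rcases Nat.eq_zero_or_pos n with rfl | hpos
  · have h0 : ∀ x, nestedFun 0 x = x := fun x => by simp [nestedFun]
    refine ⟨fun _ => h0, by simp [h0], by simp [h0], fun x y h1 h2 => ?_, by simp⟩
    rw [h0] at h2; omega
  have hn : (0 : ℤ) < n := by exact_mod_cast hpos
  have key : ∀ x : ℤ, ∃ k r : ℤ, x = n * k + r ∧ 0 ≤ r ∧ r < n := fun x =>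
    ⟨x / n, x % n, (Int.mul_ediv_add_emod x n).symm, Int.emod_nonneg _ hn.ne',
      Int.emod_lt_of_pos _ hn⟩
  refine ⟨by omega, ?_, ?_, ?_, ?_⟩
  · intro x
    obtain ⟨k, r, rfl, h0, h1⟩ := key x
    rcases lt_trichotomy (2 * r + 1) (n : ℤ) with h | h | h
    · rw [nestedFun_of_lt h0 h,
        show (n * k - 1 - r : ℤ) = n * (k - 1) + (n - 1 - r) by ring,
        nestedFun_of_gt (by omega) (by omega)]; ring
    · rw [nestedFun_of_eq h0 h, nestedFun_of_eq h0 h]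
    · rw [nestedFun_of_gt h1 h,
        show (n * k + 2 * n - 1 - r : ℤ) = n * (k + 1) + (n - 1 - r) by ring,
        nestedFun_of_lt (by omega) (by omega)]; ring
  · intro x
    obtain ⟨k, r, rfl, h0, h1⟩ := key x
    rw [show (n * k + r + n : ℤ) = n * (k + 1) + r by ring]
    rcases lt_trichotomy (2 * r + 1) (n : ℤ) with h | h | h
    · rw [nestedFun_of_lt h0 h, nestedFun_of_lt h0 h]; ring
    · rw [nestedFun_of_eq h0 h, nestedFun_of_eq h0 h]; ring
    · rw [nestedFun_of_gt h1 h, nestedFun_of_gt h1 h]; ring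
  · intro x y hxy hyx
    obtain ⟨k, r, rfl, h0, h1⟩ := key x
    rcases lt_trichotomy (2 * r + 1) (n : ℤ) with h | h | h
    · rw [nestedFun_of_lt h0 h] at hyx; omega
    · rw [nestedFun_of_eq h0 h] at hyx; omega
    rw [nestedFun_of_gt h1 h] at hyx ⊢
    rcases lt_or_ge y (n * k + n) with hy | hy
    · rw [show y = n * k + (y - n * k) by ring, nestedFun_of_gt (by omega) (by omega)]
      omega
    · rw [show y = n * (k + 1) + (y - n * k - n) by ring, nestedFun_of_lt (by omega) (by omega),
        mul_add]
      omega
  · have h : ∀ x ∈ Finset.range n, (nestedFun n x = x ↔ 2 * x + 1 = n) := by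
      intro x hx
      rw [Finset.mem_range] at hx
      have e : (x : ℤ) = n * 0 + x := by ring
      rcases lt_trichotomy (2 * (x : ℤ) + 1) (n : ℤ) with h | h | h
      · rw [e, nestedFun_of_lt (by omega) h]; omega
      · rw [e, nestedFun_of_eq (by omega) h]; omega
      · rw [e, nestedFun_of_gt (by omega) h]; omega
    rw [Finset.filter_congr h]
    rcases Nat.even_or_odd' n with ⟨m, rfl | rfl⟩
    · rw [Finset.card_eq_zero.2]
      · omega
      · ext x
        simp only [Finset.mem_filter, Finset.mem_range, Finset.notMem_empty, iff_false]
        omega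
    · rw [Finset.card_eq_one.2 ⟨m, by
        ext x
        simp only [Finset.mem_filter, Finset.mem_range, Finset.mem_singleton]
        omega⟩]
      omega

end nested

/-- The fully nested diagram `L_∩` of size `n`. -/
def nested (n : ℕ) : LinkPattern n := ⟨nestedFun n, isLinkPattern_nestedFun n⟩

/-! ### The action of the extended affine Temperley-Lieb algebra (twist parameter `v = 1`)

Throughout, `t₄` stands for `t^{1/4}`. -/

/-- The weight of a null-homotopic loop. -/
def loopWeight (t₄ : ℂ) : ℂ := -(t₄ ^ 2 + (t₄ ^ 2)⁻¹)

/-- The weight of a loop around the puncture. -/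
def punctureLoopWeight (t₄ : ℂ) : ℂ := t₄ + t₄⁻¹

open Classical in
/-- The basis vector of the link pattern with lift `σ`.  (It is only applied to functions `σ` that
are lifts of link patterns.) -/
def pat (R : Type) [CommRing R] (n : ℕ) (σ : ℤ → ℤ) : LinkModule R n :=
  if h : IsLinkPattern n σ then Finsupp.single ⟨σ, h⟩ 1 else 0

/-- Replace in `σ` the connections at the points over `p` and `q` by a line that connects `p` and
`q` (and its translates by multiples of `n`).  For `p = q` this makes `p` the end of a defect
line. -/
def link (n : ℕ) (p q : ℤ) (σ : ℤ → ℤ) : ℤ → ℤ := fun x =>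
  if (n : ℤ) ∣ x - p then q + (x - p)
  else if (n : ℤ) ∣ x - q then p + (x - q)
  else σ x

/-- The diagram of the Temperley-Lieb generator which joins the points `i` and `i + 1`, put around
the link pattern `σ`: the points `i`, `i + 1` become joined by a little arch, and the lines of `σ`
that ended at `i` and at `i + 1` are joined to each other.  If these two lines are one and the same
arch, a loop arises, which is replaced by its weight; if one of them is the defect line, the other
end of the other line becomes the end of the defect line. -/
def eBasis (R : Type) [CommRing R] [Algebra ℂ R] (t₄ : ℂ) (n : ℕ) (i : ℤ) (σ : ℤ → ℤ) :
    LinkModule R n :=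
  if σ i = i + 1 then loopWeight t₄ • pat R n σ
  else if (n : ℤ) ∣ σ i - (i + 1) then punctureLoopWeight t₄ • pat R n (link n i (i + 1) σ)
  else
    pat R n (link n i (i + 1)
      (link n (if σ i = i then σ (i + 1) else σ i) (if σ (i + 1) = i + 1 then σ i else σ (i + 1)) σ))

/-- The `R`-linear action of the Temperley-Lieb generator joining the lifted points `i`, `i + 1`
(that is, of `e_{i+1}` in the numbering of the marked points by `1, …, n`). -/
def eOp (R : Type) [CommRing R] [Algebra ℂ R] (t₄ : ℂ) (n : ℕ) (i : ℤ) :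
    LinkModule R n →ₗ[R] LinkModule R n :=
  Finsupp.linearCombination R (fun L : LinkPattern n => eBasis R t₄ n i L.1)

/-- The `R`-linear action of the generator `ρ`: rotate a link pattern counterclockwise by one marked
point. -/
def rhoOp (R : Type) [CommRing R] (n : ℕ) : LinkModule R n →ₗ[R] LinkModule R n :=
  Finsupp.linearCombination R (fun L : LinkPattern n => pat R n (fun x => L.1 (x - 1) + 1))

/-! ### The maps `φₙ` of the link pattern tower

A new marked point is inserted behind the last one.  A new line runs from it straight to the
puncture, passing underneath all arches which separate it from the puncture.  For even `n` it ends
in the puncture and is the new defect line.  For odd `n` it is joined to the inner end of the old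
defect line, and the result is the sum of the two ways of passing the puncture, with
coefficients `1` and `t^{1/4}`. -/

/-- Shift of the lifted points when one point is inserted behind every `n` points. -/
def shiftPoint (n : ℕ) (x : ℤ) : ℤ := x + x / n

/-- The old connections, in terms of the `n + 1` marked points; the new points (those congruent to
`n` modulo `n + 1`) are not yet connected. -/
def extend (n : ℕ) (σ : ℤ → ℤ) : ℤ → ℤ := fun y =>
  if y % ((n + 1 : ℕ) : ℤ) = n then y else shiftPoint n (σ (y - y / ((n + 1 : ℕ) : ℤ)))

/-- The arches (opening point, closing point) that are crossed by the new line starting at `n`, in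
the order in which the line meets them on its way to the puncture. -/
def crossedArches (n : ℕ) (σ : ℤ → ℤ) : List (ℤ × ℤ) :=
  (((List.range n).reverse).filter (fun x : ℕ => decide ((n : ℤ) ≤ σ x))).map
    (fun x : ℕ => (shiftPoint n x, shiftPoint n (σ x)))

/-- Resolve the crossings of the new line with the arches in the list by the Kauffman skein
relation.  Here `x` is the end point on the boundary of the part of the new line inside the crossed
arches.  At a crossing with the overcrossing arch with opening `o` and closing `c`, one smoothing,
of weight `t^{1/4}`, joins the outer part of the new line to the part of the arch at `o` and
the inner part of the new line to the part of the arch at `c`; the other smoothing,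
of weight `t^{-1/4}`, joins the outer part to the part at `c` and the inner part to the part at `o`.
The function `fin` says what to do with the remaining line when all crossings are resolved. -/
def resolve (R : Type) [CommRing R] [Algebra ℂ R] (t₄ : ℂ) (N : ℕ)
    (fin : (ℤ → ℤ) → ℤ → LinkModule R N) : List (ℤ × ℤ) → (ℤ → ℤ) → ℤ → LinkModule R N
  | [], τ, x => fin τ x
  | (o, c) :: l, τ, x =>
      t₄ • resolve R t₄ N fin l (link N x o τ) c + t₄⁻¹ • resolve R t₄ N fin l (link N x c τ) o

/-- The end of the new line at the puncture.  For even `n`, the line ends in the puncture.  For odd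
`n`, it is joined to the old defect line, whose end is at `d`: with coefficient `1` as the arch
running counterclockwise from `x` to `d`, and with coefficient `t^{1/4}` as the arch running
counterclockwise from `d` to `x`. -/
def finish (R : Type) [CommRing R] [Algebra ℂ R] (t₄ : ℂ) (n : ℕ) (σ τ : ℤ → ℤ) (x : ℤ) :
    LinkModule R (n + 1) :=
  if n % 2 = 0 then pat R (n + 1) (link (n + 1) x x τ)
  else ∑ d ∈ (Finset.range n).filter (fun d : ℕ => σ d = d),
    (pat R (n + 1) (link (n + 1) x (d + (n + 1)) τ)
      + t₄ • pat R (n + 1) (link (n + 1) x d τ))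

/-- The `R`-linear extension of the map `φₙ : Vₙ → Vₙ₊₁` of the link pattern tower. -/
def phi (R : Type) [CommRing R] [Algebra ℂ R] (t₄ : ℂ) (n : ℕ) :
    LinkModule R n →ₗ[R] LinkModule R (n + 1) :=
  Finsupp.linearCombination R (fun L : LinkPattern n =>
    resolve R t₄ (n + 1) (finish R t₄ n L.1) (crossedArches n L.1) (extend n L.1) n)

/-! ### Solutions of the qKZ equations -/

/-- Apply a ring homomorphism to all components of a vector. -/
def mapCoeff {R S : Type} [CommRing R] [CommRing S] {n : ℕ} (F : R →+* S) (f : LinkModule R n) :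
    LinkModule S n :=
  f.mapRange F (map_zero F)

/-- The field `ℂ(z₁, …, zₙ)`. -/
abbrev RatFun (n : ℕ) : Type := FractionRing (MvPolynomial (Fin n) ℂ)

/-- `Vₙ[z] → Vₙ(z)`. -/
def toRat {n : ℕ} (f : LinkModule (MvPolynomial (Fin n) ℂ) n) : LinkModule (RatFun n) n :=
  mapCoeff (algebraMap (MvPolynomial (Fin n) ℂ) (RatFun n)) f

/-- The variables as rational functions. -/
def z {n : ℕ} (i : Fin n) : RatFun n := algebraMap (MvPolynomial (Fin n) ℂ) (RatFun n) (X i)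

/-- `a(x) = (x - 1) / (t^{1/2} - t^{-1/2} x)`. -/
def weightA (t₄ : ℂ) {n : ℕ} (x : RatFun n) : RatFun n :=
  (x - 1) / (algebraMap ℂ (RatFun n) (t₄ ^ 2) - algebraMap ℂ (RatFun n) (t₄ ^ 2)⁻¹ * x)

/-- `b(x) = (x t^{1/2} - t^{-1/2}) / (t^{1/2} - t^{-1/2} x)`. -/
def weightB (t₄ : ℂ) {n : ℕ} (x : RatFun n) : RatFun n :=
  (x * algebraMap ℂ (RatFun n) (t₄ ^ 2) - algebraMap ℂ (RatFun n) (t₄ ^ 2)⁻¹) /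
    (algebraMap ℂ (RatFun n) (t₄ ^ 2) - algebraMap ℂ (RatFun n) (t₄ ^ 2)⁻¹ * x)

/-- The R-operator `R(x) = a(x) e + b(x)`, where `e` joins the points `i`, `i + 1`. -/
def rOp (t₄ : ℂ) {n : ℕ} (i : ℤ) (x : RatFun n) (f : LinkModule (RatFun n) n) :
    LinkModule (RatFun n) n :=
  weightA t₄ x • eOp (RatFun n) t₄ n i f + weightB t₄ x • f

/-- `p ↦ p(…, zᵢ₊₁, zᵢ, …)`. -/
def swapVars {m : ℕ} (i : Fin m) :
    MvPolynomial (Fin (m + 1)) ℂ →+* MvPolynomial (Fin (m + 1)) ℂ :=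
  (rename (Equiv.swap i.castSucc i.succ)).toRingHom

/-- `p ↦ p(z₂, …, zₙ, q⁻¹ z₁)`, for `n = m + 1`. -/
def rhoVars (q : ℂ) (m : ℕ) :
    MvPolynomial (Fin (m + 1)) ℂ →+* MvPolynomial (Fin (m + 1)) ℂ :=
  (aeval (Fin.snoc (α := fun _ => MvPolynomial (Fin (m + 1)) ℂ)
    (fun j : Fin m => X j.succ) (C q⁻¹ * X 0))).toRingHom

/-- `p ↦ p(z₁, …, zₙ, 0)`. -/
def lastZero (n : ℕ) : MvPolynomial (Fin (n + 1)) ℂ →+* MvPolynomial (Fin n) ℂ :=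
  (aeval (Fin.snoc (α := fun _ => MvPolynomial (Fin n) ℂ) (fun j : Fin n => X j) 0)).toRingHom

/-- `f ∈ Solₙ(Vₙ; q, c)` for the link pattern module `Vₙ`.  For `n = 0` the generator of the algebra
`ℂ[X]` acts on `V₀` by inserting a loop around the puncture. -/
def IsSol (t₄ q c : ℂ) : (n : ℕ) → LinkModule (MvPolynomial (Fin n) ℂ) n → Prop
  | 0, f => punctureLoopWeight t₄ • f = c • f
  | m + 1, f =>
      (∀ i : Fin m,
        rOp t₄ ((i : ℕ) : ℤ) (z i.succ / z i.castSucc) (toRat (mapCoeff (swapVars i) f)) = toRat f) ∧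
      rhoOp (MvPolynomial (Fin (m + 1)) ℂ) (m + 1) (mapCoeff (rhoVars q m) f) = c • f

/-! ### qKZ towers -/

/-- `h` is a `lam`-recursion factor: a symmetric polynomial with
`h(z₂, …, zₙ, q⁻¹ z₁) = lam h(z₁, …, zₙ)`; for `n = 0` the space of these is `ℂ` if `lam = 1` and
`0` otherwise. -/
def IsRecursionFactor (q lam : ℂ) : (n : ℕ) → MvPolynomial (Fin n) ℂ → Prop
  | 0, h => lam ≠ 0 ∧ (lam ≠ 1 → h = 0)
  | m + 1, h => lam ≠ 0 ∧ h.IsSymmetric ∧ rhoVars q m h = C lam * h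

/-- `(gₙ)` is a qKZ tower of solutions relative to the link pattern tower, with twist
parameters `cₙ`, scale parameters `lamₙ` and recursion factors `hₙ`. -/
structure IsQKZTowerWith (t₄ q : ℂ) (c : ℕ → ℂ)
    (g : (n : ℕ) → LinkModule (MvPolynomial (Fin n) ℂ) n)
    (lam : ℕ → ℂ) (h : (n : ℕ) → MvPolynomial (Fin n) ℂ) : Prop where
  twist_ne_zero : ∀ n, 1 ≤ n → c n ≠ 0
  twist_zero : c 0 = t₄ * c 1 + t₄⁻¹ * (c 1)⁻¹
  factor : ∀ n, IsRecursionFactor q (lam n) n (h n)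
  ne_zero : ∀ n, g n ≠ 0
  sol : ∀ n, IsSol t₄ q (c n) n (g n)
  lastZero_ne_zero : ∀ n, mapCoeff (lastZero n) (g (n + 1)) ≠ 0
  braid : ∀ n, mapCoeff (lastZero n) (g (n + 1)) =
    h n • phi (MvPolynomial (Fin n) ℂ) t₄ n (g n)

/-- `(gₙ)` is a qKZ tower of solutions relative to the link pattern tower, with twist
parameters `cₙ`. -/
def IsQKZTower (t₄ q : ℂ) (c : ℕ → ℂ)
    (g : (n : ℕ) → LinkModule (MvPolynomial (Fin n) ℂ) n) : Prop :=
  ∃ (lam : ℕ → ℂ) (h : (n : ℕ) → MvPolynomial (Fin n) ℂ), IsQKZTowerWith t₄ q c g lam h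

/-- The polynomial `∏_{i < j} (t^{1/2} zⱼ - t^{-1/2} zᵢ)`. -/
def nestedComponent (t₄ : ℂ) (n : ℕ) : MvPolynomial (Fin n) ℂ :=
  ∏ i : Fin n, ∏ j ∈ Finset.Ioi i, (C (t₄ ^ 2) * X j - C (t₄ ^ 2)⁻¹ * X i)

/-- The polynomial `(-1)ⁿ t^{(⌊n/2⌋ - 2n)/4} z₁ ⋯ zₙ`. -/
def braidFactor (t₄ : ℂ) (n : ℕ) : MvPolynomial (Fin n) ℂ :=
  C ((-1) ^ n * t₄ ^ (((n / 2 : ℕ) : ℤ) - 2 * (n : ℤ))) * ∏ i : Fin n, X i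

end QKZ

end

/-!
The heart of the matter is that drawing a new line from the boundary to the puncture underneath
all arches, with the crossings resolved by the skein relation, is compatible with Reidemeister moves.
`lineUnder` is the vector that results from a diagram `σ` and a starting point `y`; crossings are
resolved from the innermost arch outwards.  An induction on the number of arches over `y`
(`lineRelations`) shows that a Temperley-Lieb generator away from `y` commutes with drawing the line,
and that a generator next to `y` joins the line to the neighbouring arch.  The two consequences for
`φₙ` are `phi_eOp`, the intertwining of the generators `e₁, …, eₙ₋₁`, and `phi_rhoOp`,
`φₙ ρ = ρ (t^{1/4} + t^{-1/4} eₙ) φₙ`.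

Let `f = g⁽ⁿ⁺¹⁾` for some `n ≥ 1`, and set `zₙ₊₁ = 0`.  The equations with `Rᵢ`, `i < n`, survive
(`ExchangeRel`).  Since `Rₙ` at the argument `0` or `∞` is, up to a factor, one of the two braid
generators, the equation with `Rₙ` combines with the one with `ρ` into a single equation with
`ρ (eₙ + t^{1/2})` (`RotationRel`).  By the intertwining relations, the vector
`braidFactor · φₙ(g⁽ⁿ⁾)` satisfies the same equations, provided that
`cₙ₊₁ = -t^{3/4} q⁻¹ cₙ`; the factor `q⁻¹` is due to `rhoVars_braidFactor`.

These equations have at most one solution with a given component at the fully nested diagram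
(`eq_zero_of_relations`).  Indeed, a diagram that is not a rotation of the nested one has two
neighbouring arches whose inner ends `i`, `i + 1` are neighbours.  The generator joining `i` to
`i + 1` maps it to a diagram of larger area, where the area is the sum of the lengths of the arches,
and every other diagram with this image has larger area still or is the image itself
(`Valley.preimage`).  So the vanishing of components propagates from the nested diagram and its
rotations downwards in area (`eq_zero_of_nested_eq_zero`).

The nested component of `φₙ(v)` is `t^{-⌊n/2⌋/4}` times that of `v` (`phi_apply_nested`): a
diagram with a little arch elsewhere is mapped into the image of a generator, because
`loopWeight t₄ ≠ 0`, and for the nested diagram only one term of the skein expansion contributes.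
Comparison with the product formula at `zₙ₊₁ = 0` shows that `braidFactor` is the only possible
recursion factor, and that with it the nested components agree.  Hence the braid recursion holds if
and only if the twist parameters match.  Finally `c₁ = 1`, because the rotation is trivial for one
point, and `c₂² = q⁻¹`, because the square of the rotation fixes the nested diagram of size two;
together with `c₂ = -t^{3/4} q⁻¹ c₁` this gives `q = t^{3/2}`.
-/

noncomputable section

namespace QKZ

open MvPolynomial

/-! ### Residue classes and reconnections -/

/-- Residue classes modulo `N`, without any algebraic structure. -/
def Cls (N : ℕ) : Type := ZMod N

/-- The residue class of an integer modulo `N`: the marked point below a lifted point. -/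
def cls (N : ℕ) (x : ℤ) : Cls N := Int.cast (R := ZMod N) x

theorem cls_eq {N : ℕ} {x y : ℤ} : cls N x = cls N y ↔ (N : ℤ) ∣ x - y :=
  (ZMod.intCast_eq_intCast_iff_dvd_sub x y N).trans (dvd_sub_comm)

theorem cls_add {N : ℕ} {x y : ℤ} (k : ℤ) (h : cls N x = cls N y) :
    cls N (x + k) = cls N (y + k) := by
  rw [cls_eq] at *; simpa using h

theorem cls_pred {N : ℕ} {x y : ℤ} (h : cls N x = cls N (y + 1)) : cls N (x - 1) = cls N y := by
  rw [cls_eq] at *; rwa [show x - 1 - y = x - (y + 1) by ring]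

theorem cls_add_self {N : ℕ} (x : ℤ) : cls N (x + N) = cls N x := by
  rw [cls_eq]; simp

theorem cls_sub_self {N : ℕ} (x : ℤ) : cls N (x - N) = cls N x := by
  rw [cls_eq]; simp

theorem cls_eq_iff_exists {N : ℕ} {x y : ℤ} : cls N x = cls N y ↔ ∃ k : ℤ, x = y + N * k := by
  rw [cls_eq]; constructor
  · rintro ⟨k, hk⟩; exact ⟨k, by linarith⟩
  · rintro ⟨k, rfl⟩; exact ⟨k, by ring⟩

theorem eq_of_cls_eq {N : ℕ} {x y : ℤ} (h : cls N x = cls N y) (h1 : x < y + N) (h2 : y < x + N) :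
    x = y := by
  obtain ⟨k, rfl⟩ := cls_eq_iff_exists.1 h
  have hN : (0 : ℤ) < N := by linarith
  have : k < 1 := by by_contra hk; nlinarith
  have : -1 < k := by by_contra hk; nlinarith
  obtain rfl : k = 0 := by omega
  simp

theorem add_le_of_cls_eq {N : ℕ} {x y : ℤ} (h : cls N x = cls N y) (h1 : x < y) : x + N ≤ y := by
  by_contra h2
  exact h1.ne (eq_of_cls_eq h (by omega) (by omega))

theorem cls_ne_succ {N : ℕ} (hN : 2 ≤ N) (i : ℤ) : cls N i ≠ cls N (i + 1) := by
  intro h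
  have := eq_of_cls_eq h (by omega) (by omega)
  omega

open Classical in
theorem link_apply (N : ℕ) (p q : ℤ) (σ : ℤ → ℤ) (x : ℤ) :
    link N p q σ x = if cls N x = cls N p then q + (x - p)
      else if cls N x = cls N q then p + (x - q) else σ x := by
  simp [link, cls_eq]

/-! ### Systems of noncrossing lines -/

/-- `σ` is the lift of a system of pairwise noncrossing arches and at most one defect line on a
circle with `N` marked points, where the points in the classes `M` carry no line: they are fixed by
`σ`, and arches may pass over them. -/
structure NC (N : ℕ) (M : Cls N → Prop) (σ : ℤ → ℤ) : Prop where
  invol : ∀ x, σ (σ x) = x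
  per : ∀ x, σ (x + N) = σ x + N
  mark : ∀ x, M (cls N x) → σ x = x
  nc : ∀ x w, x < w → w < σ x → ¬ M (cls N w) → x < σ w ∧ σ w < σ x ∧ σ w ≠ w
  uniq : ∀ x w, σ x = x → σ w = w → ¬ M (cls N x) → ¬ M (cls N w) → cls N x = cls N w

theorem apply_add_mul {N : ℕ} {σ : ℤ → ℤ} (per : ∀ x, σ (x + N) = σ x + N) (x k : ℤ) :
    σ (x + N * k) = σ x + N * k := by
  induction k using Int.induction_on with
  | zero => simp
  | succ k ih => rw [mul_add, mul_one, ← add_assoc, per, ih]; ring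
  | pred k ih =>
    have := per (x + N * (-k - 1))
    rw [show x + N * (-(k : ℤ) - 1) + N = x + N * -(k : ℤ) by ring, ih] at this
    linarith

/-- A periodic function is determined by its values at representatives of the residue classes. -/
theorem apply_of_cls {N : ℕ} {σ : ℤ → ℤ} (per : ∀ x, σ (x + N) = σ x + N) {x y : ℤ}
    (h : cls N x = cls N y) : σ x = σ y + (x - y) := by
  obtain ⟨k, rfl⟩ := cls_eq_iff_exists.1 h
  rw [apply_add_mul per]; ring

theorem cls_apply {N : ℕ} {σ : ℤ → ℤ} (per : ∀ x, σ (x + N) = σ x + N) {x y : ℤ}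
    (h : cls N x = cls N y) : cls N (σ x) = cls N (σ y) := by
  rw [apply_of_cls per h, cls_eq]; rw [cls_eq] at h; simpa using h

theorem link_per {N : ℕ} {σ : ℤ → ℤ} (per : ∀ x, σ (x + N) = σ x + N) (p q x : ℤ) :
    link N p q σ (x + N) = link N p q σ x + N := by
  have e := cls_add_self (N := N) x
  by_cases h1 : cls N x = cls N p
  · rw [link_apply, link_apply, if_pos h1, if_pos (e.trans h1)]; ring
  by_cases h2 : cls N x = cls N q
  · rw [link_apply, link_apply, if_neg h1, if_pos h2, if_neg (e ▸ h1), if_pos (e.trans h2)]; ring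
  rw [link_apply, link_apply, if_neg h1, if_neg h2, if_neg (e ▸ h1), if_neg (e ▸ h2), per]

namespace NC

variable {N : ℕ} {M : Cls N → Prop} {σ : ℤ → ℤ}

theorem cls_ne (h : NC N M σ) {a b : ℤ} (hab : cls N a ≠ cls N b) : cls N (σ a) ≠ cls N (σ b) :=
  fun e => hab (by have := cls_apply h.per e; rwa [h.invol, h.invol] at this)

theorem not_mark (h : NC N M σ) {x : ℤ} (hx : σ x ≠ x) : ¬ M (cls N x) := fun hm => hx (h.mark x hm)

/-- An arch does not wind around the puncture more than once: its translate by `N` would cross it.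
-/
theorem lt_add (h : NC N M σ) (hN : 0 < N) (x : ℤ) : σ x < x + N := by
  by_contra hx
  have hne : σ x ≠ x := by omega
  rcases (not_lt.1 hx).lt_or_eq with h1 | h1
  · have := h.nc x (x + N) (by omega) h1 (by rw [cls_add_self]; exact h.not_mark hne)
    rw [h.per] at this; omega
  · have e := h.per x
    rw [h1, h.invol] at e; omega

theorem sub_lt (h : NC N M σ) (hN : 0 < N) (x : ℤ) : x - N < σ x := by
  have := h.lt_add hN (σ x)
  rw [h.invol] at this; omega

theorem nc' (h : NC N M σ) {x w : ℤ} (h1 : σ x < w) (h2 : w < x) (hw : ¬ M (cls N w)) :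
    σ x < σ w ∧ σ w < x ∧ σ w ≠ w := by
  have := h.nc (σ x) w h1 (by rwa [h.invol]) hw
  rwa [h.invol] at this

/-- An arch does not separate the two ends of another arch. -/
theorem sep (h : NC N M σ) {w b : ℤ} (hb : ¬ M (cls N b)) (hb' : ¬ M (cls N (σ b))) :
    (w < b ∧ b < σ w ↔ w < σ b ∧ σ b < σ w) ∧ (σ w < b ∧ b < w ↔ σ w < σ b ∧ σ b < w) := by
  have e := h.invol b
  refine ⟨⟨fun hw => ?_, fun hw => ?_⟩, ⟨fun hw => ?_, fun hw => ?_⟩⟩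
  · have := h.nc w b hw.1 hw.2 hb; omega
  · have := h.nc w _ hw.1 hw.2 hb'; omega
  · have := h.nc' hw.1 hw.2 hb; omega
  · have := h.nc' hw.1 hw.2 hb'; omega

/-- The three relative positions of the partners `p`, `q` of two neighbouring points `i`, `i + 1`
which are not joined to each other. -/
theorem shape (h : NC N M σ) (hN : 0 < N) {i p q : ℤ} (hp : σ i = p) (hq : σ (i + 1) = q)
    (hi : ¬ M (cls N i)) (hi' : ¬ M (cls N (i + 1))) (h1 : p ≠ i) (h2 : q ≠ i + 1)
    (h3 : cls N p ≠ cls N (i + 1)) :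
    (p < i ∧ i + 1 < q ∧ q - p < N) ∨ (q < p ∧ p < i) ∨ (i + 1 < q ∧ q < p) := by
  have hp' : σ p = i := by rw [← hp, h.invol]
  have hq' : σ q = i + 1 := by rw [← hq, h.invol]
  have n1 : p ≠ i + 1 := fun e => h3 (by rw [e])
  have n2 : q ≠ i := fun e => n1 (by rw [← hp, ← e, hq', e])
  have lp := h.lt_add hN i
  have lq := h.lt_add hN (i + 1)
  have lp' := h.sub_lt hN i
  have lq' := h.sub_lt hN (i + 1)
  have hMp : ¬ M (cls N p) := h.not_mark (by omega)
  have hMq : ¬ M (cls N q) := h.not_mark (by omega)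
  have n3 : p ≠ i + 1 - N := fun e => h3 (by rw [e, cls_sub_self])
  have a1 := h.nc i (i + 1)
  have a2 := h.nc' (x := i + 1) (w := i)
  have a3 := h.nc (i + 1) (p + N)
  have a4 := h.nc' (x := i) (w := q)
  have e := h.per p
  rw [cls_add_self] at a3
  rw [hp, hq'] at a4
  have n4 : (N : ℤ) ≠ 1 := fun e => h3 (by rw [cls_eq, e]; exact one_dvd _)
  have n5 : q ≠ p + N := fun e => n4 (by have := h.per p; rw [← e] at this; omega)
  simp only [hi, hi', hMp, hMq, not_false_eq_true, forall_true_left] at a1 a2 a3 a4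
  omega

/-- Joining `i` to `i + 1` and the partners of these two points to each other creates no crossings,
because of the relative positions listed in `shape`. -/
theorem reconnect_arcs (h : NC N M σ) (hN : 0 < N) {i p q : ℤ} (hp : σ i = p) (hq : σ (i + 1) = q)
    (hi : ¬ M (cls N i)) (hi' : ¬ M (cls N (i + 1))) (h1 : p ≠ i) (h2 : q ≠ i + 1)
    (h3 : cls N p ≠ cls N (i + 1)) (h4 : cls N i ≠ cls N (i + 1)) :
    NC N M (link N i (i + 1) (link N p q σ)) := by
  have hp' : σ p = i := by rw [← hp, h.invol]
  have hq' : σ q = i + 1 := by rw [← hq, h.invol]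
  have Pi : ∀ x, cls N x = cls N i → σ x = p + (x - i) := fun x hx => hp ▸ apply_of_cls h.per hx
  have Pj : ∀ x, cls N x = cls N (i + 1) → σ x = q + (x - (i + 1)) :=
    fun x hx => hq ▸ apply_of_cls h.per hx
  have Pp : ∀ x, cls N x = cls N p → σ x = i + (x - p) := fun x hx => hp' ▸ apply_of_cls h.per hx
  have Pq : ∀ x, cls N x = cls N q → σ x = i + 1 + (x - q) :=
    fun x hx => hq' ▸ apply_of_cls h.per hx
  have c1 : cls N p ≠ cls N i := fun e => by
    have := Pi p e; rw [hp'] at this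
    have := eq_of_cls_eq e (hp ▸ h.lt_add hN i) (by have := h.sub_lt hN i; omega)
    exact h1 this
  have c2 : cls N q ≠ cls N (i + 1) := fun e => by
    have := eq_of_cls_eq e (hq ▸ h.lt_add hN (i+1)) (by have := h.sub_lt hN (i+1); omega)
    exact h2 this
  have c3 : cls N q ≠ cls N i := fun e => h3 (by rw [← hp, ← hq', cls_apply h.per e])
  have c4 : cls N p ≠ cls N q := h.cls_ne h4 |> (hp ▸ hq ▸ ·)
  have hMp : ¬ M (cls N p) := h.not_mark (by omega)
  have hMq : ¬ M (cls N q) := h.not_mark (by omega)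
  have Ti : ∀ x, cls N x = cls N i → link N i (i + 1) (link N p q σ) x = x + 1 := fun x hx => by
    rw [link_apply, if_pos hx]; ring
  have Tj : ∀ x, cls N x = cls N (i + 1) → link N i (i + 1) (link N p q σ) x = x - 1 :=
    fun x hx => by rw [link_apply, if_neg (hx ▸ h4.symm), if_pos hx]; ring
  have Tp : ∀ x, cls N x = cls N p → link N i (i + 1) (link N p q σ) x = q + (x - p) :=
    fun x hx => by rw [link_apply, if_neg (hx ▸ c1), if_neg (hx ▸ h3), link_apply, if_pos hx]
  have Tq : ∀ x, cls N x = cls N q → link N i (i + 1) (link N p q σ) x = p + (x - q) :=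
    fun x hx => by
      rw [link_apply, if_neg (hx ▸ c3), if_neg (hx ▸ c2), link_apply, if_neg (hx ▸ c4.symm),
        if_pos hx]
  have To : ∀ x, cls N x ≠ cls N i → cls N x ≠ cls N (i + 1) → cls N x ≠ cls N p →
      cls N x ≠ cls N q → link N i (i + 1) (link N p q σ) x = σ x := fun x h1 h2 h3 h4 => by
    rw [link_apply, if_neg h1, if_neg h2, link_apply, if_neg h3, if_neg h4]
  have Oi : ∀ x, cls N (σ x) = cls N i → cls N x = cls N p := fun x hx => by
    rw [← hp, ← cls_apply h.per hx, h.invol]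
  have Oj : ∀ x, cls N (σ x) = cls N (i + 1) → cls N x = cls N q := fun x hx => by
    rw [← hq, ← cls_apply h.per hx, h.invol]
  have Op : ∀ x, cls N (σ x) = cls N p → cls N x = cls N i := fun x hx => by
    rw [← hp', ← cls_apply h.per hx, h.invol]
  have Oq : ∀ x, cls N (σ x) = cls N q → cls N x = cls N (i + 1) := fun x hx => by
    rw [← hq', ← cls_apply h.per hx, h.invol]
  have lp := h.lt_add hN i
  have lp' := h.sub_lt hN i
  have lq := h.lt_add hN (i + 1)
  have lq' := h.sub_lt hN (i + 1)
  have A := h.nc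
  have A' := fun x w => h.nc' (x := x) (w := w)
  have Ci : ∀ x y, cls N x = cls N y → ∀ k, cls N (k + (x - y)) = cls N k := fun x y e k => by
    rw [cls_eq] at *; simpa using e
  refine ⟨?_, link_per (link_per h.per _ _) _ _, ?_, ?_, ?_⟩ <;>
    generalize link N i (i + 1) (link N p q σ) = τ at *
  · intro x
    have e := h.invol x
    by_cases x1 : cls N x = cls N i
    · rw [Ti x x1, Tj _ (cls_add 1 x1)]; ring
    by_cases x2 : cls N x = cls N (i + 1)
    · rw [Tj x x2, Ti _ (cls_pred x2)]; ring
    by_cases x3 : cls N x = cls N p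
    · rw [Tp x x3, Tq _ (Ci _ _ x3 _)]; ring
    by_cases x4 : cls N x = cls N q
    · rw [Tq x x4, Tp _ (Ci _ _ x4 _)]; ring
    rw [To x x1 x2 x3 x4, To, h.invol] <;> grind
  · intro x hx
    rw [To x, h.mark x hx] <;> grind
  · intro x w hxw hwx hw
    by_cases x1 : cls N x = cls N i
    · have := Ti x x1; omega
    by_cases x2 : cls N x = cls N (i + 1)
    · have := Tj x x2; omega
    have sp := h.shape hN hp hq hi hi' h1 h2 h3
    -- no arch of `σ` separates two of the four points `p`, `i`, `i + 1`, `q`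
    have key : ∀ k y, cls N (p + k) = cls N p → cls N y ≠ cls N i → cls N y ≠ cls N (i + 1) →
      cls N (σ y) ≠ cls N i → cls N (σ y) ≠ cls N (i + 1) →
      ((y < p + k ∧ p + k < σ y ↔ y < q + k ∧ q + k < σ y) ∧
       (σ y < p + k ∧ p + k < y ↔ σ y < q + k ∧ q + k < y)) := by
      intro k y hk y1 y2 y3 y4
      have e1 := Pp (p + k) hk
      have hk' : ∀ z, cls N (z + k) = cls N z := fun z => by
        rw [cls_eq] at hk ⊢; simpa using hk
      have e2 := Pj (i + 1 + k) (hk' _)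
      have s1 := h.sep (w := y) (b := p + k) (by rwa [hk']) (by
        rw [e1, show i + (p + k - p) = i + k by ring, hk']; exact hi)
      have s2 := h.sep (w := y) (b := i + 1 + k) (by rwa [hk']) (by
        rw [e2, show q + (i + 1 + k - (i + 1)) = q + k by ring, hk']; exact hMq)
      have d1 : y ≠ i + k := fun e => y1 (by rw [e, hk'])
      have d2 : y ≠ i + 1 + k := fun e => y2 (by rw [e, hk'])
      have d3 : σ y ≠ i + k := fun e => y3 (by rw [e, hk'])
      have d4 : σ y ≠ i + 1 + k := fun e => y4 (by rw [e, hk'])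
      omega
    have hw' : ¬ M (cls N (σ w)) := fun hm => hw (by
      have := h.mark _ hm; rw [h.invol] at this; rwa [← this] at hm)
    have ew := h.invol w
    by_cases x3 : cls N x = cls N p
    · rw [Tp x x3] at *
      by_cases w1 : cls N w = cls N i
      · have := Ti w w1
        have : w + 1 ≠ q + (x - p) := fun e => c2 (by
          rw [← Ci _ _ x3 q, ← e]; exact (cls_add 1 w1))
        omega
      by_cases w2 : cls N w = cls N (i + 1)
      · have := Tj w w2
        have : w - 1 ≠ x := fun e => x1 (by rw [← e]; exact cls_pred w2)
        omega
      by_cases w3 : cls N w = cls N p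
      · have := add_le_of_cls_eq (x3.trans w3.symm) hxw
        omega
      by_cases w4 : cls N w = cls N q
      · have := add_le_of_cls_eq (w4.trans (Ci _ _ x3 q).symm) hwx
        omega
      rw [To w w1 w2 w3 w4] at *
      have w5 : w ≠ i + (x - p) := fun e => w1 (by rw [e, Ci _ _ x3])
      have w6 : w ≠ i + 1 + (x - p) := fun e => w2 (by rw [e, Ci _ _ x3])
      have e1 := Pp x x3
      have e2 := Pj (i + 1 + (x - p)) (Ci _ _ x3 _)
      have := A x w hxw
      have := A (i + 1 + (x - p)) w
      simp only [hw, not_false_eq_true, forall_true_left] at *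
      omega
    by_cases x4 : cls N x = cls N q
    · rw [Tq x x4] at *
      by_cases w1 : cls N w = cls N i
      · have := Ti w w1
        have : w + 1 ≠ p + (x - q) := fun e => h3 (by
          rw [← Ci _ _ x4 p, ← e]; exact (cls_add 1 w1))
        omega
      by_cases w2 : cls N w = cls N (i + 1)
      · have := Tj w w2
        have : w - 1 ≠ x := fun e => x1 (by rw [← e]; exact cls_pred w2)
        omega
      by_cases w3 : cls N w = cls N q
      · have := add_le_of_cls_eq (x4.trans w3.symm) hxw
        omega
      by_cases w4 : cls N w = cls N p
      · have := add_le_of_cls_eq (w4.trans (Ci _ _ x4 p).symm) hwx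
        omega
      rw [To w w1 w2 w4 w3] at *
      have e1 := Pq x x4
      have e2 := Pi (i + (x - q)) (Ci _ _ x4 _)
      have e3 := Pj (i + 1 + (x - q)) (Ci _ _ x4 _)
      have e4 := Pp (p + (x - q)) (Ci _ _ x4 _)
      have := A x w hxw
      have := A (i + (x - q)) w
      have := A (p + (x - q)) (σ w)
      have := A (i + 1 + (x - q)) (σ w)
      have w5 : σ w ≠ i + (x - q) := fun e => w4 (Oi w (by rw [e, Ci _ _ x4]))
      have w6 : σ w ≠ i + 1 + (x - q) := fun e => w3 (Oj w (by rw [e, Ci _ _ x4]))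
      have w7 : σ w ≠ p + (x - q) := fun e => w1 (Op w (by rw [e, Ci _ _ x4]))
      have w8 : σ w ≠ x := fun e => w2 (Oq w (by rw [e, x4]))
      simp only [hw, hw', not_false_eq_true, forall_true_left] at *
      omega
    rw [To x x1 x2 x3 x4] at *
    have x5 : cls N (σ x) ≠ cls N i := fun e => x3 (Oi x e)
    have x6 : cls N (σ x) ≠ cls N (i + 1) := fun e => x4 (Oj x e)
    by_cases w1 : cls N w = cls N i
    · have := Ti w w1
      have n1 : w + 1 ≠ σ x := fun e => x4 (Oj x (by rw [← e]; exact cls_add 1 w1))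
      omega
    by_cases w2 : cls N w = cls N (i + 1)
    · have := Tj w w2
      have n1 : w - 1 ≠ x := fun e => x1 (by rw [← e]; exact cls_pred w2)
      omega
    by_cases w3 : cls N w = cls N p
    · have := key (w - p) x (by rw [add_sub_cancel]; exact w3) x1 x2 x5 x6
      have := Tp w w3
      have : q ≠ p := fun e => c4 (by rw [e])
      omega
    by_cases w4 : cls N w = cls N q
    · have := key (w - q) x (Ci _ _ w4 _) x1 x2 x5 x6
      have := Tq w w4
      have : q ≠ p := fun e => c4 (by rw [e])
      omega
    rw [To w w1 w2 w3 w4]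
    exact A x w hxw hwx hw
  · intro x w hx hw
    by_cases x1 : cls N x = cls N i
    · have := Ti x x1; omega
    by_cases x2 : cls N x = cls N (i + 1)
    · have := Tj x x2; omega
    by_cases w1 : cls N w = cls N i
    · have := Ti w w1; omega
    by_cases w2 : cls N w = cls N (i + 1)
    · have := Tj w w2; omega
    by_cases x3 : cls N x = cls N p
    · have := Tp x x3
      exact absurd (by rw [show p = q by omega]) c4
    by_cases x4 : cls N x = cls N q
    · have := Tq x x4
      exact absurd (by rw [show p = q by omega]) c4
    by_cases w3 : cls N w = cls N p
    · have := Tp w w3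
      exact absurd (by rw [show p = q by omega]) c4
    by_cases w4 : cls N w = cls N q
    · have := Tq w w4
      exact absurd (by rw [show p = q by omega]) c4
    exact h.uniq x w (by rw [← To x x1 x2 x3 x4, hx]) (by rw [← To w w1 w2 w3 w4, hw])
end NC

/-! ### Smoothing a crossing of the new line -/

theorem cls_shift {N : ℕ} {x y : ℤ} (h : cls N x = cls N y) (k : ℤ) :
    cls N (k + (x - y)) = cls N k := by
  rw [cls_eq] at *; simpa using h

/-- Join `a` and `b` and leave `c` without connection. -/
def link3 (N : ℕ) (a b c : ℤ) (σ : ℤ → ℤ) : ℤ → ℤ := link N c c (link N a b σ)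

section link3

variable {N : ℕ} {a b c : ℤ} {σ : ℤ → ℤ}

theorem link3_left (hac : cls N a ≠ cls N c) {x : ℤ}
    (hx : cls N x = cls N a) : link3 N a b c σ x = b + (x - a) := by
  rw [link3, link_apply, if_neg (hx ▸ hac), if_neg (hx ▸ hac), link_apply, if_pos hx]

theorem link3_right (hab : cls N a ≠ cls N b) (hbc : cls N b ≠ cls N c) {x : ℤ}
    (hx : cls N x = cls N b) : link3 N a b c σ x = a + (x - b) := by
  rw [link3, link_apply, if_neg (hx ▸ hbc), if_neg (hx ▸ hbc), link_apply, if_neg (hx ▸ hab.symm),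
    if_pos hx]

theorem link3_end {x : ℤ} (hx : cls N x = cls N c) : link3 N a b c σ x = x := by
  rw [link3, link_apply, if_pos hx]; ring

theorem link3_other {x : ℤ} (h1 : cls N x ≠ cls N a) (h2 : cls N x ≠ cls N b)
    (h3 : cls N x ≠ cls N c) : link3 N a b c σ x = σ x := by
  rw [link3, link_apply, if_neg h3, if_neg h3, link_apply, if_neg h1, if_neg h2]

/-- Reconnecting `a`, `b` and `c` gives an involution if no other line ends at one of these points.
-/
theorem link3_invol (inv : ∀ x, σ (σ x) = x)
    (hab : cls N a ≠ cls N b) (hac : cls N a ≠ cls N c) (hbc : cls N b ≠ cls N c)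
    (hcl : ∀ x, cls N x ≠ cls N a → cls N x ≠ cls N b → cls N x ≠ cls N c →
      cls N (σ x) ≠ cls N a ∧ cls N (σ x) ≠ cls N b ∧ cls N (σ x) ≠ cls N c) (x : ℤ) :
    link3 N a b c σ (link3 N a b c σ x) = x := by
  by_cases x1 : cls N x = cls N a
  · rw [link3_left hac x1, link3_right hab hbc (cls_shift x1 b)]; ring
  by_cases x2 : cls N x = cls N b
  · rw [link3_right hab hbc x2, link3_left hac (cls_shift x2 a)]; ring
  by_cases x3 : cls N x = cls N c
  · rw [link3_end x3, link3_end x3]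
  obtain ⟨h1, h2, h3⟩ := hcl x x1 x2 x3
  rw [link3_other x1 x2 x3, link3_other h1 h2 h3, inv]

end link3

/-- The condition that a reconnection only involves the lines ending at `a`, `b` and `c`. -/
theorem NC.closed3 {N : ℕ} {M : Cls N → Prop} {σ : ℤ → ℤ} (h : NC N M σ) {a b c : ℤ}
    (h1 : σ a = a) (h2 : σ b = c) (x : ℤ) (x1 : cls N x ≠ cls N a) (x2 : cls N x ≠ cls N b)
    (x3 : cls N x ≠ cls N c) :
    cls N (σ x) ≠ cls N a ∧ cls N (σ x) ≠ cls N b ∧ cls N (σ x) ≠ cls N c := by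
  have h3 : σ c = b := by rw [← h2, h.invol]
  have e1 := h.cls_ne x1
  have e2 := h.cls_ne x2
  have e3 := h.cls_ne x3
  rw [h1] at e1; rw [h2] at e2; rw [h3] at e3
  exact ⟨e1, e3, e2⟩

/-- `o` is the opening point of the innermost arch over the point `y`. -/
def Inner (σ : ℤ → ℤ) (y o : ℤ) : Prop := o < y ∧ y < σ o ∧ ∀ x, o < x → x < y → σ x < y

/-- No arch passes over `y`. -/
def NoCross (σ : ℤ → ℤ) (y : ℤ) : Prop := ∀ x, x < y → ¬ y < σ x

/-- The lift of a link pattern on the points outside the class of `y`; at `y` there starts a new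
line, which passes underneath all arches. -/
abbrev NCAt (N : ℕ) (y : ℤ) (σ : ℤ → ℤ) : Prop := NC N (fun a => a = cls N y) σ

namespace NCAt

variable {N : ℕ} {y : ℤ} {σ : ℤ → ℤ}

theorem fix (h : NCAt N y σ) : σ y = y := h.mark y rfl

/-- The points between `y` and the closing point of the innermost arch over `y` are joined to points
to the right of `y`, as the points between the opening point and `y` are joined to points to the
left of `y`. -/
theorem inner_right (h : NCAt N y σ) {o : ℤ} (ho : Inner σ y o) {x : ℤ} (h1 : y < x)
    (h2 : x < σ o) : y < σ x := by
  by_contra h3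
  obtain ⟨i1, i2, i3⟩ := ho
  have e := h.invol x
  by_cases hm : cls N x = cls N y
  · have := h.mark x hm; omega
  have := h.nc o x (by omega) h2 hm
  have n : σ x ≠ y := fun e' => by rw [e', h.fix] at e; omega
  have := i3 (σ x) (by omega) (by omega)
  omega

/-- Smoothing the crossing of the new line with the innermost arch `(o, c)` over it, the outer part
of the new line being joined to `o`. -/
theorem cut_left (h : NCAt N y σ) (hN : 0 < N) {o c : ℤ} (ho : Inner σ y o) (hc : σ o = c) :
    NCAt N c (link3 N y o c σ) := by
  subst hc
  obtain ⟨i1, i2, i3⟩ := ho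
  have lo := h.lt_add hN o
  have hoc := h.invol o
  have hMo : cls N o ≠ cls N y := h.not_mark (by omega)
  have hMc : cls N (σ o) ≠ cls N y := h.not_mark (by omega)
  have dco : cls N o ≠ cls N (σ o) := fun e => by
    have := eq_of_cls_eq e (by omega) (by omega); omega
  have hcl := h.closed3 h.fix (rfl : σ o = σ o)
  have Ta := fun x hx => link3_left (σ := σ) (b := o) hMc.symm (x := x) hx
  have Tb := fun x hx => link3_right (σ := σ) hMo.symm dco (x := x) hx
  have Tc := fun x hx => link3_end (σ := σ) (a := y) (b := o) (c := σ o) (x := x) (N := N) hx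
  have To := fun x h1 h2 h3 =>
    link3_other (σ := σ) (a := y) (b := o) (c := σ o) (x := x) (N := N) h1 h2 h3
  have Po := fun x hx => apply_of_cls h.per (x := x) (y := o) hx
  refine ⟨link3_invol h.invol hMo.symm hMc.symm dco hcl,
    link_per (link_per h.per _ _) _ _, fun x hx => Tc x hx, ?_, ?_⟩
  · generalize link3 N y o (σ o) σ = τ at *
    intro x w hxw hwx hw
    by_cases x1 : cls N x = cls N y
    · have := Ta x x1; omega
    by_cases x3 : cls N x = cls N (σ o)
    · have := Tc x x3; omega
    by_cases x2 : cls N x = cls N o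
    · rw [Tb x x2] at *
      by_cases w1 : cls N w = cls N y
      · have := add_le_of_cls_eq (w1.trans (cls_shift x2 y).symm) hwx
        omega
      by_cases w2 : cls N w = cls N o
      · have := add_le_of_cls_eq (x2.trans w2.symm) hxw
        omega
      rw [To w w1 w2 hw] at *
      have e1 := Po x x2
      have e2 := h.nc x w hxw (by omega) w1
      have e3 := apply_of_cls h.per (cls_shift x2 w)
      have e4 := i3 (w - (x - o)) (by omega) (by omega)
      have e5 := apply_of_cls h.per (x := w - (x - o)) (y := w) (by
        have := cls_shift x2.symm w; rwa [show w - (x - o) = w + (o - x) by ring])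
      omega
    rw [To x x1 x2 x3] at *
    have ⟨n1, n2, n3⟩ := hcl x x1 x2 x3
    by_cases w1 : cls N w = cls N y
    · rw [Ta w w1]
      have e1 := Po (o + (w - y)) (cls_shift w1 o)
      have m1 : cls N (o + (w - y)) ≠ cls N y := by rwa [cls_shift w1]
      have m2 : cls N (σ o + (w - y)) ≠ cls N y := by rwa [cls_shift w1]
      have e2 := h.nc x (o + (w - y))
      have e4 := i3 (x - (w - y))
      have e5 := apply_of_cls h.per (x := x - (w - y)) (y := x) (by
        have := cls_shift w1.symm x; rwa [show x - (w - y) = x + (y - w) by ring])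
      have n4 : x ≠ o + (w - y) := fun e => x2 (by rw [e, cls_shift w1])
      simp only [m1, not_false_eq_true, forall_true_left] at *
      omega
    by_cases w2 : cls N w = cls N o
    · rw [Tb w w2]
      have e1 := Po w w2
      have e2 := h.nc x w hxw hwx w1
      omega
    rw [To w w1 w2 hw]
    exact h.nc x w hxw hwx w1
  · intro x w hx hw mx mw
    by_cases x1 : cls N x = cls N y
    · have := Ta x x1; omega
    by_cases x2 : cls N x = cls N o
    · have := Tb x x2; omega
    by_cases w1 : cls N w = cls N y
    · have := Ta w w1; omega
    by_cases w2 : cls N w = cls N o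
    · have := Tb w w2; omega
    rw [To x x1 x2 mx] at hx
    rw [To w w1 w2 mw] at hw
    exact h.uniq x w hx hw x1 w1

/-- A new line starting next to the end of a line with other end `c` can be joined to it; the
new line then starts at `c`. -/
theorem join_right (h : NCAt N y σ) (hN : 0 < N) {c : ℤ} (hc : σ (y + 1) = c) (h1 : c ≠ y + 1)
    (h2 : cls N y ≠ cls N (y + 1)) :
    NCAt N c (link3 N y (y + 1) c σ) := by
  have hc' : σ c = y + 1 := by rw [← hc, h.invol]
  have lo := h.lt_add hN (y + 1)
  have lo' := h.sub_lt hN (y + 1)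
  have hMc : cls N c ≠ cls N y := h.not_mark (by omega)
  have dco : cls N (y + 1) ≠ cls N c := fun e => by
    have := eq_of_cls_eq e (by omega) (by omega); omega
  have hcl := h.closed3 h.fix hc
  have Ta := fun x hx => link3_left (σ := σ) (b := y + 1) hMc.symm (x := x) hx
  have Tb := fun x hx => link3_right (σ := σ) h2 dco (x := x) hx
  have Tc := fun x hx => link3_end (σ := σ) (a := y) (b := y + 1) (c := c) (x := x) (N := N) hx
  have To := fun x h1 h2 h3 =>
    link3_other (σ := σ) (a := y) (b := y + 1) (c := c) (x := x) (N := N) h1 h2 h3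
  refine ⟨link3_invol h.invol h2 hMc.symm dco hcl,
    link_per (link_per h.per _ _) _ _, fun x hx => Tc x hx, ?_, ?_⟩
  · generalize link3 N y (y + 1) c σ = τ at *
    intro x w hxw hwx hw
    by_cases x1 : cls N x = cls N y
    · have := Ta x x1; omega
    by_cases x3 : cls N x = cls N c
    · have := Tc x x3; omega
    by_cases x2 : cls N x = cls N (y + 1)
    · have := Tb x x2; omega
    rw [To x x1 x2 x3] at *
    have ⟨n1, n2, n3⟩ := hcl x x1 x2 x3
    by_cases w1 : cls N w = cls N y
    · rw [Ta w w1]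
      have n4 : σ x ≠ w + 1 := fun e => n2 (by rw [e]; exact cls_add 1 w1)
      omega
    by_cases w2 : cls N w = cls N (y + 1)
    · rw [Tb w w2]
      have n4 : x ≠ w - 1 := fun e => x1 (by rw [e]; exact cls_pred w2)
      omega
    rw [To w w1 w2 hw]
    exact h.nc x w hxw hwx w1
  · intro x w hx hw mx mw
    by_cases x1 : cls N x = cls N y
    · have := Ta x x1; omega
    by_cases x2 : cls N x = cls N (y + 1)
    · have := Tb x x2; omega
    by_cases w1 : cls N w = cls N y
    · have := Ta w w1; omega
    by_cases w2 : cls N w = cls N (y + 1)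
    · have := Tb w w2; omega
    rw [To x x1 x2 mx] at hx
    rw [To w w1 w2 mw] at hw
    exact h.uniq x w hx hw x1 w1

end NCAt

/-- Moving the end of the defect line by a Temperley-Lieb generator. -/
theorem NC.reconnect_defect_left {N : ℕ} {M : Cls N → Prop} {σ : ℤ → ℤ} (h : NC N M σ) (hN : 0 < N)
    {i q : ℤ} (hi : ¬ M (cls N i)) (hi' : ¬ M (cls N (i + 1))) (hd : σ i = i)
    (hq : σ (i + 1) = q) (h1 : q ≠ i + 1) (h2 : cls N i ≠ cls N (i + 1)) :
    NC N M (link3 N i (i + 1) q σ) := by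
  have hq' : σ q = i + 1 := by rw [← hq, h.invol]
  have lo := h.lt_add hN (i + 1)
  have lo' := h.sub_lt hN (i + 1)
  have hMq : ¬ M (cls N q) := h.not_mark (by omega)
  have dco : cls N (i + 1) ≠ cls N q := fun e => by
    have := eq_of_cls_eq e (by omega) (by omega); omega
  have dc : cls N i ≠ cls N q := fun e => by
    have := apply_of_cls h.per e
    exact h2 (by rw [hd, hq'] at this; rw [← cls_shift e (i + 1), ← this])
  have hcl := h.closed3 hd hq
  have Ta := fun x hx => link3_left (σ := σ) (b := i + 1) dc (x := x) hx
  have Tb := fun x hx => link3_right (σ := σ) h2 dco (x := x) hx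
  have Tc := fun x hx => link3_end (σ := σ) (a := i) (b := i + 1) (c := q) (x := x) (N := N) hx
  have To := fun x h1 h2 h3 =>
    link3_other (σ := σ) (a := i) (b := i + 1) (c := q) (x := x) (N := N) h1 h2 h3
  have cov : ∀ x k, cls N k = cls N i → x < k → k < σ x → False := fun x k hk l1 l2 => by
    have := h.nc x k l1 l2 (by rwa [hk])
    have e := apply_of_cls h.per hk
    omega
  refine ⟨link3_invol h.invol h2 dc dco hcl,
    link_per (link_per h.per _ _) _ _, ?_, ?_, ?_⟩
  · intro x hx
    rw [To, h.mark x hx] <;> intro e <;> rw [e] at hx <;> contradiction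
  · generalize link3 N i (i + 1) q σ = τ at *
    intro x w hxw hwx hw
    by_cases x1 : cls N x = cls N i
    · have := Ta x x1; omega
    by_cases x3 : cls N x = cls N q
    · have := Tc x x3; omega
    by_cases x2 : cls N x = cls N (i + 1)
    · have := Tb x x2; omega
    rw [To x x1 x2 x3] at *
    have ⟨n1, n2, n3⟩ := hcl x x1 x2 x3
    by_cases w1 : cls N w = cls N i
    · exact (cov x w w1 hxw hwx).elim
    by_cases w2 : cls N w = cls N (i + 1)
    · have n4 : x ≠ w - 1 := fun e => x1 (by rw [e]; exact cls_pred w2)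
      exact (cov x (w - 1) (cls_pred w2) (by omega) (by omega)).elim
    by_cases w3 : cls N w = cls N q
    · have e1 := apply_of_cls h.per w3
      have e2 := h.nc x w hxw hwx hw
      have n4 : x ≠ i + (w - q) := fun e => x1 (by rw [e, cls_shift w3])
      exact (cov x (i + (w - q)) (cls_shift w3 i) (by omega) (by omega)).elim
    rw [To w w1 w2 w3]
    exact h.nc x w hxw hwx hw
  · have key : ∀ x, link3 N i (i + 1) q σ x = x → ¬ M (cls N x) → cls N x = cls N q := by
      intro x hx mx
      by_contra x3
      by_cases x1 : cls N x = cls N i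
      · have := Ta x x1; omega
      by_cases x2 : cls N x = cls N (i + 1)
      · have := Tb x x2; omega
      rw [To x x1 x2 x3] at hx
      exact x1 (h.uniq x i hx hd mx hi)
    intro x w hx hw mx mw
    rw [key x hx mx, key w hw mw]

/-- Replacing an arch from `i + 1` around the puncture to `i` by the little arch. -/
theorem NC.unwrap {N : ℕ} {M : Cls N → Prop} {σ : ℤ → ℤ} (h : NC N M σ)
    {i : ℤ} (hi : σ (i + 1) = i + N) (h2 : cls N i ≠ cls N (i + 1)) :
    NC N M (link N i (i + 1) σ) := by
  have hi' : σ i = i + 1 - N := by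
    have := h.invol (i + 1); rw [hi, h.per] at this; omega
  have hMi : ¬ M (cls N i) := h.not_mark fun e => h2 (by
    have e' : i = i + 1 - N := by omega
    rw [← cls_sub_self (i + 1), ← e'])
  have hMj : ¬ M (cls N (i + 1)) := h.not_mark fun e => h2 (by
    rw [← cls_add_self i, show i + N = i + 1 by omega])
  have Ti : ∀ x, cls N x = cls N i → link N i (i + 1) σ x = x + 1 := fun x hx => by
    rw [link_apply, if_pos hx]; ring
  have Tj : ∀ x, cls N x = cls N (i + 1) → link N i (i + 1) σ x = x - 1 :=
    fun x hx => by rw [link_apply, if_neg (hx ▸ h2.symm), if_pos hx]; ring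
  have To : ∀ x, cls N x ≠ cls N i → cls N x ≠ cls N (i + 1) → link N i (i + 1) σ x = σ x :=
    fun x h1 h2 => by rw [link_apply, if_neg h1, if_neg h2]
  have hcl : ∀ x, cls N x ≠ cls N i → cls N x ≠ cls N (i + 1) →
      cls N (σ x) ≠ cls N i ∧ cls N (σ x) ≠ cls N (i + 1) := fun x x1 x2 => by
    have e1 := h.cls_ne x1
    have e2 := h.cls_ne x2
    rw [hi', cls_sub_self] at e1
    rw [hi, cls_add_self] at e2
    exact ⟨e2, e1⟩
  refine ⟨?_, link_per h.per _ _, ?_, ?_, ?_⟩ <;>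
    generalize link N i (i + 1) σ = τ at *
  · intro x
    by_cases x1 : cls N x = cls N i
    · rw [Ti x x1, Tj _ (cls_add 1 x1)]; ring
    by_cases x2 : cls N x = cls N (i + 1)
    · rw [Tj x x2, Ti _ (cls_pred x2)]; ring
    rw [To x x1 x2, To _ (hcl x x1 x2).1 (hcl x x1 x2).2, h.invol]
  · intro x hx
    rw [To, h.mark x hx] <;> intro e <;> rw [e] at hx <;> contradiction
  · intro x w hxw hwx hw
    by_cases x1 : cls N x = cls N i
    · have := Ti x x1; omega
    by_cases x2 : cls N x = cls N (i + 1)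
    · have := Tj x x2; omega
    rw [To x x1 x2] at *
    obtain ⟨n1, n2⟩ := hcl x x1 x2
    by_cases w1 : cls N w = cls N i
    · rw [Ti w w1]
      have n4 : σ x ≠ w + 1 := fun e => n2 (by rw [e]; exact cls_add 1 w1)
      omega
    by_cases w2 : cls N w = cls N (i + 1)
    · rw [Tj w w2]
      have n4 : x ≠ w - 1 := fun e => x1 (by rw [e]; exact cls_pred w2)
      omega
    rw [To w w1 w2]
    exact h.nc x w hxw hwx hw
  · intro x w hx hw mx mw
    by_cases x1 : cls N x = cls N i
    · have := Ti x x1; omega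
    by_cases x2 : cls N x = cls N (i + 1)
    · have := Tj x x2; omega
    by_cases w1 : cls N w = cls N i
    · have := Ti w w1; omega
    by_cases w2 : cls N w = cls N (i + 1)
    · have := Tj w w2; omega
    rw [To x x1 x2] at hx
    rw [To w w1 w2] at hw
    exact h.uniq x w hx hw mx mw

/-! ### Reflection -/

/-- The mirror image of a lifted link pattern. -/
def mirror (σ : ℤ → ℤ) : ℤ → ℤ := fun x => -σ (-x)

theorem mirror_mirror (σ : ℤ → ℤ) : mirror (mirror σ) = σ := by
  funext x; simp [mirror]

theorem cls_neg {N : ℕ} {x y : ℤ} : cls N (-x) = cls N (-y) ↔ cls N x = cls N y := by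
  rw [cls_eq, cls_eq, ← dvd_neg]; ring_nf

theorem cls_neg' {N : ℕ} {x y : ℤ} : cls N (-x) = cls N y ↔ cls N x = cls N (-y) := by
  rw [← cls_neg, neg_neg]

theorem mirror_link (N : ℕ) (p q : ℤ) (σ : ℤ → ℤ) :
    mirror (link N p q σ) = link N (-p) (-q) (mirror σ) := by
  funext x
  simp only [mirror]
  by_cases h1 : cls N (-x) = cls N p
  · rw [link_apply, if_pos h1, link_apply, if_pos (cls_neg'.1 h1)]; ring
  by_cases h2 : cls N (-x) = cls N q
  · rw [link_apply, if_neg h1, if_pos h2, link_apply, if_neg (mt cls_neg'.2 h1),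
      if_pos (cls_neg'.1 h2)]; ring
  rw [link_apply, if_neg h1, if_neg h2, link_apply, if_neg (mt cls_neg'.2 h1),
    if_neg (mt cls_neg'.2 h2), mirror]

theorem mirror_link3 (N : ℕ) (a b c : ℤ) (σ : ℤ → ℤ) :
    mirror (link3 N a b c σ) = link3 N (-a) (-b) (-c) (mirror σ) := by
  simp only [link3, mirror_link]

/-- The residue class of `-x`, as a function of the class of `x`. -/
def negCls {N : ℕ} (a : Cls N) : Cls N := (-(show ZMod N from a) : ZMod N)

theorem negCls_cls {N : ℕ} (x : ℤ) : negCls (cls N x) = cls N (-x) := by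
  simp only [negCls, cls]; push_cast; rfl

theorem NC.mirror {N : ℕ} {M M' : Cls N → Prop} {σ : ℤ → ℤ} (h : NC N M σ)
    (hM : ∀ x, M' (cls N x) ↔ M (cls N (-x))) : NC N M' (mirror σ) := by
  refine ⟨fun x => ?_, fun x => ?_, fun x hx => ?_, fun x w h1 h2 h3 => ?_,
    fun x w h1 h2 h3 h4 => ?_⟩ <;> simp only [QKZ.mirror, hM] at *
  · simp [h.invol]
  · have := h.per (-(x + N)); rw [show -(x + N) + N = -x by ring] at this; omega
  · rw [h.mark _ hx, neg_neg]
  · have := h.nc' (x := -x) (w := -w) (by omega) (by omega) h3; omega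
  · exact cls_neg.1 (h.uniq _ _ (by omega) (by omega) h3 h4)

namespace NCAt

variable {N : ℕ} {y : ℤ} {σ : ℤ → ℤ}

theorem mirror (h : NCAt N y σ) : NCAt N (-y) (mirror σ) := NC.mirror h fun _ => cls_neg'.symm

theorem of_mirror (h : NCAt N (-y) (QKZ.mirror σ)) : NCAt N y σ := by
  have := NCAt.mirror h; rwa [mirror_mirror, neg_neg] at this

theorem inner_mirror (h : NCAt N y σ) {o : ℤ} (ho : Inner σ y o) :
    Inner (QKZ.mirror σ) (-y) (-σ o) := by
  refine ⟨by have := ho.2.1; omega, ?_, fun x h1 h2 => ?_⟩ <;> simp only [QKZ.mirror]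
  · simpa [h.invol] using ho.1
  · have := h.inner_right ho (x := -x) (by omega) (by omega); omega

/-- Smoothing the crossing of the new line with the innermost arch `(o, c)` over it, the outer part
of the new line being joined to `c`. -/
theorem cut_right (h : NCAt N y σ) (hN : 0 < N) {o c : ℤ} (ho : Inner σ y o) (hc : σ o = c) :
    NCAt N o (link3 N y c o σ) := by
  apply of_mirror
  rw [mirror_link3]
  exact h.mirror.cut_left hN (hc ▸ h.inner_mirror ho) (by simp [QKZ.mirror, ← hc, h.invol])

theorem join_left (h : NCAt N y σ) (hN : 0 < N) {c : ℤ} (hc : σ (y - 1) = c) (h1 : c ≠ y - 1)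
    (h2 : cls N y ≠ cls N (y - 1)) : NCAt N c (link3 N y (y - 1) c σ) := by
  apply of_mirror
  rw [mirror_link3, show -(y - 1) = -y + 1 by ring]
  exact h.mirror.join_right hN (by simp [QKZ.mirror, ← hc, sub_eq_add_neg, add_comm]) (by omega)
    (by rw [show -y + 1 = -(y - 1) by ring, ne_eq, cls_neg]; exact h2)

/-- If no arch passes over the point `y`, no arch passes over its translates. -/
theorem noCross_shift (h : NCAt N y σ) (hn : NoCross σ y) {k : ℤ} (hk : cls N k = cls N y) :
    NoCross σ k := by
  intro x h1 h2
  have e := apply_of_cls h.per (x := x + (y - k)) (y := x) (cls_shift hk.symm x)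
  exact hn (x + (y - k)) (by omega) (by omega)

end NCAt

theorem NC.reconnect_defect_right {N : ℕ} {M : Cls N → Prop} {σ : ℤ → ℤ} (h : NC N M σ) (hN : 0 < N)
    {i p : ℤ} (hi : ¬ M (cls N i)) (hi' : ¬ M (cls N (i + 1))) (hd : σ (i + 1) = i + 1)
    (hp : σ i = p) (h1 : p ≠ i) (h2 : cls N i ≠ cls N (i + 1)) :
    NC N M (link3 N (i + 1) i p σ) := by
  have hm : ∀ x, M (negCls (cls N x)) ↔ M (cls N (-x)) := fun x => by rw [negCls_cls]
  have hm' : ∀ x, M (cls N x) ↔ M (negCls (cls N (-x))) := fun x => by rw [negCls_cls, neg_neg]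
  have := (h.mirror (M' := fun a => M (negCls a)) hm).reconnect_defect_left hN
    (i := -(i + 1)) (q := -p) (by rwa [← hm']) (by
      rw [show -(i + 1) + 1 = -i by ring]; rwa [← hm'])
    (by simp only [QKZ.mirror, neg_neg, hd]) (by
      simp only [QKZ.mirror]; rw [show -(-(i + 1) + 1) = i by ring, hp]) (by omega)
    (by rw [show -(i + 1) + 1 = -i by ring, ne_eq, cls_neg]; exact h2.symm)
  rw [show -(i + 1) + 1 = -i by ring, ← mirror_link3] at this
  have := this.mirror (M' := M) hm'
  rwa [mirror_mirror] at this

/-- If no arch passes over the start of the new line and there is no defect line, the new line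
becomes the defect line. -/
theorem NCAt.toDefect {N : ℕ} {y : ℤ} {σ : ℤ → ℤ} (h : NCAt N y σ) (hn : NoCross σ y)
    (hd : ∀ x, σ x = x → cls N x = cls N y) : NC N (fun _ => False) σ := by
  refine ⟨h.invol, h.per, fun _ => False.elim, fun x w h1 h2 _ => ?_, fun x w h1 h2 _ _ => ?_⟩
  · exact h.nc x w h1 h2 fun hw => (h.noCross_shift hn hw x h1 h2)
  · rw [hd x h1, hd w h2]

/-- If no arch passes over the start of the new line, it can be joined to the defect line. -/
theorem NCAt.joinDefect {N : ℕ} {y d e : ℤ} {σ : ℤ → ℤ} (h : NCAt N y σ) (hn : NoCross σ y)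
    (hd : σ d = d) (hdy : cls N d ≠ cls N y) (hed : cls N e = cls N d)
    (he : y < e + N) (he' : e < y + N) : NC N (fun _ => False) (link N y e σ) := by
  have hye : cls N y ≠ cls N e := fun e' => hdy (by rw [e', hed])
  have hee : σ e = e := by rw [apply_of_cls h.per hed, hd]; ring
  have Ty : ∀ x, cls N x = cls N y → link N y e σ x = e + (x - y) := fun x hx => by
    rw [link_apply, if_pos hx]
  have Te : ∀ x, cls N x = cls N e → link N y e σ x = y + (x - e) :=
    fun x hx => by rw [link_apply, if_neg (hx ▸ hye.symm), if_pos hx]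
  have To : ∀ x, cls N x ≠ cls N y → cls N x ≠ cls N e → link N y e σ x = σ x :=
    fun x h1 h2 => by rw [link_apply, if_neg h1, if_neg h2]
  have hcl : ∀ x, cls N x ≠ cls N y → cls N x ≠ cls N e →
      cls N (σ x) ≠ cls N y ∧ cls N (σ x) ≠ cls N e := fun x x1 x2 => by
    have e1 := h.cls_ne x1
    have e2 := h.cls_ne x2
    rw [h.fix] at e1
    rw [hee] at e2
    exact ⟨e1, e2⟩
  have cy : ∀ x k, cls N k = cls N y → x < k → k < σ x → False :=
    fun x k hk h1 h2 => h.noCross_shift hn hk x h1 h2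
  have ce : ∀ x k, cls N k = cls N e → x < k → k < σ x → False := fun x k hk h1 h2 => by
    have := h.nc x k h1 h2 (fun h => hye (by rw [← hk, h]))
    have := apply_of_cls h.per hk
    omega
  refine ⟨?_, link_per h.per _ _, fun _ => False.elim, ?_, ?_⟩ <;>
    generalize link N y e σ = τ at *
  · intro x
    by_cases x1 : cls N x = cls N y
    · rw [Ty x x1, Te _ (cls_shift x1 e)]; ring
    by_cases x2 : cls N x = cls N e
    · rw [Te x x2, Ty _ (cls_shift x2 y)]; ring
    rw [To x x1 x2, To _ (hcl x x1 x2).1 (hcl x x1 x2).2, h.invol]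
  · intro x w hxw hwx _
    have main : ∀ a b, cls N a = cls N y → cls N b = cls N e → a < w ∧ w < b ∨ b < w ∧ w < a →
        cls N w ≠ cls N y → cls N w ≠ cls N e →
        (a < σ w ∧ σ w < b ∨ b < σ w ∧ σ w < a) ∧ σ w ≠ w := fun a b ha hb hab w1 w2 => by
      obtain ⟨n1, n2⟩ := hcl w w1 w2
      have ew := h.invol w
      have c1 : ¬ (w < a ∧ a < σ w) := fun hc => cy w a ha hc.1 hc.2
      have c2 : ¬ (σ w < a ∧ a < w) := fun hc => cy (σ w) a ha hc.1 (by omega)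
      have c3 : ¬ (w < b ∧ b < σ w) := fun hc => ce w b hb hc.1 hc.2
      have c4 : ¬ (σ w < b ∧ b < w) := fun hc => ce (σ w) b hb hc.1 (by omega)
      have m1 : σ w ≠ a := fun e' => n1 (by rw [e', ha])
      have m2 : σ w ≠ b := fun e' => n2 (by rw [e', hb])
      have m3 : σ w ≠ w := fun e' => w2 (by
        rw [h.uniq w d e' hd w1 hdy, hed])
      omega
    by_cases x1 : cls N x = cls N y
    · rw [Ty x x1] at *
      by_cases w1 : cls N w = cls N y
      · have := add_le_of_cls_eq (x1.trans w1.symm) hxw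
        omega
      by_cases w2 : cls N w = cls N e
      · have := add_le_of_cls_eq (w2.trans (cls_shift x1 e).symm) hwx
        omega
      have := main x (e + (x - y)) x1 (cls_shift x1 e) (by omega) w1 w2
      rw [To w w1 w2]
      omega
    by_cases x2 : cls N x = cls N e
    · rw [Te x x2] at *
      by_cases w1 : cls N w = cls N y
      · have := add_le_of_cls_eq (w1.trans (cls_shift x2 y).symm) hwx
        omega
      by_cases w2 : cls N w = cls N e
      · have := add_le_of_cls_eq (x2.trans w2.symm) hxw
        omega
      have := main (y + (x - e)) x (cls_shift x2 y) x2 (by omega) w1 w2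
      rw [To w w1 w2]
      omega
    rw [To x x1 x2] at *
    by_cases w1 : cls N w = cls N y
    · exact (cy x w w1 hxw hwx).elim
    by_cases w2 : cls N w = cls N e
    · exact (ce x w w2 hxw hwx).elim
    rw [To w w1 w2]
    exact h.nc x w hxw hwx w1
  · have key : ∀ x, τ x ≠ x := fun x hx => by
      by_cases x1 : cls N x = cls N y
      · have := Ty x x1
        exact hye (by rw [show y = e by omega])
      by_cases x2 : cls N x = cls N e
      · have := Te x x2
        exact hye (by rw [show y = e by omega])
      rw [To x x1 x2] at hx
      exact x2 (by rw [h.uniq x d hx hd x1 hdy, hed])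
    exact fun x w hx => (key x hx).elim

/-! ### Comparison with link patterns -/

theorem NC.of_isLinkPattern {N : ℕ} {σ : ℤ → ℤ} (hN : 0 < N) (h : IsLinkPattern N σ) :
    NC N (fun _ => False) σ := by
  refine ⟨h.invol, h.periodic, fun _ => False.elim, fun x w h1 h2 _ => h.noncrossing x w h1 h2,
    fun x w hx hw _ _ => ?_⟩
  have hN' : (0 : ℤ) < N := by exact_mod_cast hN
  have key : ∀ x, σ x = x → (x % N).toNat ∈ (Finset.range N).filter (fun x : ℕ => σ x = x) := by
    intro x hx
    have h0 := Int.emod_nonneg x hN'.ne'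
    have h1 := Int.emod_lt_of_pos x hN'
    rw [Finset.mem_filter, Finset.mem_range, Int.toNat_of_nonneg h0]
    refine ⟨by omega, ?_⟩
    rw [apply_of_cls (N := N) (x := x % N) (y := x) h.periodic, hx]
    · ring
    · rw [cls_eq]; exact ⟨-(x / N), by have := Int.emod_add_mul_ediv x N; linarith⟩
  have := Finset.card_le_one.1 (h.defects.le.trans (by omega)) _ (key x hx) _ (key w hw)
  have h0 := Int.emod_nonneg x hN'.ne'
  have h1 := Int.emod_nonneg w hN'.ne'
  rw [cls_eq]
  exact Int.ModEq.dvd (show w % N = x % N by omega)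

theorem NC.isLinkPattern {N : ℕ} {σ : ℤ → ℤ} (hN : 0 < N) (h : NC N (fun _ => False) σ) :
    IsLinkPattern N σ := by
  refine ⟨by omega, h.invol, h.per, fun x w h1 h2 => h.nc x w h1 h2 (by simp), ?_⟩
  have hN' : (0 : ℤ) < N := by exact_mod_cast hN
  have hle : ((Finset.range N).filter (fun x : ℕ => σ x = x)).card ≤ 1 := by
    refine Finset.card_le_one.2 fun a ha b hb => ?_
    rw [Finset.mem_filter, Finset.mem_range] at ha hb
    have := eq_of_cls_eq (h.uniq a b ha.2 hb.2 (by simp) (by simp)) (by omega) (by omega)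
    exact_mod_cast this
  have hcls : ∀ x : ℤ, cls N (x % N) = cls N x := fun x => by
    rw [cls_eq]; exact ⟨-(x / N), by have := Int.emod_add_mul_ediv x N; linarith⟩
  have heven : ((((Finset.range N).filter (fun x : ℕ => ¬ σ x = x)).card : ℕ) : ZMod 2) = 0 := by
    rw [Finset.card_eq_sum_ones]
    push_cast
    have nn : ∀ a : ℤ, (((σ a % N).toNat : ℕ) : ℤ) = σ a % N :=
      fun a => Int.toNat_of_nonneg (Int.emod_nonneg _ hN'.ne')
    have hinv : ∀ a : ℤ, σ (σ a % N) = a + (σ a % N - σ a) := fun a => by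
      rw [apply_of_cls h.per (hcls (σ a)), h.invol]
    refine Finset.sum_involution (fun a _ => (σ a % N).toNat) ?_ ?_ ?_ ?_
    · intros; decide
    · intro a ha _ e
      rw [Finset.mem_filter] at ha
      have e' : (a : ℤ) = σ a % N := by rw [← nn]; exact_mod_cast e.symm
      have := hcls (σ a)
      rw [← e'] at this
      exact ha.2 (eq_of_cls_eq this (by have := h.sub_lt hN a; omega) (h.lt_add hN _)).symm
    · intro a ha
      rw [Finset.mem_filter, Finset.mem_range] at *
      rw [nn, hinv]
      have := Int.emod_lt_of_pos (σ a) hN'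
      have := Int.emod_nonneg (σ a) hN'.ne'
      refine ⟨by omega, by omega⟩
    · intro a ha
      rw [Finset.mem_filter, Finset.mem_range] at ha
      have : (σ ((σ a % N).toNat : ℕ) % N) = a := by
        rw [nn, hinv]
        have := Int.emod_add_mul_ediv (σ a) N
        rw [show (a + (σ a % N - σ a) : ℤ) = a + N * -(σ a / N) by linarith,
          Int.add_mul_emod_self_left]
        exact Int.emod_eq_of_lt (by omega) (by omega)
      rw [this]; simp
  have := Finset.card_filter_add_card_filter_not (s := Finset.range N) (fun x : ℕ => σ x = x)
  rw [Finset.card_range] at this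
  rw [ZMod.natCast_eq_zero_iff] at heven
  omega

/-! ### Drawing a line underneath the arches -/

theorem link_shift {N : ℕ} {s : ℤ} (hs : (N : ℤ) ∣ s) (p q : ℤ) (σ : ℤ → ℤ) :
    link N (p + s) (q + s) σ = link N p q σ := by
  have e : ∀ x r : ℤ, (N : ℤ) ∣ x - (r + s) ↔ (N : ℤ) ∣ x - r := fun x r => by
    rw [show x - r = x - (r + s) + s by ring, dvd_add_left hs]
  funext x
  simp only [link, e]
  split_ifs <;> ring

theorem link3_shift {N : ℕ} {s : ℤ} (hs : (N : ℤ) ∣ s) (a b c : ℤ) (σ : ℤ → ℤ) :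
    link3 N (a + s) (b + s) (c + s) σ = link3 N a b c σ := by
  rw [link3, link_shift hs, link_shift hs, link3]

theorem link_comm {N : ℕ} {p q : ℤ} (h : cls N p ≠ cls N q) (σ : ℤ → ℤ) :
    link N p q σ = link N q p σ := by
  funext x; simp only [link_apply]; grind

theorem apply_add_of_dvd {N : ℕ} {σ : ℤ → ℤ} (per : ∀ x, σ (x + N) = σ x + N) {s : ℤ}
    (hs : (N : ℤ) ∣ s) (x : ℤ) : σ (x + s) = σ x + s := by
  obtain ⟨k, rfl⟩ := hs
  exact apply_add_mul per x k

theorem NCAt.exists_inner {N : ℕ} {y : ℤ} {σ : ℤ → ℤ} (h : NCAt N y σ) (hc : ¬ NoCross σ y) :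
    ∃ o, Inner σ y o := by
  obtain ⟨x, hx⟩ : ∃ x, x < y ∧ y < σ x := by
    by_contra hn
    push Not at hn
    exact hc fun x h1 h2 => absurd (hn x h1) (by omega)
  obtain ⟨o, ho, hmax⟩ := Int.exists_greatest_of_bdd (P := fun x => x < y ∧ y < σ x)
    ⟨y, fun z hz => hz.1.le⟩ ⟨x, hx⟩
  refine ⟨o, ho.1, ho.2, fun z h1 h2 => ?_⟩
  have e1 : ¬ y < σ z := fun h3 => by have := hmax z ⟨h2, h3⟩; omega
  have e2 : σ z ≠ y := fun h3 => by
    have e := h.invol z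
    rw [h3, h.fix] at e; omega
  omega

theorem Inner.unique {σ : ℤ → ℤ} {y o o' : ℤ} (h : Inner σ y o) (h' : Inner σ y o') : o = o' := by
  obtain ⟨h1, h2, h3⟩ := h
  obtain ⟨h1', h2', h3'⟩ := h'
  by_contra hne
  rcases lt_or_gt_of_ne hne with hl | hl
  · have := h3 _ hl h1'; omega
  · have := h3' _ hl h1; omega

theorem Inner.not_noCross {σ : ℤ → ℤ} {y o : ℤ} (h : Inner σ y o) : ¬ NoCross σ y :=
  fun hn => hn o h.1 h.2.1

/-- All arches over `y` have length more than `N - m`. -/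
def CrossBound (N : ℕ) (m : ℕ) (σ : ℤ → ℤ) (y : ℤ) : Prop :=
  ∀ x, x < y → y < σ x → (N : ℤ) < σ x - x + m

theorem CrossBound.mono {N m m' : ℕ} {σ : ℤ → ℤ} {y : ℤ} (h : CrossBound N m σ y) (hm : m ≤ m') :
    CrossBound N m' σ y := fun x h1 h2 => by have := h x h1 h2; omega

theorem CrossBound.mirror {N m : ℕ} {σ : ℤ → ℤ} {y : ℤ} (inv : ∀ x, σ (σ x) = x)
    (h : CrossBound N m σ y) : CrossBound N m (QKZ.mirror σ) (-y) := fun x h1 h2 => by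
  simp only [QKZ.mirror] at *
  have := h (σ (-x)) (by omega) (by rw [inv]; omega)
  rw [inv] at this; omega

/-- Trivially true, the length of an arch over `y` being positive. -/
theorem NCAt.crossBound {N : ℕ} {y : ℤ} {σ : ℤ → ℤ} : CrossBound N N σ y :=
  fun x h1 h2 => by omega

theorem NCAt.noCross_of_crossBound {N : ℕ} {y : ℤ} {σ : ℤ → ℤ} (h : NCAt N y σ) (hN : 0 < N)
    (hb : CrossBound N 0 σ y) : NoCross σ y := fun x h1 h2 => by
  have := hb x h1 h2
  have := h.lt_add hN x
  push_cast at *; omega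

/-- The remaining crossings are with longer arches: an arch over the new start of the line contains
both ends of the innermost arch. -/
theorem NCAt.crossBound_cut_left {N m : ℕ} {y : ℤ} {σ : ℤ → ℤ} (h : NCAt N y σ) (hN : 0 < N)
    {o c : ℤ} (ho : Inner σ y o) (hc : σ o = c) (hb : CrossBound N (m + 1) σ y) :
    CrossBound N m (link3 N y o c σ) c := by
  subst hc
  obtain ⟨i1, i2, i3⟩ := ho
  have lo := h.lt_add hN o
  have hoc := h.invol o
  have hMo : cls N o ≠ cls N y := h.not_mark (by omega)
  have hMc : cls N (σ o) ≠ cls N y := h.not_mark (by omega)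
  have dco : cls N o ≠ cls N (σ o) := fun e => by
    have := eq_of_cls_eq e (by omega) (by omega); omega
  intro x h1 h2
  by_cases x1 : cls N x = cls N y
  · rw [link3_left hMc.symm x1] at h2; omega
  by_cases x3 : cls N x = cls N (σ o)
  · rw [link3_end x3] at h2; omega
  by_cases x2 : cls N x = cls N o
  · rw [link3_right hMo.symm dco x2] at h2
    have := add_le_of_cls_eq x2.symm (by omega)
    omega
  rw [link3_other x1 x2 x3] at *
  have e1 := h.nc o x
  have e2 := hb o i1 i2
  have e3 := i3 x
  have e4 : x ≠ y := fun e => x1 (by rw [e])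
  have e5 : x ≠ o := fun e => x2 (by rw [e])
  simp only [x1, not_false_eq_true, forall_true_left] at e1
  push_cast at *
  omega

theorem NCAt.crossBound_cut_right {N m : ℕ} {y : ℤ} {σ : ℤ → ℤ} (h : NCAt N y σ) (hN : 0 < N)
    {o c : ℤ} (ho : Inner σ y o) (hc : σ o = c) (hb : CrossBound N (m + 1) σ y) :
    CrossBound N m (link3 N y c o σ) o := by
  have := h.mirror.crossBound_cut_left hN (c := -o) (hc ▸ h.inner_mirror ho)
    (by simp [QKZ.mirror, ← hc, h.invol]) (hb.mirror h.invol)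
  rw [← mirror_link3] at this
  have := this.mirror (fun x => by
    have := (h.cut_right hN ho hc).invol (-x); simp only [QKZ.mirror, neg_neg, this])
  rwa [mirror_mirror, neg_neg] at this

/-- The link pattern with lift `τ`. -/
def IsLinkPattern.toPattern {N : ℕ} {τ : ℤ → ℤ} (h : IsLinkPattern N τ) : LinkPattern N := ⟨τ, h⟩

theorem pat_eq_single {R : Type} [CommRing R] {N : ℕ} {τ : ℤ → ℤ} (h : IsLinkPattern N τ) :
    pat R N τ = Finsupp.single h.toPattern 1 := dif_pos h

section lineUnder

variable (R : Type) [CommRing R] [Algebra ℂ R] (t₄ : ℂ) (N : ℕ)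

open Classical in
/-- The end of the new line when no arch passes over its start `y`: if there is a defect line, the
new line is joined to it in the two ways of passing the puncture; otherwise it becomes the
defect line. -/
def finishAt (σ : ℤ → ℤ) (y : ℤ) : LinkModule R N :=
  if h : ∃ d, y < d ∧ d < y + N ∧ σ d = d then
    pat R N (link N y h.choose σ) + t₄ • pat R N (link N y (h.choose - N) σ)
  else pat R N σ

open Classical in
/-- Resolve at most `k` crossings of the new line starting at `y` with the arches over it, the
innermost one first. -/
def lineUnderAux : ℕ → (ℤ → ℤ) → ℤ → LinkModule R N
  | 0, σ, y => finishAt R t₄ N σ y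
  | k + 1, σ, y =>
    if h : ∃ o, Inner σ y o then
      t₄ • lineUnderAux k (link3 N y h.choose (σ h.choose) σ) (σ h.choose)
        + t₄⁻¹ • lineUnderAux k (link3 N y (σ h.choose) h.choose σ) h.choose
    else finishAt R t₄ N σ y

/-- The vector obtained from the diagram `σ` by drawing a new line from `y` to the puncture
underneath all arches. -/
def lineUnder (σ : ℤ → ℤ) (y : ℤ) : LinkModule R N := lineUnderAux R t₄ N N σ y

variable {R t₄ N} {σ : ℤ → ℤ} {y : ℤ}

theorem lineUnderAux_inner {o c : ℤ} (ho : Inner σ y o) (hc : σ o = c) (k : ℕ) :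
    lineUnderAux R t₄ N (k + 1) σ y = t₄ • lineUnderAux R t₄ N k (link3 N y o c σ) c
        + t₄⁻¹ • lineUnderAux R t₄ N k (link3 N y c o σ) o := by
  have h : ∃ o, Inner σ y o := ⟨o, ho⟩
  rw [lineUnderAux, dif_pos h, ← ho.unique h.choose_spec, hc]

theorem lineUnderAux_noCross (hn : NoCross σ y) (k : ℕ) :
    lineUnderAux R t₄ N k σ y = finishAt R t₄ N σ y := by
  cases k with
  | zero => rfl
  | succ k => rw [lineUnderAux, dif_neg fun ⟨o, ho⟩ => ho.not_noCross hn]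

/-- The number of steps allowed is irrelevant as soon as it is large enough. -/
theorem lineUnderAux_succ (hN : 0 < N) (m : ℕ) (h : NCAt N y σ) (hb : CrossBound N m σ y) :
    lineUnderAux R t₄ N (m + 1) σ y = lineUnderAux R t₄ N m σ y := by
  by_cases hn : NoCross σ y
  · rw [lineUnderAux_noCross hn, lineUnderAux_noCross hn]
  obtain ⟨o, ho⟩ := h.exists_inner hn
  induction m generalizing σ y o with
  | zero => exact absurd (h.noCross_of_crossBound hN hb) hn
  | succ m ih =>
    have key : ∀ {σ' y'}, NCAt N y' σ' → CrossBound N m σ' y' →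
        lineUnderAux R t₄ N (m + 1) σ' y' = lineUnderAux R t₄ N m σ' y' := fun {σ' y'} h' hb' => by
      by_cases hn' : NoCross σ' y'
      · rw [lineUnderAux_noCross hn', lineUnderAux_noCross hn']
      obtain ⟨o', ho'⟩ := h'.exists_inner hn'
      exact ih h' hb' hn' o' ho'
    rw [lineUnderAux_inner ho rfl, lineUnderAux_inner ho rfl,
      key (h.cut_left hN ho rfl) (h.crossBound_cut_left hN ho rfl hb),
      key (h.cut_right hN ho rfl) (h.crossBound_cut_right hN ho rfl hb)]

theorem lineUnder_noCross (hn : NoCross σ y) : lineUnder R t₄ N σ y = finishAt R t₄ N σ y :=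
  lineUnderAux_noCross hn _

theorem lineUnder_inner (hN : 0 < N) (h : NCAt N y σ) {o c : ℤ} (ho : Inner σ y o)
    (hc : σ o = c) :
    lineUnder R t₄ N σ y = t₄ • lineUnder R t₄ N (link3 N y o c σ) c
        + t₄⁻¹ • lineUnder R t₄ N (link3 N y c o σ) o := by
  obtain ⟨k, rfl⟩ : ∃ k, N = k + 1 := ⟨N - 1, by omega⟩
  have hb : CrossBound (k + 1) (k + 1) σ y := NCAt.crossBound
  simp only [lineUnder]
  rw [lineUnderAux_inner ho hc,
    lineUnderAux_succ hN k (h.cut_left hN ho hc) (h.crossBound_cut_left hN ho hc hb),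
    lineUnderAux_succ hN k (h.cut_right hN ho hc) (h.crossBound_cut_right hN ho hc hb)]

theorem finishAt_defect (h : NCAt N y σ) {d : ℤ} (h1 : y < d) (h2 : d < y + N) (hd : σ d = d) :
    finishAt R t₄ N σ y = pat R N (link N y d σ) + t₄ • pat R N (link N y (d - N) σ) := by
  have hex : ∃ d, y < d ∧ d < y + N ∧ σ d = d := ⟨d, h1, h2, hd⟩
  have hs := hex.choose_spec
  have ne : ∀ z, y < z → z < y + N → cls N z ≠ cls N y := fun z z1 z2 e => by
    have := add_le_of_cls_eq e.symm z1; omega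
  have e : hex.choose = d := eq_of_cls_eq
    (h.uniq _ _ hs.2.2 hd (ne _ hs.1 hs.2.1) (ne _ h1 h2)) (by omega) (by omega)
  rw [finishAt, dif_pos hex, e]

theorem finishAt_none (hd : ∀ x, σ x = x → cls N x = cls N y) :
    finishAt R t₄ N σ y = pat R N σ := by
  rw [finishAt, dif_neg]
  rintro ⟨d, h1, h2, h3⟩
  have := add_le_of_cls_eq (hd d h3).symm h1
  omega

theorem NCAt.of_cls (h : NCAt N y σ) {y' : ℤ} (hy : cls N y' = cls N y) : NCAt N y' σ := by
  unfold NCAt; rwa [hy]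

theorem finishAt_shift (h : NCAt N y σ) {s : ℤ} (hs : (N : ℤ) ∣ s) :
    finishAt R t₄ N σ (y + s) = finishAt R t₄ N σ y := by
  have hc : cls N (y + s) = cls N y := by rw [cls_eq]; simpa using hs
  by_cases hd : ∃ d, y < d ∧ d < y + N ∧ σ d = d
  · obtain ⟨d, h1, h2, h3⟩ := hd
    rw [finishAt_defect h h1 h2 h3, finishAt_defect (d := d + s) (h.of_cls hc) (by omega) (by omega)
      (by rw [apply_add_of_dvd h.per hs, h3]), link_shift hs,
      show d + s - N = d - N + s by ring, link_shift hs]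
  · rw [finishAt, finishAt, dif_neg hd, dif_neg]
    rintro ⟨d, h1, h2, h3⟩
    exact hd ⟨d - s, by omega, by omega, by
      have := apply_add_of_dvd h.per hs (d - s)
      rw [sub_add_cancel, h3] at this; omega⟩

theorem NoCross.shift (h : NCAt N y σ) (hn : NoCross σ y) {s : ℤ} (hs : (N : ℤ) ∣ s) :
    NoCross σ (y + s) := h.noCross_shift hn (by rw [cls_eq]; simpa using hs)

theorem Inner.shift (per : ∀ x, σ (x + N) = σ x + N) {o : ℤ} (ho : Inner σ y o) {s : ℤ}
    (hs : (N : ℤ) ∣ s) : Inner σ (y + s) (o + s) := by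
  have e := fun x => apply_add_of_dvd per hs x
  refine ⟨by have := ho.1; omega, by have := ho.2.1; rw [e]; omega, fun x h1 h2 => ?_⟩
  have := ho.2.2 (x - s) (by omega) (by omega)
  have e' := e (x - s)
  rw [sub_add_cancel] at e'
  omega

/-- The result depends only on the marked point below `y`. -/
theorem lineUnder_shift (hN : 0 < N) (h : NCAt N y σ) {s : ℤ} (hs : (N : ℤ) ∣ s) :
    lineUnder R t₄ N σ (y + s) = lineUnder R t₄ N σ y := by
  have hc : ∀ z, cls N (z + s) = cls N z := fun z => by rw [cls_eq]; simpa using hs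
  have hb : CrossBound N N σ y := NCAt.crossBound
  suffices H : ∀ m, ∀ {σ y}, NCAt N y σ → CrossBound N m σ y →
      lineUnder R t₄ N σ (y + s) = lineUnder R t₄ N σ y from H _ h hb
  clear h hb
  intro m
  induction m with
  | zero =>
    intro σ y h hb
    have hn := h.noCross_of_crossBound hN hb
    rw [lineUnder_noCross hn, lineUnder_noCross (hn.shift h hs), finishAt_shift h hs]
  | succ m ih =>
    intro σ y h hb
    by_cases hn : NoCross σ y
    · rw [lineUnder_noCross hn, lineUnder_noCross (hn.shift h hs), finishAt_shift h hs]
    obtain ⟨o, ho⟩ := h.exists_inner hn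
    rw [lineUnder_inner hN h ho rfl, lineUnder_inner hN (h.of_cls (hc y)) (ho.shift h.per hs)
      (apply_add_of_dvd h.per hs o), link3_shift hs, link3_shift hs,
      ih (h.cut_left hN ho rfl) (h.crossBound_cut_left hN ho rfl hb),
      ih (h.cut_right hN ho rfl) (h.crossBound_cut_right hN ho rfl hb)]

/-! ### The action of the Temperley-Lieb generators in cases -/

/-- The formula for the action of the Temperley-Lieb generator on the diagram `σ`, in terms of the
vectors `F τ` of diagrams `τ`. -/
def eAt (t₄ : ℂ) {V : Type} [AddCommGroup V] [Module ℂ V] (N : ℕ) (F : (ℤ → ℤ) → V) (i : ℤ)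
    (σ : ℤ → ℤ) : V :=
  if σ i = i + 1 then loopWeight t₄ • F σ
  else if (N : ℤ) ∣ σ i - (i + 1) then punctureLoopWeight t₄ • F (link N i (i + 1) σ)
  else F (link N i (i + 1)
      (link N (if σ i = i then σ (i + 1) else σ i) (if σ (i + 1) = i + 1 then σ i else σ (i + 1)) σ))

section eAt

variable {V : Type} [AddCommGroup V] [Module ℂ V] {F : (ℤ → ℤ) → V} {M : Cls N → Prop} {i : ℤ}

theorem eAt_peak (h : σ i = i + 1) : eAt t₄ N F i σ = loopWeight t₄ • F σ := if_pos h

theorem eAt_wrap (h2 : 2 ≤ N) (h : σ i = i + 1 - N) :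
    eAt t₄ N F i σ = punctureLoopWeight t₄ • F (link N i (i + 1) σ) := by
  rw [eAt, if_neg (by omega), if_pos (by rw [h, show i + 1 - (N : ℤ) - (i + 1) = -N by ring]; simp)]

theorem eAt_arcs {p q : ℤ} (hp : σ i = p) (hq : σ (i + 1) = q) (h1 : p ≠ i) (h2 : q ≠ i + 1)
    (h3 : cls N p ≠ cls N (i + 1)) :
    eAt t₄ N F i σ = F (link N i (i + 1) (link N p q σ)) := by
  rw [eAt, hp, hq, if_neg (fun e => h3 (by rw [e])), if_neg (mt cls_eq.2 h3), if_neg h1,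
    if_neg h2]

theorem link_link_eq_link3 {a b c : ℤ} (h1 : cls N a ≠ cls N c) (h2 : cls N b ≠ cls N c) :
    link N a b (link N c c σ) = link3 N a b c σ := by
  funext x; simp only [link3, link_apply]; grind

theorem eAt_left {q : ℤ} (h4 : cls N i ≠ cls N (i + 1)) (hp : σ i = i) (hq : σ (i + 1) = q)
    (h1 : cls N q ≠ cls N i) (h2 : cls N q ≠ cls N (i + 1)) :
    eAt t₄ N F i σ = F (link3 N i (i + 1) q σ) := by
  rw [eAt, hp, hq, if_neg (by omega), if_neg (mt cls_eq.2 h4), if_pos rfl,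
    if_neg (fun e => h2 (by rw [e])), link_link_eq_link3 h1.symm h2.symm]

theorem eAt_right {p : ℤ} (hp : σ i = p) (hq : σ (i + 1) = i + 1)
    (h1 : cls N p ≠ cls N i) (h2 : cls N p ≠ cls N (i + 1)) :
    eAt t₄ N F i σ = F (link3 N i (i + 1) p σ) := by
  rw [eAt, hp, hq, if_neg (fun e => h2 (by rw [e])), if_neg (mt cls_eq.2 h2),
    if_neg (fun e => h1 (by rw [e])), if_pos rfl, link_link_eq_link3 h1.symm h2.symm]

theorem eAt_shift (per : ∀ x, σ (x + N) = σ x + N) {s : ℤ} (hs : (N : ℤ) ∣ s) :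
    eAt t₄ N F (i + s) σ = eAt t₄ N F i σ := by
  have e1 := apply_add_of_dvd per hs i
  have e2 := apply_add_of_dvd per hs (i + 1)
  have k1 : (if σ i + s = i + s then σ (i + 1) + s else σ i + s) =
      (if σ i = i then σ (i + 1) else σ i) + s := by split_ifs <;> omega
  have k2 : (if σ (i + 1) + s = i + 1 + s then σ i + s else σ (i + 1) + s) =
      (if σ (i + 1) = i + 1 then σ i else σ (i + 1)) + s := by split_ifs <;> omega
  rw [eAt, eAt, show i + s + 1 = i + 1 + s by ring, e1, e2, k1, k2, link_shift hs, link_shift hs,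
    link_shift hs]
  simp only [add_left_inj, add_sub_add_right_eq_sub]

end eAt

/-- The five possible configurations at two neighbouring points. -/
theorem NC.cases_succ {M : Cls N → Prop} (h : NC N M σ) (hN : 0 < N) {i : ℤ}
    (hi : ¬ M (cls N i)) (hi' : ¬ M (cls N (i + 1))) (h4 : cls N i ≠ cls N (i + 1)) :
    σ i = i + 1 ∨ σ i = i + 1 - N ∨
    (σ i ≠ i ∧ σ (i + 1) ≠ i + 1 ∧ cls N (σ i) ≠ cls N (i + 1)) ∨
    (σ i = i ∧ σ (i + 1) ≠ i + 1) ∨ (σ i ≠ i ∧ σ (i + 1) = i + 1) := by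
  have l1 := h.lt_add hN i
  have l2 := h.sub_lt hN i
  by_cases e : cls N (σ i) = cls N (i + 1)
  · rcases lt_trichotomy (σ i) (i + 1) with e1 | e1 | e1
    · have := add_le_of_cls_eq e e1; omega
    · omega
    · have := add_le_of_cls_eq e.symm e1; omega
  · have := h.uniq i (i + 1)
    simp only [hi, hi', h4, not_false_eq_true, forall_true_left, imp_false] at this
    tauto

theorem eOp_single (L : LinkPattern N) (a : R) (i : ℤ) :
    eOp R t₄ N i (Finsupp.single L a) = a • eAt t₄ N (pat R N) i L.1 :=
  Finsupp.linearCombination_single R a L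

theorem eOp_pat {τ : ℤ → ℤ} (h : IsLinkPattern N τ) (i : ℤ) :
    eOp R t₄ N i (pat R N τ) = eAt t₄ N (pat R N) i τ := by
  rw [pat_eq_single h, eOp_single, one_smul]; rfl

theorem eOp_shift {s : ℤ} (hs : (N : ℤ) ∣ s) (i : ℤ) :
    eOp R t₄ N (i + s) = eOp R t₄ N i := by
  unfold eOp
  congr 1
  funext L
  exact eAt_shift L.2.periodic hs

theorem eOp_smul (a : ℂ) (i : ℤ) (v : LinkModule R N) :
    eOp R t₄ N i (a • v) = a • eOp R t₄ N i v := LinearMap.map_smul_of_tower _ _ _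

end lineUnder

/-! ### A new line that meets no arch -/

section

variable {R : Type} [CommRing R] [Algebra ℂ R] {t₄ : ℂ} {N : ℕ} {σ : ℤ → ℤ} {y : ℤ}

theorem exists_lift (hN : 0 < N) (y a : ℤ) : ∃ y', cls N y' = cls N y ∧ a ≤ y' ∧ y' < a + N := by
  have hN' : (0 : ℤ) < N := by exact_mod_cast hN
  refine ⟨a + (y - a) % N, ?_, ?_, ?_⟩
  · rw [cls_eq]
    exact ⟨-((y - a) / N), by have := Int.emod_add_mul_ediv (y - a) N; linarith⟩
  · have := Int.emod_nonneg (y - a) hN'.ne'; omega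
  · have := Int.emod_lt_of_pos (y - a) hN'; omega

/-- If no arch passes over `y`, the two ends of any line lie on the same side of `y`. -/
theorem NCAt.side (h : NCAt N y σ) (hn : NoCross σ y) {x : ℤ} (hx : x ≠ y) :
    σ x < y ↔ x < y := by
  have e := h.invol x
  have n : σ x ≠ y := fun e' => hx (by rw [← e, e', h.fix])
  have c1 : ¬ (x < y ∧ y < σ x) := fun hc => hn x hc.1 hc.2
  have c2 : ¬ (σ x < y ∧ y < x) := fun hc => hn (σ x) hc.1 (by rw [e]; exact hc.2)
  omega

section preserve

variable {S : ℤ → Prop} {i p q : ℤ} (per : ∀ x, σ (x + N) = σ x + N) (inv : ∀ x, σ (σ x) = x)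
  (hS : ∀ x, S x → S (σ x)) (hi : ∀ k, cls N k = cls N i → (S k ↔ S (k + 1)))

include hi in
/-- In the lemmas of this section `S` is a set of points, such as the points on one side of `y` or
under an arch, that contains with a point the other end of its line; it still does after a
Temperley-Lieb generator has acted. -/
theorem preserve_link (hS : ∀ x, S x → cls N x ≠ cls N i → cls N x ≠ cls N (i + 1) → S (σ x))
    {x : ℤ} (hx : S x) : S (link N i (i + 1) σ x) := by
  by_cases x1 : cls N x = cls N i
  · rw [link_apply, if_pos x1, show i + 1 + (x - i) = x + 1 by ring]; exact (hi x x1).1 hx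
  by_cases x2 : cls N x = cls N (i + 1)
  · rw [link_apply, if_neg x1, if_pos x2, show i + (x - (i + 1)) = x - 1 by ring]
    exact (hi _ (cls_pred x2)).2 (by rwa [sub_add_cancel])
  rw [link_apply, if_neg x1, if_neg x2]
  exact hS x hx x1 x2

include per inv hS hi

theorem preserve_arcs (hp : σ i = p) (hq : σ (i + 1) = q) {x : ℤ} (hx : S x) :
    S (link N i (i + 1) (link N p q σ) x) := by
  have hp' : σ p = i := by rw [← hp, inv]
  have hq' : σ q = i + 1 := by rw [← hq, inv]
  refine preserve_link hi (fun x hx x1 x2 => ?_) hx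
  by_cases x3 : cls N x = cls N p
  · rw [link_apply, if_pos x3]
    have h1 := hS x hx
    rw [apply_of_cls per x3, hp'] at h1
    have h2 := hS _ ((hi _ (cls_shift x3 i)).1 h1)
    rwa [apply_of_cls per (y := i + 1) (by
      rw [show i + (x - p) + 1 = i + 1 + (x - p) by ring]; exact cls_shift x3 _), hq,
      show q + (i + (x - p) + 1 - (i + 1)) = q + (x - p) by ring] at h2
  by_cases x4 : cls N x = cls N q
  · rw [link_apply, if_neg x3, if_pos x4]
    have h1 := hS x hx
    rw [apply_of_cls per x4, hq', show i + 1 + (x - q) = i + (x - q) + 1 by ring] at h1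
    have h2 := hS _ ((hi _ (cls_shift x4 i)).2 h1)
    rwa [apply_of_cls per (cls_shift x4 i), hp,
      show p + (i + (x - q) - i) = p + (x - q) by ring] at h2
  rw [link_apply, if_neg x3, if_neg x4]
  exact hS x hx

omit per inv in
theorem preserve_defect {x : ℤ} (hx : S x) : S (link3 N i (i + 1) q σ x) := by
  by_cases x3 : cls N x = cls N q
  · rwa [link3_end x3]
  rw [link3, link_apply, if_neg x3, if_neg x3]
  exact preserve_link hi (fun x hx _ _ => hS x hx) hx

end preserve

theorem link3_comm {a b c : ℤ} (h : cls N a ≠ cls N b) : link3 N a b c σ = link3 N b a c σ := by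
  rw [link3, link_comm h, link3]

theorem NCAt.two_le (h : cls N y ≠ cls N (y + 1)) (hN : 0 < N) : 2 ≤ N := by
  by_contra h2
  obtain rfl : N = 1 := by omega
  exact h (by rw [cls_eq]; simp)

theorem NCAt.isLinkPattern_none (h : NCAt N y σ) (hN : 0 < N) (hn : NoCross σ y)
    (hd : ∀ x, σ x = x → cls N x = cls N y) : IsLinkPattern N σ :=
  (h.toDefect hn hd).isLinkPattern hN

theorem NCAt.isLinkPattern_link (h : NCAt N y σ) (hN : 0 < N) (hn : NoCross σ y)
    {d : ℤ} (hd : σ d = d) (h1 : y < d) (h2 : d < y + N) :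
    cls N d ≠ cls N y ∧ IsLinkPattern N (link N y d σ) ∧ IsLinkPattern N (link N y (d - N) σ) := by
  have hdy : cls N d ≠ cls N y := fun e => by
    have := add_le_of_cls_eq e.symm h1; omega
  exact ⟨hdy, (h.joinDefect hn hd hdy rfl (by omega) h2).isLinkPattern hN,
    (h.joinDefect hn hd hdy (cls_sub_self d) (by omega) (by omega)).isLinkPattern hN⟩

/-- Either there is no defect line, or its end has a lift between `y` and `y + N`. -/
theorem NCAt.none_or_defect (h : NCAt N y σ) (hN : 0 < N) :
    (∀ x, σ x = x → cls N x = cls N y) ∨ ∃ d, y < d ∧ d < y + N ∧ σ d = d := by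
  by_contra hc
  push Not at hc
  obtain ⟨⟨x, hx, hxy⟩, h2⟩ := hc
  obtain ⟨d, hd, h3, h4⟩ := exists_lift hN x y
  have : d ≠ y := fun e => hxy (by rw [← hd, e])
  exact h2 d (by omega) h4 (by rw [apply_of_cls h.per hd, hx]; ring)

theorem link_link_comm {a b c d : ℤ} (h1 : cls N a ≠ cls N c) (h2 : cls N a ≠ cls N d)
    (h3 : cls N b ≠ cls N c) (h4 : cls N b ≠ cls N d) :
    link N a b (link N c d σ) = link N c d (link N a b σ) := by
  funext x; simp only [link_apply]; grind

theorem link_link_fix {i p q : ℤ} (hpq : p ≠ q) {x : ℤ}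
    (hx : link N i (i + 1) (link N p q σ) x = x) : σ x = x := by
  rw [link_apply, link_apply] at hx
  split_ifs at hx <;> first | exact hx | omega

theorem link3_fix {a b c : ℤ} (hab : a ≠ b) {x : ℤ} (hx : link3 N a b c σ x = x) :
    σ x = x ∨ cls N x = cls N c := by
  rw [link3, link_apply, link_apply] at hx
  split_ifs at hx <;> first | exact Or.inl hx | (right; assumption) | omega

theorem NC.ne_of_fix {M : Cls N → Prop} (h : NC N M σ) {z x : ℤ} (hz : σ z = z)
    (hx : cls N x ≠ cls N z) : cls N (σ x) ≠ cls N z := by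
  have := h.cls_ne hx; rwa [hz] at this

theorem NC.partner_ne {M : Cls N → Prop} (h : NC N M σ) (hN : 0 < N) {x : ℤ} (hx : σ x ≠ x) :
    cls N (σ x) ≠ cls N x := fun e =>
  hx (eq_of_cls_eq e (h.lt_add hN x) (by have := h.sub_lt hN x; omega))

/-- The intertwining relation for a new line that meets no arch. -/
theorem eOp_lineUnder_of_noCross (hN : 0 < N) (h : NCAt N y σ) (hn : NoCross σ y) {i : ℤ}
    (hi : cls N i ≠ cls N y) (hi' : cls N (i + 1) ≠ cls N y) (h4 : cls N i ≠ cls N (i + 1)) :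
    eOp R t₄ N i (lineUnder R t₄ N σ y) = eAt t₄ N (fun τ => lineUnder R t₄ N τ y) i σ := by
  have h2N := NCAt.two_le h4 hN
  -- choose the lift of `i` between `y` and `y + N`
  suffices H : ∀ {i : ℤ}, cls N i ≠ cls N y → cls N (i + 1) ≠ cls N y → cls N i ≠ cls N (i + 1) →
      y < i → i + 1 < y + N →
      eOp R t₄ N i (lineUnder R t₄ N σ y) = eAt t₄ N (fun τ => lineUnder R t₄ N τ y) i σ by
    obtain ⟨j, hj, j1, j2⟩ := exists_lift hN i y
    have e1 : cls N (j + 1) = cls N (i + 1) := cls_add 1 hj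
    have n1 : j ≠ y := fun e => hi (by rw [← hj, e])
    have n2 : j + 1 ≠ y + N := fun e => hi' (by rw [← e1, e, cls_add_self])
    have := H (i := j) (by rwa [hj]) (by rwa [e1]) (by rwa [hj, e1]) (by omega) (by omega)
    have hs : (N : ℤ) ∣ j - i := cls_eq.1 hj
    rw [show j = i + (j - i) by ring, eOp_shift hs, eAt_shift h.per hs] at this
    exact this
  clear hi hi' h4 i
  intro i hi hi' h4 yi iy
  have hS : ∀ x, x < y → σ x < y := fun x hx => (h.side hn hx.ne).2 hx
  have hiS : ∀ k, cls N k = cls N i → (k < y ↔ k + 1 < y) := fun k hk => by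
    have : k + 1 ≠ y := fun e => hi' (by rw [← e]; exact (cls_add 1 hk).symm)
    omega
  have nc' : ∀ {τ : ℤ → ℤ}, (∀ x, x < y → τ x < y) → NoCross τ y :=
    fun hτ x h1 h2 => by have := hτ x h1; omega
  have nowrap : σ i ≠ i + 1 - N := fun e => hn (i + 1 - N) (by omega) (by
    have := h.invol i
    rw [e] at this; omega)
  have in1 : ∀ x, y < x → x < y + N → y < σ x ∧ σ x < y + N := fun x h1 h2 => by
    have s1 := h.side hn (x := x) (by omega)
    have s2 := NCAt.side (h.of_cls (cls_add_self y)) (hn.shift h (dvd_refl _)) (x := x) (by omega)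
    have n : σ x ≠ y := fun e => by have := h.invol x; rw [e, h.fix] at this; omega
    omega
  rw [lineUnder_noCross hn]
  rcases h.cases_succ hN (i := i) hi hi' h4 with hc | hc | ⟨c1, c2, c3⟩ | ⟨c1, c2⟩ | ⟨c1, c2⟩
  · rw [eAt_peak hc, lineUnder_noCross hn]
    rcases h.none_or_defect hN with hd | ⟨d, d1, d2, d3⟩
    · rw [finishAt_none hd, eOp_pat (h.isLinkPattern_none hN hn hd), eAt_peak hc]
    · obtain ⟨hdy, p1, p2⟩ := h.isLinkPattern_link hN hn d3 d1 d2
      have di : cls N d ≠ cls N i := fun e => by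
        have := apply_of_cls h.per e; omega
      have e1 : ∀ e, cls N e = cls N d → link N y e σ i = i + 1 := fun e he => by
        rw [link_apply, if_neg hi, if_neg (he ▸ di.symm), hc]
      rw [finishAt_defect h d1 d2 d3, map_add, eOp_smul, eOp_pat p1, eOp_pat p2,
        eAt_peak (e1 _ rfl), eAt_peak (e1 _ (cls_sub_self d)), smul_add, smul_comm t₄]
  · exact absurd hc nowrap
  · have hnc := h.reconnect_arcs hN rfl rfl hi hi' c1 c2 c3 h4
    have hno := nc' fun x hx => preserve_arcs h.per h.invol hS hiS rfl rfl hx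
    rw [eAt_arcs rfl rfl c1 c2 c3, lineUnder_noCross hno]
    rcases h.none_or_defect hN with hd | ⟨d, d1, d2, d3⟩
    · have hd' : ∀ x, link N i (i + 1) (link N (σ i) (σ (i + 1)) σ) x = x → cls N x = cls N y := by
        exact fun x hx => hd x (link_link_fix (fun e => c3 (by
          have e' := h.invol i
          have e'' := h.invol (i + 1)
          rw [e] at e'; omega)) hx)
      rw [finishAt_none hd, eOp_pat (h.isLinkPattern_none hN hn hd), eAt_arcs rfl rfl c1 c2 c3,
        finishAt_none hd']
    · obtain ⟨hdy, p1, p2⟩ := h.isLinkPattern_link hN hn d3 d1 d2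
      have di : cls N i ≠ cls N d := fun e => c1 (by
        have := apply_of_cls h.per e; omega)
      have dj : cls N (i + 1) ≠ cls N d := fun e => c2 (by
        have := apply_of_cls h.per e; omega)
      have dp := h.ne_of_fix d3 di
      have dq := h.ne_of_fix d3 dj
      have yp := h.ne_of_fix h.fix hi
      have yq := h.ne_of_fix h.fix hi'
      have dn := cls_sub_self (N := N) d
      have e1 : ∀ e z, cls N e = cls N d → cls N z ≠ cls N y → cls N z ≠ cls N d →
          link N y e σ z = σ z := fun e z he h1 h2 => by
        rw [link_apply, if_neg h1, if_neg (he ▸ h2)]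
      have e2 : ∀ e, cls N e = cls N d → link N i (i + 1) (link N (σ i) (σ (i + 1)) (link N y e σ))
          = link N y e (link N i (i + 1) (link N (σ i) (σ (i + 1)) σ)) := fun e he => by
        rw [link_link_comm (a := y) hi.symm hi'.symm (he ▸ di.symm) (he ▸ dj.symm),
          link_link_comm (a := y) yp.symm yq.symm (he ▸ dp.symm) (he ▸ dq.symm)]
      rw [finishAt_defect h d1 d2 d3, map_add, eOp_smul, eOp_pat p1, eOp_pat p2,
        eAt_arcs (e1 d i rfl hi di) (e1 d _ rfl hi' dj) c1 c2 c3,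
        eAt_arcs (e1 _ i dn hi di) (e1 _ _ dn hi' dj) c1 c2 c3,
        finishAt_defect hnc d1 d2, e2 _ rfl, e2 _ dn]
      rw [link_apply, if_neg di.symm, if_neg dj.symm, link_apply, if_neg dp.symm, if_neg dq.symm,
          d3]
  · obtain ⟨hdy, p1, p2⟩ := h.isLinkPattern_link hN hn c1 yi (by omega)
    generalize hq : σ (i + 1) = q at *
    have dq : cls N q ≠ cls N i := hq ▸ h.ne_of_fix c1 h4.symm
    have yq : cls N q ≠ cls N y := hq ▸ h.ne_of_fix h.fix hi'
    have qj : cls N q ≠ cls N (i + 1) := hq ▸ h.partner_ne hN (by rwa [hq])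
    have hnc := h.reconnect_defect_left hN hi hi' c1 hq c2 h4
    have hno : NoCross (link3 N i (i + 1) q σ) y := nc' fun x hx => preserve_defect hS hiS hx
    have hqy := in1 (i + 1) (by omega) iy
    rw [hq] at hqy
    have ni := cls_sub_self (N := N) i
    have nq := cls_sub_self (N := N) q
    have v1 : link N y i σ i = y := by rw [link_apply, if_neg hi, if_pos rfl]; ring
    have v2 : link N y (i - N) σ i = y + N := by rw [link_apply, if_neg hi, if_pos ni.symm]; ring
    have v3 : link N y i σ (i + 1) = q := by rw [link_apply, if_neg hi', if_neg h4.symm, hq]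
    have v4 : link N y (i - N) σ (i + 1) = q := by
      rw [link_apply, if_neg hi', if_neg (ni ▸ h4.symm), hq]
    have w1 : link N i (i + 1) (link N y q (link N y i σ)) =
        link N y q (link3 N i (i + 1) q σ) := by
      funext x; simp only [link3, link_apply]; grind
    have w2 : link N i (i + 1) (link N (y + N) q (link N y (i - N) σ)) =
        link N y (q - N) (link3 N i (i + 1) q σ) := by
      rw [show link N (y + N) q = link N y (q - N) by
        funext τ; rw [← link_shift (dvd_refl (N : ℤ)) y (q - N) τ, sub_add_cancel]]
      funext x; simp only [link3, link_apply]; grind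
    rw [eAt_left h4 c1 hq dq qj, lineUnder_noCross hno, finishAt_defect h yi (by omega) c1, map_add,
      eOp_smul, eOp_pat p1, eOp_pat p2, eAt_arcs v1 v3 (by omega) c2 hi'.symm,
      eAt_arcs v2 v4 (by omega) c2 (by rw [cls_add_self]; exact hi'.symm), w1, w2,
      finishAt_defect hnc hqy.1 hqy.2 (link3_end rfl)]
  · obtain ⟨hdy, p1, p2⟩ := h.isLinkPattern_link hN hn c2 (by omega) iy
    generalize hp : σ i = p at *
    have dp : cls N p ≠ cls N (i + 1) := hp ▸ h.ne_of_fix c2 h4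
    have yp : cls N p ≠ cls N y := hp ▸ h.ne_of_fix h.fix hi
    have pi : cls N p ≠ cls N i := hp ▸ h.partner_ne hN (by rwa [hp])
    have hnc := h.reconnect_defect_right hN hi hi' c2 hp c1 h4
    rw [link3_comm h4.symm] at hnc
    have hno : NoCross (link3 N i (i + 1) p σ) y := nc' fun x hx => preserve_defect hS hiS hx
    have hpy := in1 i yi (by omega)
    rw [hp] at hpy
    have ni := cls_sub_self (N := N) (i + 1)
    have np := cls_sub_self (N := N) p
    have v1 : link N y (i + 1) σ (i + 1) = y := by rw [link_apply, if_neg hi', if_pos rfl]; ring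
    have v2 : link N y (i + 1 - N) σ (i + 1) = y + N := by
      rw [link_apply, if_neg hi', if_pos ni.symm]; ring
    have v3 : link N y (i + 1) σ i = p := by rw [link_apply, if_neg hi, if_neg h4, hp]
    have v4 : link N y (i + 1 - N) σ i = p := by
      rw [link_apply, if_neg hi, if_neg (ni ▸ h4), hp]
    have w1 : link N i (i + 1) (link N p y (link N y (i + 1) σ)) =
        link N y p (link3 N i (i + 1) p σ) := by
      funext x; simp only [link3, link_apply]; grind
    have w2 : link N i (i + 1) (link N p (y + N) (link N y (i + 1 - N) σ)) =
        link N y (p - N) (link3 N i (i + 1) p σ) := by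
      rw [link_comm (p := p) (q := y + N) (by rwa [cls_add_self]), show link N (y + N) p =
          link N y (p - N) by
        funext τ; rw [← link_shift (dvd_refl (N : ℤ)) y (p - N) τ, sub_add_cancel]]
      funext x; simp only [link3, link_apply]; grind
    rw [eAt_right hp c2 pi dp, lineUnder_noCross hno, finishAt_defect h (by omega) iy c2, map_add,
      eOp_smul, eOp_pat p1, eOp_pat p2, eAt_arcs v3 v1 c1 (by omega) dp,
      eAt_arcs v4 v2 c1 (by omega) dp, w1, w2,
      finishAt_defect hnc hpy.1 hpy.2 (link3_end rfl)]

end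

section

variable {R : Type} [CommRing R] [Algebra ℂ R] {t₄ : ℂ} {N : ℕ} {σ : ℤ → ℤ} {y : ℤ}

/-- Joining a new line that meets no arch to the arch opening next to it. -/
theorem eOp_lineUnder_join_right_of_noCross (hN : 2 ≤ N) (h : NCAt N y σ) (hn : NoCross σ y)
    {c : ℤ} (hc : σ (y + 1) = c) (h1 : y + 1 < c) :
    eOp R t₄ N y (lineUnder R t₄ N σ y) = lineUnder R t₄ N (link3 N y (y + 1) c σ) c := by
  have hN0 : 0 < N := by omega
  have h4 := cls_ne_succ hN y
  have lc := h.lt_add hN0 (y + 1)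
  have hc' : σ c = y + 1 := by rw [← hc, h.invol]
  have cj : cls N c ≠ cls N (y + 1) := hc ▸ h.partner_ne hN0 (by omega)
  have cy : cls N c ≠ cls N y := hc ▸ h.ne_of_fix h.fix h4.symm
  have hnc := h.join_right hN0 hc (by omega) h4
  have hcN : c < y + N := by
    have : c ≠ y + N := fun e => cy (by rw [e, cls_add_self])
    omega
  have hno : NoCross (link3 N y (y + 1) c σ) c := by
    intro x x1 x2
    by_cases e1 : cls N x = cls N y
    · rw [link3_left cy.symm e1] at x2; omega
    by_cases e2 : cls N x = cls N (y + 1)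
    · rw [link3_right h4 cj.symm e2] at x2; omega
    by_cases e3 : cls N x = cls N c
    · rw [link3_end e3] at x2; omega
    rw [link3_other e1 e2 e3] at x2
    have a1 := h.nc x c x1 x2 cy
    have n1 : x ≠ y := fun e => e1 (by rw [e])
    exact hn x (by omega) (by omega)
  rw [lineUnder_noCross hn, lineUnder_noCross hno]
  rcases h.none_or_defect hN0 with hd | ⟨d, d1, d2, d3⟩
  · have hd' : ∀ x, link3 N y (y + 1) c σ x = x → cls N x = cls N c := by
      intro x hx
      by_contra x3
      rcases link3_fix (by omega) hx with e | e
      · rw [link3_left cy.symm (hd x e)] at hx; omega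
      · exact x3 e
    rw [finishAt_none hd, eOp_pat (h.isLinkPattern_none hN0 hn hd), eAt_left h4 h.fix hc cy cj,
      finishAt_none hd']
  · obtain ⟨hdy, p1, p2⟩ := h.isLinkPattern_link hN0 hn d3 d1 d2
    have dj : cls N (y + 1) ≠ cls N d := fun e => by
      have := apply_of_cls h.per e; omega
    have dc : cls N c ≠ cls N d := hc ▸ h.ne_of_fix d3 dj
    have cd : c < d := by
      have n1 : d ≠ y + 1 := fun e => dj (by rw [e])
      have n2 : d ≠ c := fun e => dc (by rw [e])
      by_contra hlt
      have := h.nc (y + 1) d (by omega) (by omega) hdy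
      omega
    have dn := cls_sub_self (N := N) d
    have v1 : ∀ e, cls N e = cls N d → link N y e σ y = e := fun e _ => by
      rw [link_apply, if_pos rfl]; ring
    have v2 : ∀ e, cls N e = cls N d → link N y e σ (y + 1) = c := fun e he => by
      rw [link_apply, if_neg h4.symm, if_neg (he ▸ dj), hc]
    have w : ∀ e, cls N e = cls N d → link N y (y + 1) (link N e c (link N y e σ)) =
        link N c e (link3 N y (y + 1) c σ) := fun e he => by
      rw [link_comm (p := e) (q := c) (he ▸ dc.symm)]
      funext x; simp only [link3, link_apply]; grind
    rw [finishAt_defect h d1 d2 d3, map_add, eOp_smul, eOp_pat p1, eOp_pat p2,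
      eAt_arcs (v1 d rfl) (v2 d rfl) (by omega) (by omega) dj.symm,
      eAt_arcs (v1 _ dn) (v2 _ dn) (by omega) (by omega) (dn ▸ dj.symm), w _ rfl, w _ dn,
      finishAt_defect hnc cd (by omega)]
    rw [link3_other hdy dj.symm dc.symm, d3]

theorem eOp_lineUnder_join_left_of_noCross (hN : 2 ≤ N) (h : NCAt N y σ) (hn : NoCross σ y)
    {c : ℤ} (hc : σ (y - 1) = c) (h1 : c < y - 1) :
    eOp R t₄ N (y - 1) (lineUnder R t₄ N σ y) = lineUnder R t₄ N (link3 N y (y - 1) c σ) c := by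
  have hN0 : 0 < N := by omega
  have h4 : cls N (y - 1) ≠ cls N y := by
    have := cls_ne_succ hN (y - 1); rwa [sub_add_cancel] at this
  have lc := h.sub_lt hN0 (y - 1)
  have hc' : σ c = y - 1 := by rw [← hc, h.invol]
  have cj : cls N c ≠ cls N (y - 1) := hc ▸ h.partner_ne hN0 (by omega)
  have cy : cls N c ≠ cls N y := hc ▸ h.ne_of_fix h.fix h4
  have hnc := h.join_left hN0 hc (by omega) h4.symm
  have hcN : y - N < c := by
    have : c ≠ y - N := fun e => cy (by rw [e, cls_sub_self])
    omega
  have hno : NoCross (link3 N y (y - 1) c σ) c := by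
    intro x x1 x2
    by_cases e1 : cls N x = cls N y
    · rw [link3_left cy.symm e1] at x2; omega
    by_cases e2 : cls N x = cls N (y - 1)
    · rw [link3_right h4.symm cj.symm e2] at x2
      have : x = c - 1 + 1 - 1 := by omega
      omega
    by_cases e3 : cls N x = cls N c
    · rw [link3_end e3] at x2; omega
    rw [link3_other e1 e2 e3] at x2
    have a1 := h.nc x c x1 x2 cy
    have n1 : σ x ≠ y := fun e => e1 (by rw [← h.invol x, e, h.fix])
    exact hn x (by omega) (by omega)
  have hy : y - 1 + 1 = y := by ring
  have fy : σ (y - 1 + 1) = y - 1 + 1 := by rw [hy, h.fix]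
  have q1 : link3 N (y - 1) (y - 1 + 1) c σ = link3 N y (y - 1) c σ := by
    rw [hy, link3_comm h4]
  rw [lineUnder_noCross hn, lineUnder_noCross hno]
  rcases h.none_or_defect hN0 with hd | ⟨d, d1, d2, d3⟩
  · have hd' : ∀ x, link3 N y (y - 1) c σ x = x → cls N x = cls N c := by
      intro x hx
      by_contra x3
      rcases link3_fix (by omega) hx with e | e
      · rw [link3_left cy.symm (hd x e)] at hx; omega
      · exact x3 e
    rw [finishAt_none hd, eOp_pat (h.isLinkPattern_none hN0 hn hd), eAt_right hc fy cj
      (by rwa [hy]), q1, finishAt_none hd']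
  · obtain ⟨hdy, p1, p2⟩ := h.isLinkPattern_link hN0 hn d3 d1 d2
    have dj : cls N (y - 1) ≠ cls N d := fun e => by
      have := apply_of_cls h.per e; omega
    have dc : cls N c ≠ cls N d := hc ▸ h.ne_of_fix d3 dj
    have dn := cls_sub_self (N := N) d
    have fd : σ (d - N) = d - N := by rw [apply_of_cls h.per dn, d3]; ring
    have cd : d - N < c := by
      have n1 : d - N ≠ y - 1 := fun e => dj (by rw [← dn, e])
      have n2 : d - N ≠ c := fun e => dc (by rw [← dn, e])
      by_contra hlt
      have := h.nc' (x := y - 1) (w := d - N) (by omega) (by omega) (dn ▸ hdy)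
      omega
    have v1 : ∀ e, cls N e = cls N d → link N y e σ (y - 1 + 1) = e := fun e _ => by
      rw [hy, link_apply, if_pos rfl]; ring
    have v2 : ∀ e, cls N e = cls N d → link N y e σ (y - 1) = c := fun e he => by
      rw [link_apply, if_neg h4, if_neg (he ▸ dj), hc]
    have w : ∀ e, cls N e = cls N d → link N (y - 1) (y - 1 + 1) (link N c e (link N y e σ)) =
        link N c e (link3 N y (y - 1) c σ) := fun e he => by
      rw [hy]
      funext x; simp only [link3, link_apply]; grind
    rw [finishAt_defect h d1 d2 d3, map_add, eOp_smul, eOp_pat p1, eOp_pat p2,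
      eAt_arcs (v2 d rfl) (v1 d rfl) (by omega) (by omega) (by rwa [hy]),
      eAt_arcs (v2 _ dn) (v1 _ dn) (by omega) (by omega) (by rwa [hy]), w _ rfl, w _ dn,
      finishAt_defect hnc (d := d) (by omega) (by omega)]
    rw [link3_other hdy dj.symm dc.symm, d3]

variable (R t₄ N) in
/-- The relations between the new line and the Temperley-Lieb generators, for diagrams in which all
arches over the start of the new line have length more than `N - m`. -/
structure LineRelations (m : ℕ) : Prop where
  intertwine : ∀ {σ y i}, NCAt N y σ → CrossBound N m σ y → cls N i ≠ cls N y →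
    cls N (i + 1) ≠ cls N y →
    eOp R t₄ N i (lineUnder R t₄ N σ y) = eAt t₄ N (fun τ => lineUnder R t₄ N τ y) i σ
  join_right : ∀ {σ y c}, NCAt N y σ → CrossBound N m σ y → σ (y + 1) = c → y + 1 < c →
    eOp R t₄ N y (lineUnder R t₄ N σ y) = lineUnder R t₄ N (link3 N y (y + 1) c σ) c
  join_left : ∀ {σ y c}, NCAt N y σ → CrossBound N m σ y → σ (y - 1) = c → c < y - 1 →
    eOp R t₄ N (y - 1) (lineUnder R t₄ N σ y) = lineUnder R t₄ N (link3 N y (y - 1) c σ) c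

/-! ### Curls and joins at the innermost arch -/

/-- Consequences of `(o, c)` being the innermost arch over the start `y` of the new line. -/
structure InnerFacts (N : ℕ) (σ : ℤ → ℤ) (y o c : ℤ) : Prop where
  oy : cls N o ≠ cls N y
  cy : cls N c ≠ cls N y
  oc : cls N o ≠ cls N c
  co : σ c = o
  lt : c < o + N
  lt₁ : o < y
  lt₂ : y < c

theorem NCAt.innerFacts (h : NCAt N y σ) (hN : 0 < N) {o c : ℤ} (ho : Inner σ y o) (hc : σ o = c) :
    InnerFacts N σ y o c := by
  subst hc
  have h1 := ho.1
  have h2 := ho.2.1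
  have h3 := h.lt_add hN o
  have h4 := h.invol o
  exact ⟨h.not_mark (by omega), h.not_mark (by omega), (h.partner_ne hN (by omega)).symm, h4,
    h3, h1, h2⟩

/-- A new line joined to the end of the innermost arch over it: the curl is removed at the cost of
a factor. -/
theorem LineRelations.curl_right (H : LineRelations R t₄ N m) (ht : t₄ ≠ 0) (hN : 2 ≤ N)
    (h : NCAt N y σ) (hb : CrossBound N (m + 1) σ y) {c : ℤ} (hc : σ (y + 1) = c) (h1 : c < y) :
    eOp R t₄ N y (lineUnder R t₄ N σ y) =
      (-(t₄ ^ 3)⁻¹) • lineUnder R t₄ N (link3 N y (y + 1) c σ) c := by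
  have hN0 : 0 < N := by omega
  have h4 := cls_ne_succ hN y
  have hc' : σ c = y + 1 := by rw [← hc, h.invol]
  have ho : Inner σ y c := by
    refine ⟨h1, by omega, fun x x1 x2 => ?_⟩
    have hx : cls N x ≠ cls N y := fun e => by
      have := add_le_of_cls_eq e x2
      have := h.lt_add hN0 c
      have : c + N ≠ y + 1 := fun e => by
        have := h.invol (y + 1)
        have e2 := h.per c
        omega
      omega
    have := h.nc c x x1 (by omega) hx
    have n : σ x ≠ y := fun e => hx (by rw [← h.invol x, e, h.fix])
    omega
  have F := h.innerFacts hN0 ho hc'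
  have n1 := h.cut_left hN0 ho hc'
  have n2 := h.cut_right hN0 ho hc'
  have b1 := h.crossBound_cut_left hN0 ho hc' hb
  have b2 := h.crossBound_cut_right hN0 ho hc' hb
  -- one smoothing joins the line to the arch and the other one gives a loop: in total, a factor
  -- `t₄ + t₄⁻¹ * loopWeight t₄`
  have e1 := H.join_left n1 b1 (c := c) (by
    rw [show y + 1 - 1 = y by ring, link3_left h4 rfl]; ring) (by omega)
  have e2 := H.intertwine n2 b2 (i := y) F.oy.symm F.oc.symm
  rw [eAt_peak (by rw [link3_left F.oy.symm rfl]; ring)] at e2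
  rw [show y + 1 - 1 = y by ring] at e1
  have w : link3 N (y + 1) y c (link3 N y c (y + 1) σ) = link3 N y (y + 1) c σ := by
    have f1 := F.oy
    have f2 := F.oc
    funext x; simp only [link3, link_apply]; grind
  rw [lineUnder_inner hN0 h ho hc', map_add, eOp_smul, eOp_smul, e1, e2, w, smul_smul, ← add_smul]
  congr 1
  rw [loopWeight]; field_simp; ring

theorem LineRelations.curl_left (H : LineRelations R t₄ N m) (ht : t₄ ≠ 0) (hN : 2 ≤ N)
    (h : NCAt N y σ) (hb : CrossBound N (m + 1) σ y) {c : ℤ} (hc : σ (y - 1) = c) (h1 : y < c) :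
    eOp R t₄ N (y - 1) (lineUnder R t₄ N σ y) =
      (-t₄ ^ 3) • lineUnder R t₄ N (link3 N y (y - 1) c σ) c := by
  have hN0 : 0 < N := by omega
  have hy : y - 1 + 1 = y := by ring
  have h4 : cls N (y - 1) ≠ cls N y := by
    have := cls_ne_succ hN (y - 1); rwa [hy] at this
  have ho : Inner σ y (y - 1) := ⟨by omega, by omega, fun x x1 x2 => by omega⟩
  have F := h.innerFacts hN0 ho hc
  have n1 := h.cut_left hN0 ho hc
  have n2 := h.cut_right hN0 ho hc
  have b1 := h.crossBound_cut_left hN0 ho hc hb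
  have b2 := h.crossBound_cut_right hN0 ho hc hb
  -- one smoothing gives a loop and the other one joins the line to the arch: in total, a factor
  -- `t₄ * loopWeight t₄ + t₄⁻¹`
  have e1 := H.intertwine n1 b1 (i := y - 1) F.oc (by rw [hy]; exact F.cy.symm)
  have e2 := H.join_right n2 b2 (c := c) (by
    rw [hy, link3_left h4.symm rfl]; ring) (by omega)
  rw [eAt_peak (by rw [link3_right h4.symm F.oc rfl]; ring)] at e1
  rw [hy] at e2
  have w : link3 N (y - 1) y c (link3 N y c (y - 1) σ) = link3 N y (y - 1) c σ := by
    have f1 := F.cy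
    have f2 := F.oc
    funext x; simp only [link3, link_apply]; grind
  rw [lineUnder_inner hN0 h ho hc, map_add, eOp_smul, eOp_smul, e1, e2, w, smul_smul, ← add_smul]
  congr 1
  rw [loopWeight]; field_simp; ring

/-- The arch opening at `y + 1` lies under the innermost arch over `y`.  Joining the new line to it
moves the start of the line under that arch, and this commutes with smoothing the crossing. -/
theorem LineRelations.step_join_right (H : LineRelations R t₄ N m) (hN : 2 ≤ N)
    (h : NCAt N y σ) (hb : CrossBound N (m + 1) σ y) {c : ℤ} (hc : σ (y + 1) = c) (h1 : y + 1 < c) :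
    eOp R t₄ N y (lineUnder R t₄ N σ y) = lineUnder R t₄ N (link3 N y (y + 1) c σ) c := by
  have hN0 : 0 < N := by omega
  have h4 := cls_ne_succ hN y
  by_cases hn : NoCross σ y
  · exact eOp_lineUnder_join_right_of_noCross hN h hn hc h1
  obtain ⟨o, ho⟩ := h.exists_inner hn
  obtain ⟨c', hc'⟩ : ∃ c', σ o = c' := ⟨_, rfl⟩
  have F := h.innerFacts hN0 ho hc'
  obtain ⟨f1, f2, f3, f4, f5, f6, f7⟩ := F
  have hcc : σ c = y + 1 := by rw [← hc, h.invol]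
  have g1 := h.inner_right ho (x := y + 1) (by omega)
  have jc : y + 1 ≠ c' := fun e => by rw [← e, hc] at f4; omega
  have lc : c < c' := by
    have := (h.nc o (y + 1) (by omega) (by omega) h4.symm); omega
  have dj : cls N c ≠ cls N (y + 1) := hc ▸ h.partner_ne hN0 (by omega)
  have dy : cls N c ≠ cls N y := hc ▸ h.ne_of_fix h.fix h4.symm
  have ne : ∀ a b : ℤ, o ≤ a → a < b → b ≤ c' → cls N a ≠ cls N b := fun a b h1 h2 h3 e => by
    have := add_le_of_cls_eq e h2; omega
  have oj := ne o (y + 1) le_rfl (by omega) (by omega)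
  have jc' := ne (y + 1) c' (by omega) (by omega) le_rfl
  have oc := ne o c le_rfl (by omega) (by omega)
  have cc' := ne c c' (by omega) lc le_rfl
  have n1 := h.cut_left hN0 ho hc'
  have n2 := h.cut_right hN0 ho hc'
  have b1 := h.crossBound_cut_left hN0 ho hc' hb
  have b2 := h.crossBound_cut_right hN0 ho hc' hb
  have e1 := H.intertwine n1 b1 (i := y) f2.symm jc'
  have e2 := H.intertwine n2 b2 (i := y) f1.symm oj.symm
  rw [eAt_arcs (p := o) (q := c) (by rw [link3_left f2.symm rfl]; ring)
    (by rw [link3_other h4.symm oj.symm jc', hc]) (by omega) (by omega) oj] at e1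
  rw [eAt_arcs (p := c') (q := c) (by rw [link3_left f1.symm rfl]; ring)
    (by rw [link3_other h4.symm jc' oj.symm, hc]) (by omega) (by omega) jc'.symm] at e2
  have hJ := h.join_right hN0 hc (by omega) h4
  have hoJ : link3 N y (y + 1) c σ o = c' := by rw [link3_other f1 oj oc, hc']
  have hin : Inner (link3 N y (y + 1) c σ) c o := by
    refine ⟨by omega, by omega, fun x x1 x2 => ?_⟩
    rcases lt_trichotomy x y with l | l | l
    · rw [link3_other (ne x y (by omega) l (by omega))
          (ne x (y + 1) (by omega) (by omega) (by omega))
        (ne x c (by omega) (by omega) (by omega))]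
      have := ho.2.2 x x1 l
      omega
    · rw [l, link3_left dy.symm rfl]; omega
    · rcases eq_or_lt_of_le (show y + 1 ≤ x by omega) with l' | l'
      · rw [← l', link3_right h4 dj.symm rfl]; omega
      · rw [link3_other (ne y x (by omega) l (by omega)).symm
          (ne (y + 1) x (by omega) l' (by omega)).symm (ne x c (by omega) (by omega) (by omega))]
        have := h.nc (y + 1) x l' (by omega) (ne y x (by omega) l (by omega)).symm
        omega
  have w1 : link N y (y + 1) (link N o c (link3 N y o c' σ)) =
      link3 N c o c' (link3 N y (y + 1) c σ) := by
    funext x; simp only [link3, link_apply]; grind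
  have w2 : link N y (y + 1) (link N c' c (link3 N y c' o σ)) =
      link3 N c c' o (link3 N y (y + 1) c σ) := by
    funext x; simp only [link3, link_apply]; grind
  rw [lineUnder_inner hN0 h ho hc', map_add, eOp_smul, eOp_smul, e1, e2, w1, w2,
    lineUnder_inner hN0 hJ hin hoJ]

theorem LineRelations.step_join_left (H : LineRelations R t₄ N m) (hN : 2 ≤ N)
    (h : NCAt N y σ) (hb : CrossBound N (m + 1) σ y) {c : ℤ} (hc : σ (y - 1) = c) (h1 : c < y - 1) :
    eOp R t₄ N (y - 1) (lineUnder R t₄ N σ y) = lineUnder R t₄ N (link3 N y (y - 1) c σ) c := by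
  have hN0 : 0 < N := by omega
  have hy : y - 1 + 1 = y := by ring
  have h4 : cls N (y - 1) ≠ cls N y := by
    have := cls_ne_succ hN (y - 1); rwa [hy] at this
  by_cases hn : NoCross σ y
  · exact eOp_lineUnder_join_left_of_noCross hN h hn hc h1
  obtain ⟨o, ho⟩ := h.exists_inner hn
  obtain ⟨c', hc'⟩ : ∃ c', σ o = c' := ⟨_, rfl⟩
  have F := h.innerFacts hN0 ho hc'
  obtain ⟨f1, f2, f3, f4, f5, f6, f7⟩ := F
  have hcc : σ c = y - 1 := by rw [← hc, h.invol]
  have oj' : o ≠ y - 1 := fun e => by rw [← e, hc'] at hc; omega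
  have lc : o < c := by
    have := (h.nc o (y - 1) (by omega) (by omega) h4); omega
  have dj : cls N c ≠ cls N (y - 1) := hc ▸ h.partner_ne hN0 (by omega)
  have dy : cls N c ≠ cls N y := hc ▸ h.ne_of_fix h.fix h4
  have ne : ∀ a b : ℤ, o ≤ a → a < b → b ≤ c' → cls N a ≠ cls N b := fun a b h1 h2 h3 e => by
    have := add_le_of_cls_eq e h2; omega
  have oj := ne o (y - 1) le_rfl (by omega) (by omega)
  have jc' := ne (y - 1) c' (by omega) (by omega) le_rfl
  have oc := ne o c le_rfl (by omega) (by omega)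
  have cc' := ne c c' (by omega) (by omega) le_rfl
  have n1 := h.cut_left hN0 ho hc'
  have n2 := h.cut_right hN0 ho hc'
  have b1 := h.crossBound_cut_left hN0 ho hc' hb
  have b2 := h.crossBound_cut_right hN0 ho hc' hb
  have e1 := H.intertwine n1 b1 (i := y - 1) jc' (by rw [hy]; exact f2.symm)
  have e2 := H.intertwine n2 b2 (i := y - 1) oj.symm (by rw [hy]; exact f1.symm)
  rw [eAt_arcs (p := c) (q := o) (by rw [link3_other h4 oj.symm jc', hc])
    (by rw [hy, link3_left f2.symm rfl]; ring) (by omega) (by omega) (by rwa [hy]), hy] at e1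
  rw [eAt_arcs (p := c) (q := c') (by rw [link3_other h4 jc' oj.symm, hc])
    (by rw [hy, link3_left f1.symm rfl]; ring) (by omega) (by omega) (by rwa [hy]), hy] at e2
  have hJ := h.join_left hN0 hc (by omega) h4.symm
  have hoJ : link3 N y (y - 1) c σ o = c' := by rw [link3_other f1 oj oc, hc']
  have hin : Inner (link3 N y (y - 1) c σ) c o := by
    refine ⟨by omega, by omega, fun x x1 x2 => ?_⟩
    rw [link3_other (ne x y (by omega) (by omega) (by omega))
      (ne x (y - 1) (by omega) (by omega) (by omega)) (ne x c (by omega) (by omega) (by omega))]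
    have a1 := ho.2.2 x x1 (by omega)
    have a2 := h.nc' (x := y - 1) (w := σ x)
    rw [h.invol] at a2
    have a3 : cls N (σ x) ≠ cls N y := h.ne_of_fix h.fix (ne x y (by omega) (by omega) (by omega))
    have a4 : σ x ≠ c := fun e => by have := h.invol x; rw [e, hcc] at this; omega
    have a5 : σ x ≠ y - 1 := fun e => by have := h.invol x; rw [e, hc] at this; omega
    have := a2
    by_contra hlt
    have := a2 (by omega) (by omega) a3
    omega
  have w1 : link N (y - 1) y (link N c o (link3 N y o c' σ)) =
      link3 N c o c' (link3 N y (y - 1) c σ) := by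
    funext x; simp only [link3, link_apply]; grind
  have w2 : link N (y - 1) y (link N c c' (link3 N y c' o σ)) =
      link3 N c c' o (link3 N y (y - 1) c σ) := by
    funext x; simp only [link3, link_apply]; grind
  rw [lineUnder_inner hN0 h ho hc', map_add, eOp_smul, eOp_smul, e1, e2, w1, w2,
    lineUnder_inner hN0 hJ hin hoJ]

end

/-! ### Generators away from the innermost arch -/

section

variable {R : Type} [CommRing R] [Algebra ℂ R] {t₄ : ℂ} {N m : ℕ} {σ : ℤ → ℤ} {y : ℤ}

/-- Reconnections of disjoint sets of points commute. -/
theorem link_link3_comm {p q a b c : ℤ} (pa : cls N p ≠ cls N a) (pb : cls N p ≠ cls N b)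
    (pc : cls N p ≠ cls N c) (qa : cls N q ≠ cls N a) (qb : cls N q ≠ cls N b)
    (qc : cls N q ≠ cls N c) :
    link N p q (link3 N a b c σ) = link3 N a b c (link N p q σ) := by
  rw [link3, link3, link_link_comm pc pc qc qc, link_link_comm pa pb qa qb]

theorem link3_link3_comm {p q r a b c : ℤ} (pa : cls N p ≠ cls N a) (pb : cls N p ≠ cls N b)
    (pc : cls N p ≠ cls N c) (qa : cls N q ≠ cls N a) (qb : cls N q ≠ cls N b)
    (qc : cls N q ≠ cls N c) (ra : cls N r ≠ cls N a) (rb : cls N r ≠ cls N b)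
    (rc : cls N r ≠ cls N c) :
    link3 N p q r (link3 N a b c σ) = link3 N a b c (link3 N p q r σ) := by
  rw [link3.eq_1 N p q r (link3 N a b c σ), link_link3_comm pa pb pc qa qb qc,
      link_link3_comm ra rb rc ra rb rc]; rfl

/-- If a Temperley-Lieb generator acts far from the innermost arch over the new line, its action
commutes with the two smoothings of the crossing. -/
theorem LineRelations.intertwine_of_cut (H : LineRelations R t₄ N m) (hN : 0 < N)
    (h : NCAt N y σ) (hb : CrossBound N (m + 1) σ y) {o c i : ℤ} (ho : Inner σ y o) (hc : σ o = c)
    (io : cls N i ≠ cls N o) (ic : cls N i ≠ cls N c) (jo : cls N (i + 1) ≠ cls N o)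
    (jc : cls N (i + 1) ≠ cls N c) {σ' : ℤ → ℤ} {a : ℂ}
    (e0 : eAt t₄ N (fun τ => lineUnder R t₄ N τ y) i σ = a • lineUnder R t₄ N σ' y)
    (e1 : eAt t₄ N (fun τ => lineUnder R t₄ N τ c) i (link3 N y o c σ) =
      a • lineUnder R t₄ N (link3 N y o c σ') c)
    (e2 : eAt t₄ N (fun τ => lineUnder R t₄ N τ o) i (link3 N y c o σ) =
      a • lineUnder R t₄ N (link3 N y c o σ') o)
    (h' : NCAt N y σ') (hS : ∀ x, (o < x ∧ x < y) → (o < σ' x ∧ σ' x < y)) (hc' : σ' o = c) :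
    eOp R t₄ N i (lineUnder R t₄ N σ y) = eAt t₄ N (fun τ => lineUnder R t₄ N τ y) i σ := by
  have hin : Inner σ' y o := ⟨ho.1, by rw [hc', ← hc]; exact ho.2.1, fun x h1 h2 => (hS x ⟨h1, h2⟩).2⟩
  rw [lineUnder_inner hN h ho hc, map_add, eOp_smul, eOp_smul,
    H.intertwine (h.cut_left hN ho hc) (h.crossBound_cut_left hN ho hc hb) ic jc,
    H.intertwine (h.cut_right hN ho hc) (h.crossBound_cut_right hN ho hc hb) io jo,
    e0, e1, e2, lineUnder_inner hN h' hin hc', smul_add, smul_comm a, smul_comm a]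

/-- The intertwining relation for a generator that does not touch the innermost arch over the new
line. -/
theorem LineRelations.step_intertwine_far (H : LineRelations R t₄ N m) (hN : 2 ≤ N)
    (h : NCAt N y σ) (hb : CrossBound N (m + 1) σ y) {o c i : ℤ} (ho : Inner σ y o) (hc : σ o = c)
    (iy : cls N i ≠ cls N y) (jy : cls N (i + 1) ≠ cls N y)
    (io : cls N i ≠ cls N o) (ic : cls N i ≠ cls N c) (jo : cls N (i + 1) ≠ cls N o)
    (jc : cls N (i + 1) ≠ cls N c) :
    eOp R t₄ N i (lineUnder R t₄ N σ y) = eAt t₄ N (fun τ => lineUnder R t₄ N τ y) i σ := by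
  have hN0 : 0 < N := by omega
  have h4 := cls_ne_succ hN i
  obtain ⟨f1, f2, f3, f4, f5, f6, f7⟩ := h.innerFacts hN0 ho hc
  have key := fun (σ' : ℤ → ℤ) (a : ℂ) => H.intertwine_of_cut hN0 h hb ho hc io ic jo jc (σ' := σ')
    (a := a)
  have hSi : ∀ k, cls N k = cls N i → ((o < k ∧ k < y) ↔ (o < k + 1 ∧ k + 1 < y)) := by
    intro k hk
    have n1 : k + 1 ≠ y := fun e => jy (by rw [← e]; exact (cls_add 1 hk).symm)
    have n2 : k ≠ o := fun e => io (by rw [← hk, e])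
    omega
  have hSσ : ∀ x, (o < x ∧ x < y) → (o < σ x ∧ σ x < y) := by
    intro x hx
    have := h.nc o x hx.1 (by omega) (fun e => by
      have := add_le_of_cls_eq e hx.2; omega)
    exact ⟨this.1, ho.2.2 x hx.1 hx.2⟩
  have g1 : link3 N y o c σ i = σ i := link3_other iy io ic
  have g1' : link3 N y o c σ (i + 1) = σ (i + 1) := link3_other jy jo jc
  have g2 : link3 N y c o σ i = σ i := link3_other iy ic io
  have g2' : link3 N y c o σ (i + 1) = σ (i + 1) := link3_other jy jc jo
  have ppy : cls N (σ i) ≠ cls N y := h.ne_of_fix h.fix iy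
  have ppo : cls N (σ i) ≠ cls N o := f4 ▸ h.cls_ne ic
  have ppc : cls N (σ i) ≠ cls N c := hc ▸ h.cls_ne io
  have pqy : cls N (σ (i + 1)) ≠ cls N y := h.ne_of_fix h.fix jy
  have pqo : cls N (σ (i + 1)) ≠ cls N o := f4 ▸ h.cls_ne jc
  have pqc : cls N (σ (i + 1)) ≠ cls N c := hc ▸ h.cls_ne jo
  have qi := h.invol i
  have qi' := h.invol (i + 1)
  rcases h.cases_succ hN0 iy jy h4 with hk | hk | ⟨k1, k2, k3⟩ | ⟨k1, k2⟩ | ⟨k1, k2⟩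
  · refine key σ (loopWeight t₄) (eAt_peak hk) (eAt_peak (by rw [g1, hk]))
        (eAt_peak (by rw [g2, hk]))
      h hSσ hc
  · have hk' : σ (i + 1) = i + N := by
      have := h.per (σ i); rw [qi, hk] at this
      rw [← this]; congr 1; ring
    refine key (link N i (i + 1) σ) (punctureLoopWeight t₄) (eAt_wrap hN hk) ?_ ?_ (h.unwrap hk' h4)
      ?_ ?_
    · rw [eAt_wrap hN (by rw [g1, hk])]; rw [link_link3_comm iy io ic jy jo jc]
    · rw [eAt_wrap hN (by rw [g2, hk])]; rw [link_link3_comm iy ic io jy jc jo]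
    · intro x hx
      exact preserve_link (S := fun x => o < x ∧ x < y) hSi (fun x hx _ _ => hSσ x hx) hx
    · rw [link_apply, if_neg io.symm, if_neg jo.symm, hc]
  · obtain ⟨p, hp⟩ : ∃ p, σ i = p := ⟨_, rfl⟩
    obtain ⟨q, hq⟩ : ∃ q, σ (i + 1) = q := ⟨_, rfl⟩
    rw [hp] at k1 k3 ppy ppo ppc
    rw [hq] at k2 pqy pqo pqc
    refine key (link N i (i + 1) (link N p q σ)) 1 ?_ ?_ ?_
        (h.reconnect_arcs hN0 hp hq iy jy k1 k2 k3 h4)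
      ?_ ?_
    · rw [eAt_arcs hp hq k1 k2 k3, one_smul]
    · rw [eAt_arcs (g1.trans hp) (g1'.trans hq) k1 k2 k3, one_smul]
      rw [link_link3_comm ppy ppo ppc pqy pqo pqc, link_link3_comm iy io ic jy jo jc]
    · rw [eAt_arcs (g2.trans hp) (g2'.trans hq) k1 k2 k3, one_smul]
      rw [link_link3_comm ppy ppc ppo pqy pqc pqo, link_link3_comm iy ic io jy jc jo]
    · intro x hx
      exact preserve_arcs (S := fun x => o < x ∧ x < y) h.per h.invol hSσ hSi hp hq hx
    · rw [link_apply, if_neg io.symm, if_neg jo.symm, link_apply, if_neg ppo.symm, if_neg pqo.symm,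
        hc]
  · obtain ⟨q, hq⟩ : ∃ q, σ (i + 1) = q := ⟨_, rfl⟩
    have qd : cls N q ≠ cls N (i + 1) := hq ▸ h.partner_ne hN0 k2
    have qi2 : cls N q ≠ cls N i := hq ▸ h.ne_of_fix k1 h4.symm
    rw [hq] at k2 pqy pqo pqc
    refine key (link3 N i (i + 1) q σ) 1 ?_ ?_ ?_ (h.reconnect_defect_left hN0 iy jy k1 hq k2 h4)
        ?_ ?_
    · rw [eAt_left h4 k1 hq qi2 qd, one_smul]
    · rw [eAt_left h4 (g1.trans k1) (g1'.trans hq) qi2 qd, one_smul]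
      rw [link3_link3_comm iy io ic jy jo jc pqy pqo pqc]
    · rw [eAt_left h4 (g2.trans k1) (g2'.trans hq) qi2 qd, one_smul]
      rw [link3_link3_comm iy ic io jy jc jo pqy pqc pqo]
    · intro x hx
      exact preserve_defect (S := fun x => o < x ∧ x < y) hSσ hSi hx
    · rw [link3_other io.symm jo.symm pqo.symm, hc]
  · obtain ⟨p, hp⟩ : ∃ p, σ i = p := ⟨_, rfl⟩
    have pd : cls N p ≠ cls N (i + 1) := hp ▸ h.ne_of_fix k2 h4
    have pi2 : cls N p ≠ cls N i := hp ▸ h.partner_ne hN0 k1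
    rw [hp] at k1 ppy ppo ppc
    have hd := h.reconnect_defect_right hN0 iy jy k2 hp k1 h4
    rw [link3_comm h4.symm] at hd
    refine key (link3 N i (i + 1) p σ) 1 ?_ ?_ ?_ hd ?_ ?_
    · rw [eAt_right hp k2 pi2 pd, one_smul]
    · rw [eAt_right (g1.trans hp) (g1'.trans k2) pi2 pd, one_smul]
      rw [link3_link3_comm iy io ic jy jo jc ppy ppo ppc]
    · rw [eAt_right (g2.trans hp) (g2'.trans k2) pi2 pd, one_smul]
      rw [link3_link3_comm iy ic io jy jc jo ppy ppc ppo]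
    · intro x hx
      exact preserve_defect (S := fun x => o < x ∧ x < y) hSσ hSi hx
    · rw [link3_other io.symm jo.symm ppo.symm, hc]

end

/-! ### Generators at the ends of the innermost arch -/

section

variable {R : Type} [CommRing R] [Algebra ℂ R] {t₄ : ℂ} {N m : ℕ} {σ : ℤ → ℤ} {y : ℤ}

theorem NCAt.cls_ne_of_inner (h : NCAt N y σ) (hN : 0 < N) {o c : ℤ} (ho : Inner σ y o)
    (hc : σ o = c) (a b : ℤ) (h1 : o ≤ a) (h2 : a < b) (h3 : b ≤ c) : cls N a ≠ cls N b :=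
  fun e => by
    have := add_le_of_cls_eq e h2
    have := (h.innerFacts hN ho hc).lt
    omega

/-- The generator joins the closing point of the innermost arch over the new line to its left
neighbour. -/
theorem LineRelations.step_intertwine_left_of_close (H : LineRelations R t₄ N m) (hN : 2 ≤ N)
    (h : NCAt N y σ) (hb : CrossBound N (m + 1) σ y) {o c : ℤ} (ho : Inner σ y o) (hc : σ o = c)
    (iy : cls N (c - 1) ≠ cls N y) :
    eOp R t₄ N (c - 1) (lineUnder R t₄ N σ y) =
      eAt t₄ N (fun τ => lineUnder R t₄ N τ y) (c - 1) σ := by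
  have hN0 : 0 < N := by omega
  have hj : c - 1 + 1 = c := by ring
  obtain ⟨f1, f2, f3, f4, f5, f6, f7⟩ := h.innerFacts hN0 ho hc
  have ne := h.cls_ne_of_inner hN0 ho hc
  have n1 : c - 1 ≠ y := fun e => iy (by rw [e])
  obtain ⟨p, hp⟩ : ∃ p, σ (c - 1) = p := ⟨_, rfl⟩
  have hp' : σ p = c - 1 := by rw [← hp, h.invol]
  have a1 := h.inner_right ho (x := c - 1) (by omega) (by omega)
  have a2 := h.nc o (c - 1) (by omega) (by omega) iy
  rw [hp] at a1 a2
  rw [hc] at a2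
  have a3 : p ≠ c - 1 := a2.2.2
  have h4 := ne (c - 1) c (by omega) (by omega) le_rfl
  have io := ne o (c - 1) le_rfl (by omega) (by omega)
  have pi : cls N p ≠ cls N (c - 1) := hp ▸ h.partner_ne hN0 (by omega)
  have py := ne y p (by omega) a1 (by omega)
  have po := ne o p (by omega) (by omega) (by omega)
  have pc := ne p c (by omega) (by omega) le_rfl
  have e1 := H.join_left (h.cut_left hN0 ho hc) (h.crossBound_cut_left hN0 ho hc hb) (c := p)
    (by rw [link3_other iy io.symm h4, hp]) (by omega)
  have e2 := H.intertwine (h.cut_right hN0 ho hc) (h.crossBound_cut_right hN0 ho hc hb)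
    (i := c - 1) io.symm (by rw [hj]; exact f3.symm)
  rw [eAt_arcs (p := p) (q := y) (by rw [link3_other iy h4 io.symm, hp])
    (by rw [hj, link3_right f2.symm f3.symm rfl]; ring) a3 (by omega) (by rwa [hj]), hj] at e2
  rw [lineUnder_inner hN0 h ho hc, map_add, eOp_smul, eOp_smul, e1, e2,
    eAt_arcs (p := p) (q := o) hp (by rw [hj, f4]) a3 (by omega) (by rwa [hj]), hj]
  have h' := h.reconnect_arcs hN0 (i := c - 1) (p := p) (q := o) hp (by rw [hj, f4]) iy
      (by rwa [hj]) a3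
    (by omega) (by rwa [hj]) (by rwa [hj])
  rw [hj] at h'
  have hop : link N (c - 1) c (link N p o σ) o = p := by
    rw [link_apply, if_neg io, if_neg f3, link_apply, if_neg po, if_pos rfl]; ring
  have hin : Inner (link N (c - 1) c (link N p o σ)) y o := by
    refine ⟨f6, by omega, fun x x1 x2 => ?_⟩
    rw [link_apply, if_neg (ne x (c - 1) (by omega) (by omega) (by omega)),
      if_neg (ne x c (by omega) (by omega) (by omega)), link_apply,
      if_neg (ne x p (by omega) (by omega) (by omega)),
      if_neg (ne o x (by omega) (by omega) (by omega)).symm]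
    exact ho.2.2 x x1 x2
  rw [lineUnder_inner hN0 h' hin hop]
  congr 3
  · funext x; simp only [link3, link_apply]; grind
  · funext x; simp only [link3, link_apply]; grind

/-- The generator joins the opening point of the innermost arch over the new line to its right
neighbour. -/
theorem LineRelations.step_intertwine_right_of_open (H : LineRelations R t₄ N m) (hN : 2 ≤ N)
    (h : NCAt N y σ) (hb : CrossBound N (m + 1) σ y) {o c : ℤ} (ho : Inner σ y o) (hc : σ o = c)
    (jy : cls N (o + 1) ≠ cls N y) :
    eOp R t₄ N o (lineUnder R t₄ N σ y) =
      eAt t₄ N (fun τ => lineUnder R t₄ N τ y) o σ := by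
  have hN0 : 0 < N := by omega
  obtain ⟨f1, f2, f3, f4, f5, f6, f7⟩ := h.innerFacts hN0 ho hc
  have ne := h.cls_ne_of_inner hN0 ho hc
  have n1 : o + 1 ≠ y := fun e => jy (by rw [e])
  obtain ⟨p, hp⟩ : ∃ p, σ (o + 1) = p := ⟨_, rfl⟩
  have hp' : σ p = o + 1 := by rw [← hp, h.invol]
  have a1 := ho.2.2 (o + 1) (by omega) (by omega)
  have a2 := h.nc o (o + 1) (by omega) (by omega) jy
  rw [hp] at a1 a2
  have a3 : p ≠ o + 1 := a2.2.2
  have h4 := cls_ne_succ hN o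
  have jc := ne (o + 1) c (by omega) (by omega) le_rfl
  have pj : cls N p ≠ cls N (o + 1) := hp ▸ h.partner_ne hN0 (by omega)
  have py := ne p y (by omega) a1 (by omega)
  have po := ne o p (by omega) (by omega) (by omega)
  have pc := ne p c (by omega) (by omega) le_rfl
  have e1 := H.intertwine (h.cut_left hN0 ho hc) (h.crossBound_cut_left hN0 ho hc hb)
    (i := o) f3 jc
  have e2 := H.join_right (h.cut_right hN0 ho hc) (h.crossBound_cut_right hN0 ho hc hb) (c := p)
    (by rw [link3_other jy jc h4.symm, hp]) (by omega)
  rw [eAt_arcs (p := y) (q := p) (by rw [link3_right f1.symm f3 rfl]; ring)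
    (by rw [link3_other jy h4.symm jc, hp]) (by omega) a3 jy.symm] at e1
  rw [lineUnder_inner hN0 h ho hc, map_add, eOp_smul, eOp_smul, e1, e2,
    eAt_arcs (p := c) (q := p) hc hp (by omega) a3 jc.symm]
  have h' := h.reconnect_arcs hN0 (i := o) (p := c) (q := p) hc hp f1 jy (by omega) a3 jc.symm h4
  have hop : link N o (o + 1) (link N c p σ) p = c := by
    rw [link_apply, if_neg po.symm, if_neg pj, link_apply, if_neg pc, if_pos rfl]; ring
  have hin : Inner (link N o (o + 1) (link N c p σ)) y p := by
    refine ⟨by omega, by omega, fun x x1 x2 => ?_⟩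
    rw [link_apply, if_neg (ne o x (by omega) (by omega) (by omega)).symm,
      if_neg (ne (o + 1) x (by omega) (by omega) (by omega)).symm, link_apply,
      if_neg (ne x c (by omega) (by omega) (by omega)),
      if_neg (ne p x (by omega) (by omega) (by omega)).symm]
    exact ho.2.2 x (by omega) x2
  rw [lineUnder_inner hN0 h' hin hop]
  congr 3
  · funext x; simp only [link3, link_apply]; grind
  · funext x; simp only [link3, link_apply]; grind

end

section

variable {R : Type} [CommRing R] [Algebra ℂ R] {t₄ : ℂ} {N m : ℕ} {σ : ℤ → ℤ} {y : ℤ}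

/-- The generator joins the opening point of the innermost arch over the new line to its left
neighbour, and the line at that neighbour is an arch. -/
theorem LineRelations.step_intertwine_left_of_open (H : LineRelations R t₄ N m) (ht : t₄ ≠ 0)
    (hN : 2 ≤ N) (h : NCAt N y σ) (hb : CrossBound N (m + 1) σ y) {o c : ℤ} (ho : Inner σ y o)
    (hc : σ o = c) (iy : cls N (o - 1) ≠ cls N y) (h1 : σ (o - 1) ≠ o - 1)
    (h3 : cls N (σ (o - 1)) ≠ cls N o) :
    eOp R t₄ N (o - 1) (lineUnder R t₄ N σ y) =
      eAt t₄ N (fun τ => lineUnder R t₄ N τ y) (o - 1) σ := by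
  have hN0 : 0 < N := by omega
  have hj : o - 1 + 1 = o := by ring
  obtain ⟨f1, f2, f3, f4, f5, f6, f7⟩ := h.innerFacts hN0 ho hc
  have ne := h.cls_ne_of_inner hN0 ho hc
  have h4 : cls N (o - 1) ≠ cls N o := by have := cls_ne_succ hN (o - 1); rwa [hj] at this
  obtain ⟨p, hp⟩ : ∃ p, σ (o - 1) = p := ⟨_, rfl⟩
  rw [hp] at h1 h3
  have hp' : σ p = o - 1 := by rw [← hp, h.invol]
  have ic : cls N (o - 1) ≠ cls N c := fun e => h3 (by
    have := cls_apply h.per e; rwa [hp, f4] at this)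
  have pi : cls N p ≠ cls N (o - 1) := hp ▸ h.partner_ne hN0 (by omega)
  have py : cls N p ≠ cls N y := hp ▸ h.ne_of_fix h.fix iy
  have pc : cls N p ≠ cls N c := by rw [← hp, ← hc]; exact h.cls_ne h4
  have sh := h.shape hN0 (i := o - 1) hp (by rw [hj, hc]) iy (by rwa [hj]) h1 (by omega)
    (by rwa [hj])
  rw [hj] at sh
  have n1 := h.cut_left hN0 ho hc
  have n2 := h.cut_right hN0 ho hc
  have b1 := h.crossBound_cut_left hN0 ho hc hb
  have b2 := h.crossBound_cut_right hN0 ho hc hb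
  have e1 := H.intertwine n1 b1 (i := o - 1) ic (by rwa [hj])
  rw [eAt_arcs (p := p) (q := y) (by rw [link3_other iy h4 ic, hp])
    (by rw [hj, link3_right f1.symm f3 rfl]; ring) h1 (by omega) (by rwa [hj]), hj] at e1
  have h' := h.reconnect_arcs hN0 (i := o - 1) (p := p) (q := c) hp (by rw [hj, hc]) iy
      (by rwa [hj]) h1
    (by omega) (by rwa [hj]) (by rwa [hj])
  rw [hj] at h'
  have hpc : link N (o - 1) o (link N p c σ) p = c := by
    rw [link_apply, if_neg pi, if_neg h3, link_apply, if_pos rfl]; ring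
  rw [lineUnder_inner hN0 h ho hc, map_add, eOp_smul, eOp_smul, e1,
    eAt_arcs (p := p) (q := c) hp (by rw [hj, hc]) h1 (by omega) (by rwa [hj]), hj]
  have g2 : link3 N y c o σ (o - 1) = p := by rw [link3_other iy ic h4, hp]
  rcases sh with ⟨s1, s2, s3⟩ | ⟨s1, s2⟩ | ⟨s1, s2⟩
  -- the two arches lie side by side and are joined to one arch over the line
  · have e2 := H.join_left n2 b2 g2 s1
    have hin : Inner (link N (o - 1) o (link N p c σ)) y p := by
      have ne' : ∀ a b : ℤ, p ≤ a → a < b → b ≤ c → cls N a ≠ cls N b := fun a b h1 h2 h3 e => by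
        have := add_le_of_cls_eq e h2; omega
      refine ⟨by omega, by omega, fun x x1 x2 => ?_⟩
      rcases eq_or_ne x (o - 1) with e | e
      · rw [e, link_apply, if_pos rfl]; omega
      rcases eq_or_ne x o with e' | e'
      · rw [e', link_apply, if_neg h4.symm, if_pos rfl]; omega
      have i1 : cls N x ≠ cls N (o - 1) := by
        rcases lt_or_gt_of_ne e with l | l
        · exact ne' x _ (by omega) l (by omega)
        · exact (ne' _ x (by omega) l (by omega)).symm
      have i2 : cls N x ≠ cls N o := by
        rcases lt_or_gt_of_ne e' with l | l
        · exact ne' x _ (by omega) l (by omega)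
        · exact (ne' _ x (by omega) l (by omega)).symm
      rw [link_apply, if_neg i1, if_neg i2, link_apply,
        if_neg (ne' p x le_rfl x1 (by omega)).symm, if_neg (ne' x c (by omega) (by omega) le_rfl)]
      rcases lt_or_gt_of_ne e' with l | l
      · have := h.nc' (x := o - 1) (w := x) (by omega) (by omega) (ne' x y (by omega) x2 (by omega))
        omega
      · exact ho.2.2 x l x2
    rw [e2, lineUnder_inner hN0 h' hin hpc]
    congr 3
    · funext x; simp only [link3, link_apply]; grind
    · funext x; simp only [link3, link_apply]; grind
  · omega
  -- the arch at `o - 1` passes over both ends of the innermost arch; the joined arch does not cross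
  -- the line any more, and the contributions with crossings cancel (second Reidemeister move)
  · have e2 := H.curl_left ht hN n2 (b2.mono (by omega)) g2 (by omega)
    have h1' := n1.reconnect_arcs hN0 (i := o - 1) (p := p) (q := y)
        (by rw [link3_other iy h4 ic, hp])
      (by rw [hj, link3_right f1.symm f3 rfl]; ring) ic (by rwa [hj]) h1 (by omega) (by rwa [hj])
      (by rwa [hj])
    rw [hj] at h1'
    have hyp : link N (o - 1) o (link N p y (link3 N y o c σ)) y = p := by
      rw [link_apply, if_neg iy.symm, if_neg f1.symm, link_apply, if_neg py.symm, if_pos rfl]; ring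
    have hin : Inner (link N (o - 1) o (link N p y (link3 N y o c σ))) c y := by
      refine ⟨f7, by omega, fun x x1 x2 => ?_⟩
      have i1 := (ne o x (by omega) (by omega) (by omega)).symm
      have i2 := (ne y x (by omega) (by omega) (by omega)).symm
      have i3 := (ne x c (by omega) (by omega) (by omega))
      have lp := h.lt_add hN0 (o - 1)
      rw [hp] at lp
      have i4 : cls N x ≠ cls N (o - 1) := fun e => by
        have := add_le_of_cls_eq e.symm (by omega); omega
      have i5 : cls N x ≠ cls N p := fun e => by
        have := add_le_of_cls_eq e (by omega); omega
      rw [link_apply, if_neg i4, if_neg i1, link_apply, if_neg i5, if_neg i2,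
        link3_other i2 i1 i3]
      have := h.nc o x (by omega) (by omega) i2
      omega
    rw [e2, lineUnder_inner hN0 h1' hin hyp]
    have w1 : link3 N c y p (link N (o - 1) o (link N p y (link3 N y o c σ))) =
        link3 N o (o - 1) p (link3 N y c o σ) := by
      funext x; simp only [link3, link_apply]; grind
    have w2 : link3 N c p y (link N (o - 1) o (link N p y (link3 N y o c σ))) =
        link N (o - 1) o (link N p c σ) := by
      have := h.fix
      funext x
      by_cases hx : cls N x = cls N y
      · rw [link3_end hx, link_apply, if_neg (hx ▸ iy.symm), if_neg (hx ▸ f1.symm), link_apply,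
          if_neg (hx ▸ py.symm), if_neg (hx ▸ f2.symm), apply_of_cls h.per hx, h.fix]; ring
      simp only [link3, link_apply]; grind
    rw [w1, w2, smul_add, smul_smul, smul_smul, smul_smul, add_right_comm, ← add_smul]
    rw [show t₄ * t₄ + t₄⁻¹ * -t₄ ^ 3 = 0 by field_simp; ring, mul_inv_cancel₀ ht, zero_smul,
      zero_add, one_smul]

/-- The generator joins the closing point of the innermost arch over the new line to its right
neighbour, and the line at that neighbour is an arch. -/
theorem LineRelations.step_intertwine_right_of_close (H : LineRelations R t₄ N m) (ht : t₄ ≠ 0)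
    (hN : 2 ≤ N) (h : NCAt N y σ) (hb : CrossBound N (m + 1) σ y) {o c : ℤ} (ho : Inner σ y o)
    (hc : σ o = c) (jy : cls N (c + 1) ≠ cls N y) (h1 : σ (c + 1) ≠ c + 1)
    (h3 : cls N (σ (c + 1)) ≠ cls N c) :
    eOp R t₄ N c (lineUnder R t₄ N σ y) =
      eAt t₄ N (fun τ => lineUnder R t₄ N τ y) c σ := by
  have hN0 : 0 < N := by omega
  obtain ⟨f1, f2, f3, f4, f5, f6, f7⟩ := h.innerFacts hN0 ho hc
  have ne := h.cls_ne_of_inner hN0 ho hc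
  have h4 := cls_ne_succ hN c
  obtain ⟨p, hp⟩ : ∃ p, σ (c + 1) = p := ⟨_, rfl⟩
  rw [hp] at h1 h3
  have hp' : σ p = c + 1 := by rw [← hp, h.invol]
  have jo : cls N (c + 1) ≠ cls N o := fun e => h3 (by
    have := cls_apply h.per e; rwa [hp, hc] at this)
  have pj : cls N p ≠ cls N (c + 1) := hp ▸ h.partner_ne hN0 (by omega)
  have py : cls N p ≠ cls N y := hp ▸ h.ne_of_fix h.fix jy
  have po : cls N p ≠ cls N o := by rw [← hp, ← f4]; exact h.cls_ne h4.symm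
  have sh := h.shape hN0 (i := c) f4 hp f2 jy (by omega) h1 jo.symm
  have n1 := h.cut_left hN0 ho hc
  have n2 := h.cut_right hN0 ho hc
  have b1 := h.crossBound_cut_left hN0 ho hc hb
  have b2 := h.crossBound_cut_right hN0 ho hc hb
  have e2 := H.intertwine n2 b2 (i := c) f3.symm jo
  rw [eAt_arcs (p := y) (q := p) (by rw [link3_right f2.symm f3.symm rfl]; ring)
    (by rw [link3_other jy h4.symm jo, hp]) (by omega) h1 jy.symm] at e2
  have h' := h.reconnect_arcs hN0 (i := c) (p := o) (q := p) f4 hp f2 jy (by omega) h1 jo.symm h4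
  have hop : link N c (c + 1) (link N o p σ) o = p := by
    rw [link_apply, if_neg f3, if_neg jo.symm, link_apply, if_pos rfl]; ring
  have hpo : link N c (c + 1) (link N o p σ) p = o := by
    rw [link_apply, if_neg h3, if_neg pj, link_apply, if_neg po, if_pos rfl]; ring
  rw [lineUnder_inner hN0 h ho hc, map_add, eOp_smul, eOp_smul, e2,
    eAt_arcs (p := o) (q := p) f4 hp (by omega) h1 jo.symm]
  have g1 : link3 N y o c σ (c + 1) = p := by rw [link3_other jy jo h4.symm, hp]
  rcases sh with ⟨s1, s2, s3⟩ | ⟨s1, s2⟩ | ⟨s1, s2⟩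
  -- the two arches lie side by side and are joined to one arch over the line
  · have e1 := H.join_right n1 b1 g1 s2
    have hin : Inner (link N c (c + 1) (link N o p σ)) y o := by
      have ne' : ∀ a b : ℤ, o ≤ a → a < b → b ≤ p → cls N a ≠ cls N b := fun a b h1 h2 h3 e => by
        have := add_le_of_cls_eq e h2; omega
      refine ⟨by omega, by omega, fun x x1 x2 => ?_⟩
      rw [link_apply, if_neg (ne' x c (by omega) (by omega) (by omega)),
        if_neg (ne' x (c + 1) (by omega) (by omega) (by omega)), link_apply,
        if_neg (ne' o x le_rfl x1 (by omega)).symm, if_neg (ne' x p (by omega) (by omega) le_rfl)]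
      exact ho.2.2 x x1 x2
    rw [e1, lineUnder_inner hN0 h' hin hop]
    congr 3
    · funext x; simp only [link3, link_apply]; grind
    · funext x; simp only [link3, link_apply]; grind
  -- the arch at `c + 1` passes over both ends of the innermost arch; the joined arch does not cross
  -- the line any more, and the contributions with crossings cancel (second Reidemeister move)
  · have e1 := H.curl_right ht hN n1 (b1.mono (by omega)) g1 (by omega)
    have h2' := n2.reconnect_arcs hN0 (i := c) (p := y) (q := p)
      (by rw [link3_right f2.symm f3.symm rfl]; ring)
      (by rw [link3_other jy h4.symm jo, hp]) f3.symm jo (by omega) h1 jy.symm h4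
    have hpy : link N c (c + 1) (link N y p (link3 N y c o σ)) p = y := by
      rw [link_apply, if_neg h3, if_neg pj, link_apply, if_neg py, if_pos rfl]; ring
    have lp := h.sub_lt hN0 (c + 1)
    rw [hp] at lp
    have hin : Inner (link N c (c + 1) (link N y p (link3 N y c o σ))) o p := by
      refine ⟨s1, by omega, fun x x1 x2 => ?_⟩
      have i1 : cls N x ≠ cls N o := fun e => by
        have := add_le_of_cls_eq e x2; omega
      have i2 : cls N x ≠ cls N y := fun e => by
        have := add_le_of_cls_eq e (by omega); omega
      have i3 : cls N x ≠ cls N c := fun e => by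
        have := add_le_of_cls_eq e (by omega); omega
      have i4 : cls N x ≠ cls N (c + 1) := fun e => by
        have := add_le_of_cls_eq e (by omega); omega
      have i5 : cls N x ≠ cls N p := fun e => by
        have := add_le_of_cls_eq e.symm (by omega); omega
      rw [link_apply, if_neg i3, if_neg i4, link_apply, if_neg i2, if_neg i5,
        link3_other i2 i3 i1]
      have a1 := h.nc p x (by omega) (by omega) i2
      have a2 := h.nc o (σ x)
      rw [h.invol] at a2
      have i6 : cls N (σ x) ≠ cls N y := h.ne_of_fix h.fix i2
      have i7 : σ x ≠ o := fun e => by rw [← hc, ← e, h.invol] at f7; omega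
      have i8 : σ x ≠ c := fun e => by have := h.invol x; rw [e, f4] at this; omega
      by_contra hlt
      have := a2 (by omega) (by omega) i6
      omega
    rw [e1, lineUnder_inner hN0 h2' hin hpy]
    have w1 : link3 N o y p (link N c (c + 1) (link N y p (link3 N y c o σ))) =
        link3 N c (c + 1) p (link3 N y o c σ) := by
      funext x; simp only [link3, link_apply]; grind
    have w2 : link3 N o p y (link N c (c + 1) (link N y p (link3 N y c o σ))) =
        link N c (c + 1) (link N o p σ) := by
      funext x
      by_cases hx : cls N x = cls N y
      · rw [link3_end hx, link_apply, if_neg (hx ▸ f2.symm), if_neg (hx ▸ jy.symm), link_apply,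
          if_neg (hx ▸ f1.symm), if_neg (hx ▸ py.symm), apply_of_cls h.per hx, h.fix]; ring
      simp only [link3, link_apply]; grind
    rw [w1, w2, smul_add, smul_smul, smul_smul, smul_smul, add_left_comm, ← add_smul]
    rw [show t₄ * -(t₄ ^ 3)⁻¹ + t₄⁻¹ * t₄⁻¹ = 0 by field_simp; ring, inv_mul_cancel₀ ht, zero_smul,
      add_zero, one_smul]
  · omega

/-- The generator joins the closing point of the innermost arch over the new line to its opening
point. -/
theorem LineRelations.step_intertwine_wrap (H : LineRelations R t₄ N m)
    (hN : 2 ≤ N) (h : NCAt N y σ) (hb : CrossBound N (m + 1) σ y) {o : ℤ} (ho : Inner σ y o)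
    (hc : σ o = o - 1 + N) :
    eOp R t₄ N (o - 1) (lineUnder R t₄ N σ y) =
      eAt t₄ N (fun τ => lineUnder R t₄ N τ y) (o - 1) σ := by
  have hN0 : 0 < N := by omega
  have hj : o - 1 + 1 = o := by ring
  obtain ⟨f1, f2, f3, f4, f5, f6, f7⟩ := h.innerFacts hN0 ho hc
  have h4 : cls N (o - 1) ≠ cls N o := by have := cls_ne_succ hN (o - 1); rwa [hj] at this
  have ec := cls_add_self (N := N) (o - 1)
  have ey := cls_add_self (N := N) y
  have ey' := cls_sub_self (N := N) y
  have iy : cls N (o - 1) ≠ cls N y := ec ▸ f2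
  have fy : σ (y - N) = y - N := by rw [apply_of_cls h.per ey', h.fix]; ring
  have hi : σ (o - 1) = o - N := by
    have := h.per (o - 1); rw [f4] at this; omega
  have jc : o - 1 + N + 1 = o + N := by ring
  have eo := cls_add_self (N := N) o
  have e1 := H.join_right (h.cut_left hN0 ho hc) (h.crossBound_cut_left hN0 ho hc hb) (c := y + N)
    (by rw [jc, link3_right f1.symm f3 eo]; ring) (by omega)
  have e2 := H.join_left (h.cut_right hN0 ho hc) (h.crossBound_cut_right hN0 ho hc hb) (c := y - N)
    (by rw [link3_right f2.symm f3.symm ec.symm]; ring) (by omega)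
  have hu := h.unwrap (i := o - 1) (by rw [hj, hc]) (by rwa [hj])
  rw [hj] at hu
  have w1 : link3 N (o - 1 + N) (o - 1 + N + 1) (y + N) (link3 N y o (o - 1 + N) σ) =
      link N (o - 1) o σ := by
    rw [jc, link3_shift (dvd_refl _)]
    have := h.fix
    funext x
    by_cases hx : cls N x = cls N y
    · rw [link3_end hx, link_apply, if_neg (hx ▸ iy.symm), if_neg (hx ▸ f1.symm),
        apply_of_cls h.per hx, h.fix]; ring
    simp only [link3, link_apply]; grind
  have w2 : link3 N o (o - 1) (y - N) (link3 N y (o - 1 + N) o σ) = link N (o - 1) o σ := by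
    funext x
    by_cases hx : cls N x = cls N y
    · rw [link3_end (hx.trans ey'.symm), link_apply, if_neg (hx ▸ iy.symm), if_neg (hx ▸ f1.symm),
        apply_of_cls h.per hx, h.fix]; ring
    simp only [link3, link_apply]; grind
  rw [w1, eOp_shift (dvd_refl _), lineUnder_shift hN0 hu (dvd_refl _)] at e1
  rw [w2, sub_eq_add_neg y, lineUnder_shift hN0 hu (by simp)] at e2
  rw [lineUnder_inner hN0 h ho hc, map_add, eOp_smul, eOp_smul, e1, e2,
    eAt_wrap hN (by rw [hi]; ring), hj, ← add_smul, punctureLoopWeight]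

/-- The generator joins the opening point of the innermost arch over the new line to the end of the
defect line. -/
theorem LineRelations.step_intertwine_defect_open (H : LineRelations R t₄ N m) (ht : t₄ ≠ 0)
    (hN : 2 ≤ N) (h : NCAt N y σ) (hb : CrossBound N (m + 1) σ y) {o c : ℤ} (ho : Inner σ y o)
    (hc : σ o = c) (iy : cls N (o - 1) ≠ cls N y) (h1 : σ (o - 1) = o - 1) :
    eOp R t₄ N (o - 1) (lineUnder R t₄ N σ y) =
      eAt t₄ N (fun τ => lineUnder R t₄ N τ y) (o - 1) σ := by
  have hN0 : 0 < N := by omega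
  have hj : o - 1 + 1 = o := by ring
  obtain ⟨f1, f2, f3, f4, f5, f6, f7⟩ := h.innerFacts hN0 ho hc
  have ne := h.cls_ne_of_inner hN0 ho hc
  have h4 : cls N (o - 1) ≠ cls N o := by have := cls_ne_succ hN (o - 1); rwa [hj] at this
  have ic : cls N (o - 1) ≠ cls N c := fun e => f3 (by
    have := apply_of_cls h.per e; rw [h1, f4] at this; omega)
  have n1 := h.cut_left hN0 ho hc
  have n2 := h.cut_right hN0 ho hc
  have b1 := h.crossBound_cut_left hN0 ho hc hb
  have e1 := H.intertwine n1 b1 (i := o - 1) ic (by rwa [hj])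
  rw [eAt_left (q := y) (by rwa [hj]) (by rw [link3_other iy h4 ic, h1])
    (by rw [hj, link3_right f1.symm f3 rfl]; ring) iy.symm (by rw [hj]; exact f1.symm), hj] at e1
  have n3 := n1.reconnect_defect_left hN0 (i := o - 1) (q := y) ic (by rwa [hj])
    (by rw [link3_other iy h4 ic, h1])
    (by rw [hj, link3_right f1.symm f3 rfl]; ring) (by omega) (by rwa [hj])
  have n4 := h.reconnect_defect_left hN0 (i := o - 1) (q := c) iy (by rwa [hj]) h1 (by rw [hj, hc])
    (by omega) (by rwa [hj])
  rw [hj] at n3 n4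
  have lc : c < o - 1 + N := by
    have : c ≠ o - 1 + N := fun e => ic (by rw [e, cls_add_self])
    omega
  have iN : σ (o - 1 + N) = o - 1 + N := by rw [h.per, h1]
  have nc2 : NoCross (link3 N y c o σ) o := by
    intro x x1 x2
    rcases eq_or_lt_of_le (show x ≤ o - 1 by omega) with e | l
    · rw [e, link3_other iy ic h4, h1] at x2; omega
    have := n2.nc x (o - 1) l (by omega) h4
    rw [link3_other iy ic h4] at this
    exact this.2.2 h1
  have r3 : ∀ x, o < x → x < c → x ≠ y → link3 N (o - 1) o c σ x = σ x ∧
      link3 N (o - 1) o y (link3 N y o c σ) x = σ x := by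
    intro x x1 x2 x3
    have i1 : cls N x ≠ cls N (o - 1) := fun e => by
      have := add_le_of_cls_eq e.symm (by omega); omega
    have i2 := (ne o x le_rfl x1 x2.le).symm
    have i3 := ne x c x1.le x2 le_rfl
    have i4 : cls N x ≠ cls N y := by
      rcases lt_or_gt_of_ne x3 with l | l
      · exact ne x y x1.le l f7.le
      · exact (ne y x f6.le l x2.le).symm
    rw [link3_other i1 i2 i3, link3_other i1 i2 i4, link3_other i4 i2 i3]
    exact ⟨rfl, rfl⟩
  have nc4 : NoCross (link3 N (o - 1) o c σ) y := by
    intro x x1 x2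
    have a1 := n4.nc x c (by omega)
    rw [link3_end rfl] at a1
    have a2 : link3 N (o - 1) o c σ x ≠ c := fun e => by
      have := n4.invol x; rw [e, link3_end rfl] at this; omega
    have a3 : link3 N (o - 1) o c σ x < c := by
      by_contra hlt
      exact (a1 (by omega) f2).2.2 rfl
    have a4 := (r3 _ (by omega) a3 (by omega)).1
    rw [n4.invol] at a4
    have := h.inner_right ho x2 (by omega)
    omega
  have nc3 : NoCross (link3 N (o - 1) o y (link3 N y o c σ)) c := by
    intro x x1 x2
    rcases lt_trichotomy x y with l | l | l
    · exact (n3.nc x y l (by omega) f2.symm).2.2 (link3_end rfl)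
    · rw [l, link3_end rfl] at x2; omega
    · rw [(r3 x (by omega) x1 (by omega)).2] at x2
      have := h.nc o x (by omega) (by omega) (ne y x (by omega) l (by omega)).symm
      omega
  have ei := cls_add_self (N := N) (o - 1)
  have ey := cls_add_self (N := N) y
  have t2 : link3 N y c o σ (o - 1) = o - 1 := by rw [link3_other iy ic h4, h1]
  obtain ⟨-, p1, p2⟩ := n2.isLinkPattern_link hN0 nc2 (d := o - 1 + N)
    (by rw [link3_other (ei ▸ iy) (ei ▸ ic) (ei ▸ h4), iN]) (by omega) (by omega)
  have s1 : link N o (o - 1 + N) (link3 N y c o σ) (o - 1) = o - 1 + 1 - N := by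
    rw [link_apply, if_neg h4, if_pos ei.symm]; ring
  have s2 : link N o (o - 1 + N - N) (link3 N y c o σ) (o - 1) = o - 1 + 1 := by
    rw [add_sub_cancel_right, link_apply, if_neg h4, if_pos rfl]; ring
  have w1 : link N (o - 1) o (link N o (o - 1 + N) (link3 N y c o σ)) =
      link N o (o - 1) (link3 N y c o σ) := by
    funext x; simp only [link3, link_apply]; grind
  have w2 : link N y c (link3 N (o - 1) o c σ) = link N o (o - 1) (link3 N y c o σ) := by
    funext x; simp only [link3, link_apply]; grind
  have w3 : link N y (c - N) (link3 N (o - 1) o c σ) =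
      link N c (y + N) (link3 N (o - 1) o y (link3 N y o c σ)) := by
    have := cls_sub_self (N := N) c
    funext x; simp only [link3, link_apply]; grind
  have w4 : link N c y (link3 N (o - 1) o y (link3 N y o c σ)) =
      link N o (o - 1) (link3 N y c o σ) := by
    funext x; simp only [link3, link_apply]; grind
  rw [lineUnder_inner hN0 h ho hc, map_add, eOp_smul, eOp_smul, e1, lineUnder_noCross nc2,
    finishAt_defect n2 (d := o - 1 + N) (by omega) (by omega)
      (by rw [link3_other (ei ▸ iy) (ei ▸ ic) (ei ▸ h4), iN]),
    map_add, eOp_smul, eOp_pat p1, eOp_pat p2, eAt_wrap hN s1, eAt_peak s2,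
    eAt_left (q := c) (by rwa [hj]) h1 (by rw [hj, hc]) ic.symm (by rw [hj]; exact f3.symm),
    hj, lineUnder_noCross nc3, lineUnder_noCross nc4,
    finishAt_defect n3 (d := y + N) (by omega) (by omega) (by rw [link3_end ey]),
    finishAt_defect n4 f7 (by omega) (link3_end rfl), add_sub_cancel_right, add_sub_cancel_right,
    w1, w2, w3, w4]
  simp only [smul_add, smul_smul]
  rw [add_assoc, add_comm, ← add_smul, ← add_smul]
  congr 1
  rw [show t₄ * t₄ + (t₄⁻¹ * punctureLoopWeight t₄ + t₄⁻¹ * (t₄ * loopWeight t₄)) = 1 by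
    rw [punctureLoopWeight, loopWeight]; field_simp; ring, one_smul]

/-- The generator joins the closing point of the innermost arch over the new line to the end of the
defect line. -/
theorem LineRelations.step_intertwine_defect_close (H : LineRelations R t₄ N m) (ht : t₄ ≠ 0)
    (hN : 2 ≤ N) (h : NCAt N y σ) (hb : CrossBound N (m + 1) σ y) {o c : ℤ} (ho : Inner σ y o)
    (hc : σ o = c) (jy : cls N (c + 1) ≠ cls N y) (h1 : σ (c + 1) = c + 1) :
    eOp R t₄ N c (lineUnder R t₄ N σ y) =
      eAt t₄ N (fun τ => lineUnder R t₄ N τ y) c σ := by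
  have hN0 : 0 < N := by omega
  obtain ⟨f1, f2, f3, f4, f5, f6, f7⟩ := h.innerFacts hN0 ho hc
  have ne := h.cls_ne_of_inner hN0 ho hc
  have h4 := cls_ne_succ hN c
  have jo : cls N (c + 1) ≠ cls N o := fun e => f3 (by
    have := apply_of_cls h.per e; rw [h1, hc] at this; omega)
  have n1 := h.cut_left hN0 ho hc
  have n2 := h.cut_right hN0 ho hc
  have b2 := h.crossBound_cut_right hN0 ho hc hb
  have t1 : link3 N y o c σ (c + 1) = c + 1 := by rw [link3_other jy jo h4.symm, h1]
  have t2 : link3 N y c o σ (c + 1) = c + 1 := by rw [link3_other jy h4.symm jo, h1]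
  have t2' : link3 N y c o σ c = y := by rw [link3_right f2.symm f3.symm rfl]; ring
  have e2 := H.intertwine n2 b2 (i := c) f3.symm jo
  rw [eAt_right (p := y) t2' t2 f2.symm jy.symm] at e2
  have n3 := n2.reconnect_defect_right hN0 (i := c) (p := y) f3.symm jo t2 t2' (by omega) h4
  have n4 := h.reconnect_defect_right hN0 (i := c) (p := o) f2 jy h1 f4 (by omega) h4
  rw [link3_comm h4.symm] at n3 n4
  have lc : c + 1 < o + N := by
    have : c + 1 ≠ o + N := fun e => jo (by rw [e, cls_add_self])
    omega
  have nc1 : NoCross (link3 N y o c σ) c := by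
    intro x x1 x2
    rcases eq_or_ne (link3 N y o c σ x) (c + 1) with e | e
    · have := n1.invol x; rw [e, t1] at this; omega
    exact (n1.nc x (c + 1) (by omega) (by omega) h4.symm).2.2 t1
  have r3 : ∀ x, o < x → x < c → x ≠ y → link3 N c (c + 1) o σ x = σ x ∧
      link3 N c (c + 1) y (link3 N y c o σ) x = σ x := by
    intro x x1 x2 x3
    have i1 : cls N x ≠ cls N (c + 1) := fun e => by
      have := add_le_of_cls_eq e (by omega); omega
    have i2 := (ne o x le_rfl x1 x2.le).symm
    have i3 := ne x c x1.le x2 le_rfl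
    have i4 : cls N x ≠ cls N y := by
      rcases lt_or_gt_of_ne x3 with l | l
      · exact ne x y x1.le l f7.le
      · exact (ne y x f6.le l x2.le).symm
    rw [link3_other i3 i1 i2, link3_other i3 i1 i4, link3_other i4 i3 i2]
    exact ⟨rfl, rfl⟩
  have nc4 : NoCross (link3 N c (c + 1) o σ) y := by
    intro x x1 x2
    have a1 := n4.nc x o
    rw [link3_end rfl] at a1
    have a2 : x ≠ o := fun e => by rw [e, link3_end rfl] at x2; omega
    have a3 : o < x := by
      by_contra hlt
      exact (a1 (by omega) (by omega) f1).2.2 rfl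
    have a4 := (r3 _ a3 (by omega) (by omega)).1
    rw [a4] at x2
    have := ho.2.2 x a3 x1
    omega
  have nc3 : NoCross (link3 N c (c + 1) y (link3 N y c o σ)) o := by
    intro x x1 x2
    obtain ⟨w, hw⟩ : ∃ w, link3 N c (c + 1) y (link3 N y c o σ) x = w := ⟨_, rfl⟩
    have hw' : link3 N c (c + 1) y (link3 N y c o σ) w = x := by rw [← hw, n3.invol]
    rw [hw] at x2
    rcases lt_trichotomy y w with l | l | l
    · exact (n3.nc x y (by omega) (by omega) f1.symm).2.2 (link3_end rfl)
    · rw [← l, link3_end rfl] at hw'; omega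
    · rw [(r3 w x2 (by omega) (by omega)).2] at hw'
      have := h.nc o w (by omega) (by omega) (ne w y (by omega) l (by omega))
      omega
  have eo := cls_add_self (N := N) o
  have ej := cls_sub_self (N := N) (c + 1)
  have ey := cls_add_self (N := N) y
  obtain ⟨-, p1, p2⟩ := n1.isLinkPattern_link hN0 nc1 t1 (by omega) (by omega)
  have s1 : link N c (c + 1) (link3 N y o c σ) c = c + 1 := by
    rw [link_apply, if_pos rfl]; ring
  have s2 : link N c (c + 1 - N) (link3 N y o c σ) c = c + 1 - N := by
    rw [link_apply, if_pos rfl]; ring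
  have w1 : link N c (c + 1) (link N c (c + 1 - N) (link3 N y o c σ)) =
      link N c (c + 1) (link3 N y o c σ) := by
    funext x; simp only [link3, link_apply]; grind
  have w2 : link N y o (link3 N c (c + 1) o σ) = link N c (c + 1) (link3 N y o c σ) := by
    funext x; simp only [link3, link_apply]; grind
  have w3 : link N o y (link3 N c (c + 1) y (link3 N y c o σ)) =
      link N c (c + 1) (link3 N y o c σ) := by
    funext x; simp only [link3, link_apply]; grind
  have w4 : link N o (y - N) (link3 N c (c + 1) y (link3 N y c o σ)) =
      link N y (o + N) (link3 N c (c + 1) o σ) := by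
    have := cls_sub_self (N := N) y
    funext x; simp only [link3, link_apply]; grind
  rw [lineUnder_inner hN0 h ho hc, map_add, eOp_smul, eOp_smul, e2, lineUnder_noCross nc1,
    finishAt_defect n1 (d := c + 1) (by omega) (by omega) t1,
    map_add, eOp_smul, eOp_pat p1, eOp_pat p2, eAt_wrap hN s2, eAt_peak s1,
    eAt_right (p := o) f4 h1 f3 jo.symm,
    lineUnder_noCross nc3, lineUnder_noCross nc4,
    finishAt_defect n3 (d := y) (by omega) (by omega) (link3_end rfl),
    finishAt_defect n4 (d := o + N) (by omega) (by omega) (link3_end eo), add_sub_cancel_right,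
    w1, w2, w3, w4]
  simp only [smul_add, smul_smul]
  have hw : t₄ * loopWeight t₄ + t₄ * (t₄ * punctureLoopWeight t₄) + t₄⁻¹ = t₄ := by
    rw [punctureLoopWeight, loopWeight]; field_simp; ring
  rw [inv_mul_cancel₀ ht, one_smul]
  linear_combination (norm := module) hw • pat R N (link N c (c + 1) (link3 N y o c σ))

end

/-! ### The relations between the new line and the Temperley-Lieb generators -/

section

variable {R : Type} [CommRing R] [Algebra ℂ R] {t₄ : ℂ} {N m : ℕ} {σ : ℤ → ℤ} {y : ℤ}

/-- The intertwining relation for one more crossing: the generator is far from the innermost arch,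
or joins one of its ends to a neighbour. -/
theorem LineRelations.step_intertwine (H : LineRelations R t₄ N m) (ht : t₄ ≠ 0)
    (hN : 2 ≤ N) (h : NCAt N y σ) (hb : CrossBound N (m + 1) σ y) {i : ℤ}
    (iy : cls N i ≠ cls N y) (jy : cls N (i + 1) ≠ cls N y) :
    eOp R t₄ N i (lineUnder R t₄ N σ y) = eAt t₄ N (fun τ => lineUnder R t₄ N τ y) i σ := by
  have hN0 : 0 < N := by omega
  by_cases hn : NoCross σ y
  · exact eOp_lineUnder_of_noCross hN0 h hn iy jy (cls_ne_succ hN i)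
  obtain ⟨o, ho⟩ := h.exists_inner hn
  obtain ⟨c, hc⟩ : ∃ c, σ o = c := ⟨_, rfl⟩
  obtain ⟨f1, f2, f3, f4, f5, f6, f7⟩ := h.innerFacts hN0 ho hc
  -- it suffices to treat one representative of the class of `i`
  have key : ∀ k, cls N i = cls N k →
      (cls N k ≠ cls N y → cls N (k + 1) ≠ cls N y →
        eOp R t₄ N k (lineUnder R t₄ N σ y) = eAt t₄ N (fun τ => lineUnder R t₄ N τ y) k σ) →
      eOp R t₄ N i (lineUnder R t₄ N σ y) = eAt t₄ N (fun τ => lineUnder R t₄ N τ y) i σ := by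
    intro k hk hh
    have hd := cls_eq.1 hk
    have := hh (hk ▸ iy) (by rwa [← cls_add 1 hk])
    rwa [← eOp_shift hd, ← eAt_shift h.per hd, add_sub_cancel] at this
  by_cases jo : cls N (i + 1) = cls N o
  · refine key (o - 1) (by have := cls_add (-1) jo; rwa [add_neg_cancel_right] at this) fun iy _ =>
        ?_
    have hj : o - 1 + 1 = o := by ring
    rcases h.cases_succ hN0 iy (by rwa [hj]) (cls_ne_succ hN (o - 1)) with
      hk | hk | ⟨k1, k2, k3⟩ | ⟨k1, k2⟩ | ⟨k1, k2⟩
    · have := h.invol (o - 1); rw [hk, hj] at this; omega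
    · have e := h.per (σ (o - 1))
      rw [h.invol, hk, hj, sub_add_cancel] at e
      exact H.step_intertwine_wrap hN h hb ho e
    · rw [hj] at k3
      exact H.step_intertwine_left_of_open ht hN h hb ho hc iy k1 k3
    · exact H.step_intertwine_defect_open ht hN h hb ho hc iy k1
    · rw [hj, hc] at k2; omega
  by_cases ic : cls N i = cls N c
  · refine key c ic fun _ jy => ?_
    rcases h.cases_succ hN0 f2 jy (cls_ne_succ hN c) with
      hk | hk | ⟨k1, k2, k3⟩ | ⟨k1, k2⟩ | ⟨k1, k2⟩
    · omega
    · exfalso; apply jo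
      rw [cls_add 1 ic, show c + 1 = o + N by omega, cls_add_self]
    · refine H.step_intertwine_right_of_close ht hN h hb ho hc jy k2 fun e => ?_
      have := cls_apply h.per e
      rw [h.invol, f4] at this
      rw [f4] at k3; exact k3 this.symm
    · omega
    · exact H.step_intertwine_defect_close ht hN h hb ho hc jy k2
  by_cases io : cls N i = cls N o
  · exact key o io fun _ jy => H.step_intertwine_right_of_open hN h hb ho hc jy
  by_cases jc : cls N (i + 1) = cls N c
  · exact key (c - 1) (by have := cls_add (-1) jc; rwa [add_neg_cancel_right] at this) fun iy _ =>
      H.step_intertwine_left_of_close hN h hb ho hc iy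
  exact H.step_intertwine_far hN h hb ho hc iy jy io ic jo jc

/-- The relations between the new line and the Temperley-Lieb generators, by induction on a bound
for the number of arches over the start of the line. -/
theorem lineRelations (ht : t₄ ≠ 0) (hN : 2 ≤ N) (m : ℕ) : LineRelations R t₄ N m := by
  have hN0 : 0 < N := by omega
  induction m with
  | zero =>
    exact ⟨fun h hb iy jy => eOp_lineUnder_of_noCross hN0 h (h.noCross_of_crossBound hN0 hb) iy jy
        (cls_ne_succ hN _),
      fun h hb => eOp_lineUnder_join_right_of_noCross hN h (h.noCross_of_crossBound hN0 hb),
      fun h hb => eOp_lineUnder_join_left_of_noCross hN h (h.noCross_of_crossBound hN0 hb)⟩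
  | succ m ih =>
    exact ⟨fun h hb iy jy => ih.step_intertwine ht hN h hb iy jy,
      fun h hb => ih.step_join_right hN h hb, fun h hb => ih.step_join_left hN h hb⟩

/-- Drawing the new line intertwines the Temperley-Lieb generators that do not involve its start. -/
theorem eOp_lineUnder (ht : t₄ ≠ 0) (hN : 2 ≤ N) (h : NCAt N y σ) {i : ℤ}
    (iy : cls N i ≠ cls N y) (jy : cls N (i + 1) ≠ cls N y) :
    eOp R t₄ N i (lineUnder R t₄ N σ y) = eAt t₄ N (fun τ => lineUnder R t₄ N τ y) i σ :=
  (lineRelations ht hN N).intertwine h NCAt.crossBound iy jy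

/-- Moving the marked point where the new line starts from `y` to `y - 1`, that is, letting the line
start underneath the line at `y - 1`, amounts to putting a resolved crossing around the diagram. -/
theorem lineUnder_swap (ht : t₄ ≠ 0) (hN : 2 ≤ N) (h : NCAt N y σ) {σ' : ℤ → ℤ}
    (h' : NCAt N (y - 1) σ') (hy : σ (y - 1) = y - 1 → σ' y = y)
    (hc : σ (y - 1) ≠ y - 1 → σ' y = σ (y - 1))
    (ho : ∀ x, cls N x ≠ cls N y → cls N x ≠ cls N (y - 1) →
      cls N x ≠ cls N (σ (y - 1)) → σ' x = σ x) :
    lineUnder R t₄ N σ' (y - 1) =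
      t₄ • lineUnder R t₄ N σ y + t₄⁻¹ • eOp R t₄ N (y - 1) (lineUnder R t₄ N σ y) := by
  have hN0 : 0 < N := by omega
  have hj : y - 1 + 1 = y := by ring
  have h4 : cls N (y - 1) ≠ cls N y := by have := cls_ne_succ hN (y - 1); rwa [hj] at this
  have H := lineRelations (R := R) ht hN N
  obtain ⟨p, hp⟩ : ∃ p, σ (y - 1) = p := ⟨_, rfl⟩
  have lp := h.sub_lt hN0 (y - 1)
  have lp' := h.lt_add hN0 (y - 1)
  rw [hp] at hy hc ho lp lp'
  have hp' : σ p = y - 1 := by rw [← hp, h.invol]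
  have py : cls N p ≠ cls N y := by rw [← hp]; exact h.ne_of_fix h.fix h4
  rcases lt_trichotomy p (y - 1) with l | l | l
  · have pj : cls N p ≠ cls N (y - 1) := by rw [← hp]; exact h.partner_ne hN0 (by omega)
    have e1 := H.join_left h NCAt.crossBound hp l
    have hc := hc (by omega)
    have hq : σ' p = y := by rw [← hc, h'.invol]
    have hin : Inner σ' (y - 1) p := by
      refine ⟨by omega, by omega, fun x x1 x2 => ?_⟩
      have ne' : ∀ a b : ℤ, p ≤ a → a < b → b ≤ y - 1 → cls N a ≠ cls N b :=
        fun a b h1 h2 h3 e => by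
          have := add_le_of_cls_eq e h2; omega
      have i1 : cls N x ≠ cls N y := fun e => by
        have := add_le_of_cls_eq e (by omega)
        have : p ≠ y - N := fun e => py (by rw [e, cls_sub_self])
        omega
      rw [ho x i1 (ne' x (y - 1) (by omega) x2 (by omega)) (ne' p x (by omega) x1 (by omega)).symm]
      have := h.nc' (x := y - 1) (w := x) (by omega) (by omega) i1
      omega
    rw [lineUnder_inner hN0 h' hin hq, e1]
    have fy := h.fix
    have fy' := h'.fix
    have ey : ∀ x, cls N x = cls N y → σ x = x := fun x hx => by
      rw [apply_of_cls h.per hx, h.fix]; ring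
    have ej : ∀ x, cls N x = cls N (y - 1) → σ x = p + (x - (y - 1)) := fun x hx => by
      rw [apply_of_cls h.per hx, hp]
    have ep : ∀ x, cls N x = cls N p → σ x = y - 1 + (x - p) := fun x hx => by
      rw [apply_of_cls h.per hx, hp']
    congr 3
    · funext x; simp only [link3, link_apply]; grind
    · funext x; simp only [link3, link_apply]; grind
  · have h1 : σ (y - 1) = y - 1 := hp.trans l
    have hss : σ' = σ := by
      funext x
      by_cases x1 : cls N x = cls N y
      · rw [apply_of_cls h'.per x1, hy l, apply_of_cls h.per x1, h.fix]
      by_cases x2 : cls N x = cls N (y - 1)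
      · rw [apply_of_cls h'.per x2, h'.fix, apply_of_cls h.per x2, h1]
      exact ho x x1 x2 (l ▸ x2)
    rw [hss] at h' ⊢
    have nc1 : NoCross σ y := by
      intro x x1 x2
      have : x ≠ y - 1 := fun e => by rw [e, h1] at x2; omega
      exact (h.nc x (y - 1) (by omega) (by omega) h4).2.2 h1
    have nc2 : NoCross σ (y - 1) := by
      intro x x1 x2
      have : σ x ≠ y := fun e => by have := h.invol x; rw [e, h.fix] at this; omega
      exact (h'.nc x y (by omega) (by omega) h4.symm).2.2 h.fix
    have ei := cls_add_self (N := N) (y - 1)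
    have iN : σ (y - 1 + N) = y - 1 + N := by rw [h.per, h1]
    obtain ⟨-, p1, p2⟩ := h.isLinkPattern_link hN0 nc1 (d := y - 1 + N) iN (by omega) (by omega)
    have s1 : link N y (y - 1 + N) σ (y - 1) = y - 1 + 1 - N := by
      rw [link_apply, if_neg h4, if_pos ei.symm]; ring
    have s2 : link N y (y - 1 + N - N) σ (y - 1) = y - 1 + 1 := by
      rw [add_sub_cancel_right, link_apply, if_neg h4, if_pos rfl]; ring
    have w1 : link N (y - 1) y (link N y (y - 1 + N) σ) = link N (y - 1) y σ := by
      funext x; simp only [link_apply]; grind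
    have w2 : link N y (y - 1) σ = link N (y - 1) y σ := link_comm h4.symm _
    have w3 : link N (y - 1) (y - N) σ = link N y (y - 1 + N) σ := by
      have := cls_sub_self (N := N) y
      funext x; simp only [link_apply]; grind
    rw [lineUnder_noCross nc1, lineUnder_noCross nc2,
      finishAt_defect h (d := y - 1 + N) (by omega) (by omega) iN, map_add, eOp_smul,
      eOp_pat p1, eOp_pat p2, eAt_wrap hN s1, eAt_peak s2, hj, add_sub_cancel_right, w1, w2,
      finishAt_defect h' (d := y) (by omega) (by omega) h.fix, w3]
    simp only [smul_add, smul_smul]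
    have hw : t₄⁻¹ * punctureLoopWeight t₄ + t₄⁻¹ * (t₄ * loopWeight t₄) + t₄ * t₄ = 1 := by
      rw [punctureLoopWeight, loopWeight]; field_simp; ring
    linear_combination (norm := module) -hw • pat R N (link N (y - 1) y σ)
  · have n1 : p ≠ y := fun e => py (by rw [e])
    have hc := hc (by omega)
    have hin : Inner σ y (y - 1) := ⟨by omega, by omega, fun x x1 x2 => by omega⟩
    have pj : cls N p ≠ cls N (y - 1) := by rw [← hp]; exact h.partner_ne hN0 (by omega)
    have c1 := h.cut_left hN0 hin hp
    have c2 := h.cut_right hN0 hin hp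
    have w1 : link3 N y p (y - 1) σ = σ' := by
      funext x
      have hq : σ' p = y := by rw [← hc, h'.invol]
      by_cases x1 : cls N x = cls N y
      · rw [link3_left h4.symm x1, apply_of_cls h'.per x1, hc]
      by_cases x2 : cls N x = cls N (y - 1)
      · rw [link3_end x2, apply_of_cls h'.per x2, h'.fix]; ring
      by_cases x3 : cls N x = cls N p
      · rw [link3_right py.symm pj x3, apply_of_cls h'.per x3, hq]
      · rw [link3_other x1 x3 x2, ho x x1 x2 x3]
    have e1 := H.intertwine c1 NCAt.crossBound (i := y - 1) pj.symm (by rw [hj]; exact py.symm)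
    rw [eAt_peak (by rw [hj, link3_right h4.symm pj.symm rfl]; ring)] at e1
    have e2 := H.join_right c2 NCAt.crossBound (c := p)
      (by rw [hj, link3_left h4.symm rfl]; ring) (by omega)
    have w2 : link3 N (y - 1) (y - 1 + 1) p (link3 N y p (y - 1) σ) = link3 N y (y - 1) p σ := by
      rw [hj]
      funext x; simp only [link3, link_apply]; grind
    rw [w2] at e2
    rw [lineUnder_inner hN0 h hin hp, map_add, eOp_smul, eOp_smul, e1, e2, w1]
    simp only [smul_add, smul_smul]
    have hw : t₄⁻¹ * (t₄ * loopWeight t₄) + t₄ * t₄ + t₄⁻¹ * t₄⁻¹ = 0 := by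
      rw [loopWeight]; field_simp; ring
    rw [mul_inv_cancel₀ ht]
    linear_combination (norm := module) -hw • lineUnder R t₄ N (link3 N y (y - 1) p σ) p

end

/-! ### The maps of the tower draw a line underneath the arches -/

section

variable {R : Type} [CommRing R] [Algebra ℂ R] {t₄ : ℂ} {N n : ℕ} {σ : ℤ → ℤ} {y : ℤ}

/-- `l` lists the arches over the start `y` of the new line, from the innermost to the outermost. -/
structure CrossList (σ : ℤ → ℤ) (y : ℤ) (l : List (ℤ × ℤ)) : Prop where
  sorted : l.Pairwise (fun a b => b.1 < a.1)
  mem : ∀ a, a ∈ l ↔ a.1 < y ∧ y < σ a.1 ∧ a.2 = σ a.1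

/-- After smoothing the innermost crossing, the new line still has to cross the other arches of the
list, in the same order. -/
theorem NCAt.crossList_cut (h : NCAt N y σ) (hN : 0 < N) {o c : ℤ} {l : List (ℤ × ℤ)}
    (hl : CrossList σ y ((o, c) :: l)) :
    Inner σ y o ∧ σ o = c ∧ CrossList (link3 N y o c σ) c l ∧ CrossList (link3 N y c o σ) o l := by
  obtain ⟨hs, hm⟩ := hl
  rw [List.pairwise_cons] at hs
  obtain ⟨o1, o2, o3⟩ := (hm (o, c)).1 (by simp)
  dsimp only at o1 o2 o3
  have hin : Inner σ y o := by
    refine ⟨o1, o2, fun x x1 x2 => ?_⟩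
    by_contra hlt
    have n1 : σ x ≠ y := fun e => by have := h.invol x; rw [e, h.fix] at this; omega
    have := (hm (x, σ x)).2 ⟨x2, by dsimp only; omega, rfl⟩
    rcases List.mem_cons.1 this with e | e
    · have := congrArg Prod.fst e; dsimp only at this; omega
    · have := hs.1 _ e; dsimp only at this; omega
  have hc : σ o = c := o3.symm
  obtain ⟨f1, f2, f3, f4, f5, f6, f7⟩ := h.innerFacts hN hin hc
  have mem' : ∀ a, a ∈ l ↔ a.1 < y ∧ y < σ a.1 ∧ a.2 = σ a.1 ∧ a.1 ≠ o := by
    intro a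
    have := hm a
    rw [List.mem_cons] at this
    constructor
    · intro ha
      have h1 := this.1 (Or.inr ha)
      have h2 := hs.1 a ha
      exact ⟨h1.1, h1.2.1, h1.2.2, by dsimp only at h2; omega⟩
    · rintro ⟨h1, h2, h3, h4⟩
      rcases this.2 ⟨h1, h2, h3⟩ with e | e
      · exact absurd (by rw [e]) h4
      · exact e
  have cr : ∀ x, x < y → y < σ x → x ≠ o → x < o ∧ c < σ x ∧ cls N x ≠ cls N y ∧
      cls N x ≠ cls N o ∧ cls N x ≠ cls N c := by
    intro x x1 x2 x3
    have l1 : x < o := by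
      by_contra hlt
      have := hin.2.2 x (by omega) x1
      omega
    have l2 := h.nc x o l1 (by omega) f1
    refine ⟨l1, by omega, h.not_mark (by omega), fun e => ?_, fun e => ?_⟩
    · have := apply_of_cls h.per e
      have := add_le_of_cls_eq e l1
      omega
    · have := apply_of_cls h.per e
      omega
  refine ⟨hin, hc, ⟨hs.2, fun a => ?_⟩, ⟨hs.2, fun a => ?_⟩⟩
  · rw [mem']
    constructor
    · rintro ⟨h1, h2, h3, h4⟩
      obtain ⟨c1, c2, c3, c4, c5⟩ := cr a.1 h1 h2 h4
      rw [link3_other c3 c4 c5]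
      exact ⟨by omega, c2, h3⟩
    · rintro ⟨h1, h2, h3⟩
      by_cases e1 : cls N a.1 = cls N y
      · rw [link3_left f2.symm e1] at h2; omega
      by_cases e2 : cls N a.1 = cls N o
      · rw [link3_right f1.symm f3 e2] at h2
        have : ¬ o < a.1 := fun hlt => by
          have := add_le_of_cls_eq e2.symm hlt; omega
        omega
      by_cases e3 : cls N a.1 = cls N c
      · rw [link3_end e3] at h2; omega
      rw [link3_other e1 e2 e3] at h2 h3
      have n1 : a.1 ≠ o := fun e => e2 (by rw [e])
      have := h.nc o a.1
      refine ⟨?_, by omega, h3, n1⟩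
      by_contra hlt
      have := this (by omega) (by omega) e1
      omega
  · rw [mem']
    constructor
    · rintro ⟨h1, h2, h3, h4⟩
      obtain ⟨c1, c2, c3, c4, c5⟩ := cr a.1 h1 h2 h4
      rw [link3_other c3 c5 c4]
      exact ⟨by omega, by omega, h3⟩
    · rintro ⟨h1, h2, h3⟩
      by_cases e1 : cls N a.1 = cls N y
      · rw [link3_left f1.symm e1] at h2
        have := add_le_of_cls_eq e1 (by omega); omega
      by_cases e3 : cls N a.1 = cls N c
      · rw [link3_right f2.symm f3.symm e3] at h2
        have := add_le_of_cls_eq e3 (by omega); omega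
      by_cases e2 : cls N a.1 = cls N o
      · rw [link3_end e2] at h2; omega
      rw [link3_other e1 e3 e2] at h2 h3
      have := h.nc a.1 o h1 h2 f1
      exact ⟨by omega, by omega, h3, by omega⟩

/-- Resolving the crossings along a list computes `lineUnder`, whatever the values of the
connections at the start of the line are. -/
theorem resolve_eq_lineUnder (hN : 0 < N) {fin : (ℤ → ℤ) → ℤ → LinkModule R N}
    {I : (ℤ → ℤ) → ℤ → Prop}
    (hI : ∀ {S y o c}, NCAt N y S → Inner S y o → S o = c → I S y →
      I (link3 N y o c S) c ∧ I (link3 N y c o S) o)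
    (hfin : ∀ {S y τ}, NCAt N y S → NoCross S y → I S y →
      (∀ x, cls N x ≠ cls N y → τ x = S x) → fin τ y = finishAt R t₄ N S y)
    (l : List (ℤ × ℤ)) {τ : ℤ → ℤ} (h : NCAt N y σ) (hl : CrossList σ y l) (hi : I σ y)
    (hτ : ∀ x, cls N x ≠ cls N y → τ x = σ x) :
    resolve R t₄ N fin l τ y = lineUnder R t₄ N σ y := by
  induction l generalizing σ τ y with
  | nil =>
    have hn : NoCross σ y := fun x x1 x2 => by
      have := (hl.mem (x, σ x)).2 ⟨x1, x2, rfl⟩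
      simp at this
    rw [resolve, lineUnder_noCross hn, hfin h hn hi hτ]
  | cons a l ih =>
    obtain ⟨o, c⟩ := a
    obtain ⟨hin, hc, l1, l2⟩ := h.crossList_cut hN hl
    rw [resolve, lineUnder_inner hN h hin hc,
      ih (h.cut_left hN hin hc) l1 (hI h hin hc hi).1 fun x hx => ?_,
      ih (h.cut_right hN hin hc) l2 (hI h hin hc hi).2 fun x hx => ?_]
    · rw [link3, link_apply, link_apply N o o, if_neg hx, if_neg hx, link_apply]
      grind
    · rw [link3, link_apply, link_apply N c c, if_neg hx, if_neg hx, link_apply]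
      grind

section shift

theorem shiftPoint_strictMono (n : ℕ) : StrictMono (shiftPoint n) := fun a b h => by
  rcases Nat.eq_zero_or_pos n with rfl | hn
  · simpa [shiftPoint] using h
  have := Int.ediv_le_ediv (c := (n : ℤ)) (by omega) h.le
  unfold shiftPoint; omega

theorem shiftPoint_add_mul (hn : 0 < n) (x k : ℤ) :
    shiftPoint n (x + n * k) = shiftPoint n x + (n + 1 : ℕ) * k := by
  unfold shiftPoint
  rw [Int.add_mul_ediv_left _ _ (by omega)]; push_cast; ring

theorem shiftPoint_of_lt {x : ℤ} (h0 : 0 ≤ x) (h1 : x < n) : shiftPoint n x = x := by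
  unfold shiftPoint; rw [Int.ediv_eq_zero_of_lt h0 h1]; simp

theorem emod_shiftPoint (hn : 0 < n) (x : ℤ) :
    shiftPoint n x % ((n + 1 : ℕ) : ℤ) = x % n ∧ shiftPoint n x / ((n + 1 : ℕ) : ℤ) = x / n := by
  have h0 := Int.emod_nonneg x (b := (n : ℤ)) (by omega)
  have h1 := Int.emod_lt_of_pos x (b := (n : ℤ)) (by omega)
  have e : shiftPoint n x = x % n + ((n + 1 : ℕ) : ℤ) * (x / n) := by
    have := Int.mul_ediv_add_emod x n
    unfold shiftPoint; push_cast; linarith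
  rw [e, Int.add_mul_emod_self_left, Int.add_mul_ediv_left _ _ (by omega),
    Int.emod_eq_of_lt h0 (by omega), Int.ediv_eq_zero_of_lt h0 (by omega)]
  simp

theorem cls_shiftPoint_ne (hn : 0 < n) (x : ℤ) : cls (n + 1) (shiftPoint n x) ≠ cls (n + 1) n := by
  intro h
  rw [cls_eq, ← Int.emod_eq_emod_iff_emod_sub_eq_zero.trans
    (Int.dvd_iff_emod_eq_zero (a := ((n + 1 : ℕ) : ℤ))).symm, (emod_shiftPoint hn x).1,
    Int.emod_eq_of_lt (a := (n : ℤ)) (by omega) (by omega)] at h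
  have h1 := Int.emod_lt_of_pos x (b := (n : ℤ)) (by omega)
  omega

theorem extend_shiftPoint (hn : 0 < n) (σ : ℤ → ℤ) (x : ℤ) :
    extend n σ (shiftPoint n x) = shiftPoint n (σ x) := by
  have h1 := Int.emod_lt_of_pos x (b := (n : ℤ)) (by omega)
  obtain ⟨e1, e2⟩ := emod_shiftPoint hn x
  rw [extend, e1, e2, if_neg h1.ne]
  congr 2; unfold shiftPoint; ring

theorem exists_shiftPoint {y : ℤ} (hy : cls (n + 1) y ≠ cls (n + 1) n) :
    ∃ x, y = shiftPoint n x := by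
  have h0 := Int.emod_nonneg y (b := ((n + 1 : ℕ) : ℤ)) (by omega)
  have h1 := Int.emod_lt_of_pos y (b := ((n + 1 : ℕ) : ℤ)) (by omega)
  have e := Int.mul_ediv_add_emod y ((n + 1 : ℕ) : ℤ)
  have h2 : y % ((n + 1 : ℕ) : ℤ) ≠ n := fun e' => hy (by
    rw [cls_eq, ← e, e']; simp)
  have h3 : y % ((n + 1 : ℕ) : ℤ) < n := by push_cast at *; omega
  refine ⟨y % ((n + 1 : ℕ) : ℤ) + n * (y / ((n + 1 : ℕ) : ℤ)), ?_⟩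
  rw [shiftPoint_add_mul (by omega), shiftPoint_of_lt h0 h3]; linarith

theorem extend_of_cls {y : ℤ} (hy : cls (n + 1) y = cls (n + 1) n) : extend n σ y = y := by
  rw [cls_eq, ← Int.emod_eq_emod_iff_emod_sub_eq_zero.trans
    (Int.dvd_iff_emod_eq_zero (a := ((n + 1 : ℕ) : ℤ))).symm,
    Int.emod_eq_of_lt (a := (n : ℤ)) (by omega) (by omega)] at hy
  rw [extend, if_pos hy]

theorem cls_shiftPoint (hn : 0 < n) {x w : ℤ} :
    cls (n + 1) (shiftPoint n x) = cls (n + 1) (shiftPoint n w) ↔ cls n x = cls n w := by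
  rw [cls_eq_iff_exists, cls_eq_iff_exists]
  constructor
  · rintro ⟨k, hk⟩
    exact ⟨k, (shiftPoint_strictMono n).injective (by rw [hk, shiftPoint_add_mul hn])⟩
  · rintro ⟨k, rfl⟩
    exact ⟨k, shiftPoint_add_mul hn _ _⟩

/-- The extended diagram leaves exactly the new marked point without connection. -/
theorem ncAt_extend (hn : 0 < n) (h : NC n (fun _ => False) σ) : NCAt (n + 1) n (extend n σ) := by
  have mono := shiftPoint_strictMono n
  have cs : ∀ y : ℤ, cls (n + 1) y = cls (n + 1) n ∨ ∃ x, y = shiftPoint n x := fun y => by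
    by_cases hy : cls (n + 1) y = cls (n + 1) n
    · exact Or.inl hy
    · exact Or.inr (exists_shiftPoint hy)
  refine ⟨fun x => ?_, fun x => ?_, fun x hx => extend_of_cls hx, fun x w h1 h2 hw => ?_,
    fun x w h1 h2 hx hw => ?_⟩
  · rcases cs x with hx | ⟨a, rfl⟩
    · rw [extend_of_cls hx, extend_of_cls hx]
    · rw [extend_shiftPoint hn, extend_shiftPoint hn, h.invol]
  · rcases cs x with hx | ⟨a, rfl⟩
    · rw [extend_of_cls hx, extend_of_cls (by rw [cls_add_self, hx])]
    · have e := shiftPoint_add_mul hn a 1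
      rw [mul_one, mul_one] at e
      have e' := shiftPoint_add_mul hn (σ a) 1
      rw [mul_one, mul_one] at e'
      rw [← e, extend_shiftPoint hn, extend_shiftPoint hn, h.per, e']
  · obtain ⟨b, rfl⟩ := exists_shiftPoint hw
    rcases cs x with hx | ⟨a, rfl⟩
    · rw [extend_of_cls hx] at h2; omega
    · rw [extend_shiftPoint hn] at *
      have := h.nc a b (mono.lt_iff_lt.1 h1) (mono.lt_iff_lt.1 h2) id
      rw [extend_shiftPoint hn]
      exact ⟨mono this.1, mono this.2.1, fun e => this.2.2 (mono.injective e)⟩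
  · obtain ⟨b, rfl⟩ := exists_shiftPoint hw
    obtain ⟨a, rfl⟩ := exists_shiftPoint hx
    rw [extend_shiftPoint hn] at *
    exact (cls_shiftPoint hn).2 (h.uniq a b (mono.injective h1) (mono.injective h2) id id)

/-- Extension commutes with reconnecting two points. -/
theorem extend_link (hn : 0 < n) (p q : ℤ) :
    extend n (link n p q σ) = link (n + 1) (shiftPoint n p) (shiftPoint n q) (extend n σ) := by
  funext y
  by_cases hy : cls (n + 1) y = cls (n + 1) n
  · rw [extend_of_cls hy, link_apply, if_neg (hy ▸ (cls_shiftPoint_ne hn p).symm),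
      if_neg (hy ▸ (cls_shiftPoint_ne hn q).symm), extend_of_cls hy]
  obtain ⟨x, rfl⟩ := exists_shiftPoint hy
  have key : ∀ a b : ℤ, cls n x = cls n a →
      shiftPoint n (b + (x - a)) = shiftPoint n b + (shiftPoint n x - shiftPoint n a) := by
    intro a b hab
    obtain ⟨k, rfl⟩ := cls_eq_iff_exists.1 hab
    rw [add_sub_cancel_left, shiftPoint_add_mul hn, shiftPoint_add_mul hn, add_sub_cancel_left]
  rw [extend_shiftPoint hn, link_apply, link_apply]
  by_cases h1 : cls n x = cls n p
  · rw [if_pos h1, if_pos ((cls_shiftPoint hn).2 h1), key _ _ h1]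
  rw [if_neg h1, if_neg fun e => h1 ((cls_shiftPoint hn).1 e)]
  by_cases h2 : cls n x = cls n q
  · rw [if_pos h2, if_pos ((cls_shiftPoint hn).2 h2), key _ _ h2]
  rw [if_neg h2, if_neg fun e => h2 ((cls_shiftPoint hn).1 e), extend_shiftPoint hn]

theorem crossList_extend (hn : 0 < n) (h : NC n (fun _ => False) σ) :
    CrossList (extend n σ) n (crossedArches n σ) := by
  have mono := shiftPoint_strictMono n
  refine ⟨?_, fun a => ?_⟩
  · rw [crossedArches, List.pairwise_map]
    refine List.Pairwise.filter _ (List.pairwise_reverse.2 (List.pairwise_lt_range.imp ?_))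
    intro a b hab
    exact mono (by exact_mod_cast hab)
  · rw [crossedArches, List.mem_map]
    have sn : shiftPoint n n = n + 1 := by
      unfold shiftPoint; rw [Int.ediv_self (by omega)]
    have sn' : shiftPoint n (n - 1) = n - 1 := shiftPoint_of_lt (by omega) (by omega)
    constructor
    · rintro ⟨x, hx, rfl⟩
      simp only [List.mem_filter, List.mem_reverse, List.mem_range, decide_eq_true_eq] at hx
      dsimp only
      have h1 := mono.monotone hx.2
      rw [extend_shiftPoint hn, shiftPoint_of_lt (by omega) (by omega)]
      exact ⟨by omega, by omega, rfl⟩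
    · rintro ⟨h1, h2, h3⟩
      have ha : cls (n + 1) a.1 ≠ cls (n + 1) n := fun e => by
        rw [extend_of_cls e] at h2; omega
      obtain ⟨b, hb⟩ := exists_shiftPoint ha
      rw [hb] at h1 h2 h3
      rw [extend_shiftPoint hn] at h2 h3
      have b1 : b < n := by
        by_contra hlt
        have := mono.monotone (not_lt.1 hlt); omega
      have b2 : n ≤ σ b := by
        by_contra hlt
        have := mono.monotone (show σ b ≤ n - 1 by omega); omega
      have b3 := h.lt_add hn b
      lift b to ℕ using (by omega)
      refine ⟨b, ?_, by rw [Prod.ext_iff]; exact ⟨hb.symm, h3.symm⟩⟩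
      simp only [List.mem_filter, List.mem_reverse, List.mem_range, decide_eq_true_eq]
      exact ⟨by omega, b2⟩

end shift

/-- The map `φₙ` draws a new line from the inserted point to the puncture underneath all arches. -/
theorem phi_pat (hn : 0 < n) (h : IsLinkPattern n σ) :
    phi R t₄ n (pat R n σ) = lineUnder R t₄ (n + 1) (extend n σ) n := by
  have hN : 0 < n + 1 := by omega
  have hnc := NC.of_isLinkPattern hn h
  have he := ncAt_extend hn hnc
  have hl := crossList_extend hn hnc
  rw [pat_eq_single h, phi, Finsupp.linearCombination_single, one_smul]
  change resolve R t₄ (n + 1) (finish R t₄ n σ) (crossedArches n σ) (extend n σ) n = _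
  rcases Nat.mod_two_eq_zero_or_one n with hp | hp
  · refine resolve_eq_lineUnder hN (I := fun S y => ∀ x, S x = x → cls (n + 1) x = cls (n + 1) y)
      ?_ ?_ _ he hl ?_ (fun _ _ => rfl)
    · intro S y o c hS hin hc hI
      obtain ⟨f1, f2, f3, f4, f5, f6, f7⟩ := hS.innerFacts hN hin hc
      constructor
      · intro x hx
        rcases link3_fix (by omega) hx with e | e
        · rw [link3_left f2.symm (hI x e)] at hx; omega
        · exact e
      · intro x hx
        rcases link3_fix (by omega) hx with e | e
        · rw [link3_left f1.symm (hI x e)] at hx; omega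
        · exact e
    · intro S y τ hS hno hI hτ
      rw [finishAt_none hI, finish, if_pos hp]
      congr 1
      funext x
      by_cases hx : cls (n + 1) x = cls (n + 1) y
      · rw [link_apply, if_pos hx, apply_of_cls hS.per hx, hS.fix]
      · rw [link_apply, if_neg hx, if_neg hx, hτ x hx]
    · intro x hx
      by_contra hne
      obtain ⟨a, rfl⟩ := exists_shiftPoint hne
      rw [extend_shiftPoint hn] at hx
      have ha := (shiftPoint_strictMono n).injective hx
      obtain ⟨b, b1, b2, b3⟩ := exists_lift hn a 0
      have hb : σ b = b := by rw [apply_of_cls hnc.per b1, ha]; ring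
      have hd := h.defects
      rw [hp, Finset.card_eq_zero] at hd
      lift b to ℕ using b2
      have : b ∈ (Finset.range n).filter (fun x : ℕ => σ x = x) := by
        simp only [Finset.mem_filter, Finset.mem_range]; exact ⟨by omega, hb⟩
      rw [hd] at this; simp at this
  · have hd := h.defects
    rw [hp, Finset.card_eq_one] at hd
    obtain ⟨d, hd⟩ := hd
    have hd1 : d ∈ (Finset.range n).filter (fun x : ℕ => σ x = x) := by rw [hd]; simp
    simp only [Finset.mem_filter, Finset.mem_range] at hd1
    refine resolve_eq_lineUnder hN
      (I := fun S y => S d = d ∧ (d : ℤ) < y ∧ y < d + (n + 1 : ℕ)) ?_ ?_ _ he hl ?_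
      (fun _ _ => rfl)
    · rintro S y o c hS hin hc ⟨i1, i2, i3⟩
      obtain ⟨f1, f2, f3, f4, f5, f6, f7⟩ := hS.innerFacts hN hin hc
      have dy : cls (n + 1) d ≠ cls (n + 1) y := fun e => by
        have := eq_of_cls_eq e (by omega) (by omega); omega
      have dO : cls (n + 1) d ≠ cls (n + 1) o := fun e => by
        have := apply_of_cls hS.per e; omega
      have dc : cls (n + 1) d ≠ cls (n + 1) c := fun e => by
        have := apply_of_cls hS.per e; omega
      have ed := cls_add_self (N := n + 1) d
      have d1 : (d : ℤ) ≠ o := fun e => dO (by rw [e])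
      have d2 : (d : ℤ) + (n + 1 : ℕ) ≠ c := fun e => dc (by rw [← ed, e])
      have a1 := hS.nc o d
      have a2 := hS.nc o (d + (n + 1 : ℕ))
      rw [hS.per, i1] at a2
      have a3 : (d : ℤ) < o := by
        by_contra hlt
        exact (a1 (by omega) (by omega) dy).2.2 i1
      have a4 : c < d + (n + 1 : ℕ) := by
        by_contra hlt
        exact (a2 (by omega) (by omega) (ed ▸ dy)).2.2 rfl
      refine ⟨⟨by rw [link3_other dy dO dc, i1], by omega, a4⟩,
        ⟨by rw [link3_other dy dc dO, i1], a3, by omega⟩⟩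
    · rintro S y τ hS hno ⟨i1, i2, i3⟩ hτ
      have dy : cls (n + 1) d ≠ cls (n + 1) y := fun e => by
        have := eq_of_cls_eq e (by omega) (by omega); omega
      rw [finishAt_defect hS (d := d + (n + 1 : ℕ)) i3 (by omega) (by rw [hS.per, i1]), finish,
        if_neg (by omega), hd, Finset.sum_singleton, add_sub_cancel_right]
      have w : ∀ e, cls (n + 1) e = cls (n + 1) d → link (n + 1) y e τ = link (n + 1) y e S := by
        intro e he
        funext x
        rw [link_apply, link_apply]
        split_ifs with h1 h2
        · rfl
        · rfl
        · exact hτ x h1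
      rw [w _ rfl]
      push_cast
      rw [w _ (by have := cls_add_self (N := n + 1) d; push_cast at this; exact this)]
    · have sd := shiftPoint_of_lt (n := n) (x := d) (by omega) (by omega)
      refine ⟨?_, by omega, by push_cast; omega⟩
      have := extend_shiftPoint hn σ d
      rw [sd, hd1.2, sd] at this
      exact this

end

section

variable {R : Type} [CommRing R] [Algebra ℂ R] {t₄ : ℂ} {N n m : ℕ} {σ : ℤ → ℤ} {y : ℤ}

theorem extend_link3 (hn : 0 < n) (a b c : ℤ) :
    extend n (link3 n a b c σ) =
      link3 (n + 1) (shiftPoint n a) (shiftPoint n b) (shiftPoint n c) (extend n σ) := by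
  rw [link3, extend_link hn, extend_link hn, link3]

/-- The formula for the action of a Temperley-Lieb generator, transported along the insertion of the
new point. -/
theorem phi_eAt_pat (hn : 2 ≤ n) (h : IsLinkPattern n σ) {i : ℤ} (h0 : 0 ≤ i) (h1 : i + 1 < n) :
    phi R t₄ n (eAt t₄ n (pat R n) i σ) =
      eAt t₄ (n + 1) (fun τ => lineUnder R t₄ (n + 1) τ n) i (extend n σ) := by
  have hn0 : 0 < n := by omega
  have hnc := NC.of_isLinkPattern hn0 h
  have mono := shiftPoint_strictMono n
  have si : shiftPoint n i = i := shiftPoint_of_lt h0 (by omega)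
  have sj : shiftPoint n (i + 1) = i + 1 := shiftPoint_of_lt (by omega) h1
  have ei : extend n σ i = shiftPoint n (σ i) := by
    have := extend_shiftPoint hn0 σ i; rwa [si] at this
  have ej : extend n σ (i + 1) = shiftPoint n (σ (i + 1)) := by
    have := extend_shiftPoint hn0 σ (i + 1); rwa [sj] at this
  have h4 := cls_ne_succ hn i
  have h4' := cls_ne_succ (show 2 ≤ n + 1 by omega) i
  have ne : ∀ {a b : ℤ}, cls n a ≠ cls n b →
      cls (n + 1) (shiftPoint n a) ≠ cls (n + 1) (shiftPoint n b) := fun hab e =>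
    hab ((cls_shiftPoint hn0).1 e)
  have nei : ∀ {a : ℤ}, a ≠ i → shiftPoint n a ≠ i := fun ha e =>
      ha (mono.injective (e.trans si.symm))
  have nej : ∀ {a : ℤ}, a ≠ i + 1 → shiftPoint n a ≠ i + 1 :=
    fun ha e => ha (mono.injective (e.trans sj.symm))
  rcases hnc.cases_succ hn0 id id h4 with hk | hk | ⟨k1, k2, k3⟩ | ⟨k1, k2⟩ | ⟨k1, k2⟩
  · rw [eAt_peak hk, eAt_peak (by rw [ei, hk, sj]), LinearMap.map_smul_of_tower, phi_pat hn0 h]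
  · have hk' : σ (i + 1) = i + n := by
      have := hnc.per (σ i); rw [hnc.invol, hk] at this
      rw [← this]; congr 1; ring
    have hs : shiftPoint n (i + 1 - n) = i + 1 - (n + 1 : ℕ) := by
      have := shiftPoint_add_mul hn0 (i + 1) (-1)
      rw [sj] at this
      rw [show i + 1 - (n : ℤ) = i + 1 + n * -1 by ring, this]; ring
    rw [eAt_wrap hn hk, eAt_wrap (by omega) (by rw [ei, hk, hs]), LinearMap.map_smul_of_tower,
      phi_pat hn0 ((hnc.unwrap hk' h4).isLinkPattern hn0), extend_link hn0, si, sj]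
  · rw [eAt_arcs rfl rfl k1 k2 k3, eAt_arcs ei ej (nei k1) (nej k2) (by
        have := ne k3; rwa [sj] at this),
      phi_pat hn0 ((hnc.reconnect_arcs hn0 rfl rfl id id k1 k2 k3 h4).isLinkPattern hn0),
      extend_link hn0, extend_link hn0, si, sj]
  · have a1 : cls n (σ (i + 1)) ≠ cls n i := hnc.ne_of_fix k1 h4.symm
    have a2 := hnc.partner_ne hn0 k2
    rw [eAt_left h4 k1 rfl a1 a2, eAt_left h4' (by rw [ei, k1, si]) ej (by
        have := ne a1; rwa [si] at this) (by have := ne a2; rwa [sj] at this),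
      phi_pat hn0 ((hnc.reconnect_defect_left hn0 id id k1 rfl k2 h4).isLinkPattern hn0),
      extend_link3 hn0, si, sj]
  · have a1 : cls n (σ i) ≠ cls n (i + 1) := hnc.ne_of_fix k2 h4
    have a2 := hnc.partner_ne hn0 k1
    have hd := hnc.reconnect_defect_right hn0 id id k2 rfl k1 h4
    rw [link3_comm h4.symm] at hd
    rw [eAt_right rfl k2 a2 a1, eAt_right ei (by rw [ej, k2, sj]) (by
        have := ne a2; rwa [si] at this) (by have := ne a1; rwa [sj] at this),
      phi_pat hn0 (hd.isLinkPattern hn0), extend_link3 hn0, si, sj]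

theorem single_eq_smul_pat {R : Type} [CommRing R] (L : LinkPattern n) (a : R) :
    (Finsupp.single L a : LinkModule R n) = a • pat R n L.1 := by
  rw [pat_eq_single L.2, Finsupp.smul_single, smul_eq_mul, mul_one]; rfl

/-- The map `φₙ` intertwines the Temperley-Lieb generators that do not involve the new point. -/
theorem phi_eOp (ht : t₄ ≠ 0) {i : ℤ} (h0 : 0 ≤ i) (h1 : i + 1 < n) (v : LinkModule R n) :
    phi R t₄ n (eOp R t₄ n i v) = eOp R t₄ (n + 1) i (phi R t₄ n v) := by
  have hn : 2 ≤ n := by omega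
  have hN : 2 ≤ n + 1 := by omega
  induction v using Finsupp.induction_linear with
  | zero => simp
  | add f g hf hg => rw [map_add, map_add, map_add, map_add, hf, hg]
  | single L a =>
    have he := ncAt_extend (by omega) (NC.of_isLinkPattern (by omega) L.2)
    rw [single_eq_smul_pat, map_smul, map_smul, map_smul, map_smul, eOp_pat L.2,
      phi_eAt_pat hn L.2 h0 h1, phi_pat (by omega) L.2, eOp_lineUnder ht hN he]
    · intro e
      have := eq_of_cls_eq e (by omega) (by push_cast; omega); omega
    · intro e
      have := eq_of_cls_eq e (by omega) (by push_cast; omega); omega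

/-! ### Rotation -/

/-- Rotate a diagram counterclockwise by one marked point. -/
def rot (σ : ℤ → ℤ) : ℤ → ℤ := fun x => σ (x - 1) + 1

theorem rot_apply_add (σ : ℤ → ℤ) (x : ℤ) : rot σ (x + 1) = σ x + 1 := by simp [rot]

theorem cls_sub_one {a b : ℤ} : cls N (a - 1) = cls N b ↔ cls N a = cls N (b + 1) := by
  rw [cls_eq, cls_eq, show a - 1 - b = a - (b + 1) by ring]

theorem rot_link (p q : ℤ) (σ : ℤ → ℤ) :
    rot (link N p q σ) = link N (p + 1) (q + 1) (rot σ) := by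
  funext x
  simp only [rot, link, show ∀ a : ℤ, x - 1 - a = x - (a + 1) by intro a; ring]
  split_ifs <;> ring

theorem rot_link3 (a b c : ℤ) (σ : ℤ → ℤ) :
    rot (link3 N a b c σ) = link3 N (a + 1) (b + 1) (c + 1) (rot σ) := by
  rw [link3, rot_link, rot_link, link3]

/-- Rotate a diagram counterclockwise by `k` marked points. -/
def rotate (k : ℤ) (σ : ℤ → ℤ) : ℤ → ℤ := fun x => σ (x - k) + k

theorem NC.rotate {M M' : Cls N → Prop} (h : NC N M σ) (k : ℤ)
    (hM : ∀ x, M' (cls N (x + k)) ↔ M (cls N x)) : NC N M' (rotate k σ) := by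
  have hM' : ∀ x, M' (cls N x) ↔ M (cls N (x - k)) := fun x => by
    have := hM (x - k); rwa [sub_add_cancel] at this
  unfold QKZ.rotate
  refine ⟨fun x => by simp [h.invol], fun x => ?_, fun x hx => ?_, fun x w h1 h2 hw => ?_,
    fun x w h1 h2 hx hw => ?_⟩
  · rw [show x + (N : ℤ) - k = x - k + N by ring, h.per]; ring
  · rw [h.mark _ ((hM' x).1 hx)]; ring
  · have := h.nc (x - k) (w - k) (by omega) (by omega) (by rwa [← hM'])
    omega
  · have := h.uniq (x - k) (w - k) (by omega) (by omega) (by rwa [← hM']) (by rwa [← hM'])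
    have := cls_add k this
    simpa using this

theorem NCAt.rot (h : NCAt N y σ) : NCAt N (y + 1) (QKZ.rot σ) := NC.rotate h 1 fun x =>
  ⟨fun e => by have := cls_add (-1) e; simpa using this, fun e => cls_add 1 e⟩

theorem IsLinkPattern.rot (hN : 0 < N) (h : IsLinkPattern N σ) : IsLinkPattern N (QKZ.rot σ) :=
  ((NC.of_isLinkPattern hN h).rotate 1 fun _ => Iff.rfl).isLinkPattern hN

theorem rhoOp_pat {R : Type} [CommRing R] (h : IsLinkPattern N σ) : rhoOp R N (pat R N σ) =
    pat R N (rot σ) := by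
  rw [pat_eq_single h, rhoOp, Finsupp.linearCombination_single, one_smul]; rfl

theorem rhoOp_smul (a : ℂ) (v : LinkModule R N) : rhoOp R N (a • v) = a • rhoOp R N v :=
  LinearMap.map_smul_of_tower _ _ _

theorem rhoOp_lineUnder_of_crossBound (hN : 0 < N) (h : NCAt N y σ) (hb : CrossBound N m σ y) :
    rhoOp R N (lineUnder R t₄ N σ y) = lineUnder R t₄ N (rot σ) (y + 1) := by
  have hno : ∀ {σ y}, NCAt N y σ → NoCross σ y →
      rhoOp R N (lineUnder R t₄ N σ y) = lineUnder R t₄ N (rot σ) (y + 1) := by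
    intro σ y h hn
    have hn' : NoCross (rot σ) (y + 1) := fun x x1 x2 => hn (x - 1) (by omega) (by
      unfold rot at x2; omega)
    rw [lineUnder_noCross hn, lineUnder_noCross hn']
    rcases h.none_or_defect hN with hd | ⟨d, d1, d2, d3⟩
    · have hd' : ∀ x, rot σ x = x → cls N x = cls N (y + 1) := fun x hx => by
        have := cls_add 1 (hd (x - 1) (by unfold rot at hx; omega))
        simpa using this
      rw [finishAt_none hd, finishAt_none hd', rhoOp_pat (h.isLinkPattern_none hN hn hd)]
    · obtain ⟨-, p1, p2⟩ := h.isLinkPattern_link hN hn d3 d1 d2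
      rw [finishAt_defect h d1 d2 d3, finishAt_defect h.rot (d := d + 1) (by omega) (by omega)
        (by rw [rot_apply_add, d3]), map_add, rhoOp_smul, rhoOp_pat p1, rhoOp_pat p2, rot_link,
        rot_link, show d - N + 1 = d + 1 - (N : ℤ) by ring]
  induction m generalizing σ y with
  | zero => exact hno h (h.noCross_of_crossBound hN hb)
  | succ m ih =>
    by_cases hn : NoCross σ y
    · exact hno h hn
    obtain ⟨o, ho⟩ := h.exists_inner hn
    have ho' : Inner (rot σ) (y + 1) (o + 1) := by
      obtain ⟨o1, o2, o3⟩ := ho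
      refine ⟨by omega, by rw [rot_apply_add]; omega, fun x x1 x2 => ?_⟩
      have := o3 (x - 1) (by omega) (by omega)
      unfold rot; omega
    rw [lineUnder_inner hN h ho rfl, lineUnder_inner hN h.rot ho' (rot_apply_add σ o), map_add,
      rhoOp_smul, rhoOp_smul, ih (h.cut_left hN ho rfl) (h.crossBound_cut_left hN ho rfl hb),
      ih (h.cut_right hN ho rfl) (h.crossBound_cut_right hN ho rfl hb), rot_link3, rot_link3]

/-- Rotating the diagram and the new line together changes nothing but the position of the start. -/
theorem rhoOp_lineUnder (hN : 0 < N) (h : NCAt N y σ) :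
    rhoOp R N (lineUnder R t₄ N σ y) = lineUnder R t₄ N (rot σ) (y + 1) :=
  rhoOp_lineUnder_of_crossBound hN h NCAt.crossBound

/-- The map `φₙ` intertwines `ρ` with `ρ` followed by a crossing of the new line with the line that
was rotated past it. -/
theorem phi_rhoOp (ht : t₄ ≠ 0) (hn : 0 < n) (v : LinkModule R n) :
    phi R t₄ n (rhoOp R n v) = rhoOp R (n + 1) (t₄ • phi R t₄ n v +
      t₄⁻¹ • eOp R t₄ (n + 1) (n - 1) (phi R t₄ n v)) := by
  have hN : 2 ≤ n + 1 := by omega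
  have mono := shiftPoint_strictMono n
  induction v using Finsupp.induction_linear with
  | zero => simp
  | add f g hf hg => simp only [map_add, hf, hg, smul_add]; abel
  | single L a =>
    have hL := NC.of_isLinkPattern hn L.2
    have he := ncAt_extend hn hL
    have hr := ncAt_extend hn (NC.of_isLinkPattern hn (L.2.rot hn))
    -- the diagram in which the line at `n - 1` has been moved to `n`
    obtain ⟨τ, hτ⟩ : ∃ τ, τ = rotate (-1) (extend n (rot L.1)) := ⟨_, rfl⟩
    have rτ : rot τ = extend n (rot L.1) := by
      funext x; rw [hτ]; simp [rot, rotate]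
    have nτ : NCAt (n + 1) (n - 1) τ := by
      rw [hτ]
      exact NC.rotate hr (-1) fun x => by rw [← sub_eq_add_neg, cls_sub_one, sub_add_cancel]
    have sn : shiftPoint n n = n + 1 := by unfold shiftPoint; rw [Int.ediv_self (by omega)]
    have sn' : shiftPoint n (n - 1) = n - 1 := shiftPoint_of_lt (by omega) (by omega)
    have e1 : extend n L.1 (n - 1) = shiftPoint n (L.1 (n - 1)) := by
      have := extend_shiftPoint hn L.1 (n - 1); rwa [sn'] at this
    have tn : τ n = shiftPoint n (L.1 (n - 1) + 1) - 1 := by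
      have := extend_shiftPoint hn (rot L.1) n
      rw [sn] at this
      rw [hτ, rotate, sub_neg_eq_add, this, ← sub_eq_add_neg]; rfl
    -- unless `x + 1` is divisible by `n`, the shift commutes with the successor
    have ss : ∀ x : ℤ, cls n x ≠ cls n (n - 1) → shiftPoint n (x + 1) = shiftPoint n x + 1 := by
      intro x hx
      obtain ⟨b, b1, b2, b3⟩ := exists_lift hn x 0
      obtain ⟨k, hk⟩ := cls_eq_iff_exists.1 b1.symm
      have : b ≠ n - 1 := fun e => hx (by rw [← b1, e])
      rw [hk, add_right_comm, shiftPoint_add_mul hn, shiftPoint_add_mul hn,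
        shiftPoint_of_lt b2 (by omega), shiftPoint_of_lt (by omega) (by omega)]; ring
    have hsw := lineUnder_swap (R := R) ht hN he (σ' := τ) nτ (fun e => ?_) (fun e => ?_)
      (fun x x1 x2 x3 => ?_)
    · rw [single_eq_smul_pat, map_smul, map_smul, map_smul, map_smul, rhoOp_pat L.2,
        phi_pat hn (L.2.rot hn), phi_pat hn L.2, smul_comm t₄, smul_comm t₄⁻¹, ← smul_add,
        map_smul, ← hsw, rhoOp_lineUnder (by omega) nτ, rτ, sub_add_cancel]
    · have : L.1 (n - 1) = n - 1 := mono.injective (by rw [← e1, e, sn'])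
      rw [tn, this, sub_add_cancel, sn]; ring
    · rw [tn, e1, ss, add_sub_cancel_right]
      intro e'
      have := hL.partner_ne hn (x := n - 1) (fun e'' => e (by rw [e1, e'', sn']))
      exact this e'
    · obtain ⟨b, rfl⟩ := exists_shiftPoint x1
      have b1 : cls n b ≠ cls n (n - 1) := fun e => x2 (by
        have := (cls_shiftPoint hn).2 e; rwa [sn'] at this)
      have b2 : cls n (L.1 b) ≠ cls n (n - 1) := fun e => x3 (by
        rw [e1, cls_shiftPoint hn, ← hL.invol b]; exact cls_apply hL.per e)
      rw [hτ, extend_shiftPoint hn, rotate, sub_neg_eq_add, ← ss b b1, extend_shiftPoint hn,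
        rot_apply_add, ss _ b2]; ring

end

/-! ### The fully nested diagram -/

section

variable {R : Type} [CommRing R] [Algebra ℂ R] {t₄ : ℂ} {N n m : ℕ} {σ : ℤ → ℤ} {y : ℤ}

/-- Every arch contains a little arch that joins two neighbouring points. -/
theorem NC.exists_peak (h : NC N (fun _ => False) σ) {a : ℤ} (ha : a < σ a) :
    ∃ i, a ≤ i ∧ i < σ a ∧ σ i = i + 1 := by
  obtain ⟨k, hk⟩ : ∃ k : ℕ, σ a - a = k := ⟨(σ a - a).toNat, by omega⟩
  induction k using Nat.strong_induction_on generalizing a with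
  | _ k ih =>
    by_cases e : σ a = a + 1
    · exact ⟨a, le_rfl, ha, e⟩
    have h1 := h.nc a (a + 1) (by omega) (by omega) id
    obtain ⟨i, i1, i2, i3⟩ := ih (σ (a + 1) - (a + 1)).toNat (by omega) (a := a + 1) (by omega)
      (by omega)
    exact ⟨i, by omega, by omega, i3⟩

/-- The fully nested diagram is determined by the arches over the boundary segment between the last
and the first point. -/
theorem eq_nestedFun (hN : 0 < N) (h : NC N (fun _ => False) σ)
    (hv : ∀ j : ℤ, 0 ≤ j → 2 * j + 1 < N → σ (N - 1 - j) = N + j) : σ = nestedFun N := by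
  have hv' : ∀ j : ℤ, 0 ≤ j → 2 * j + 1 < N → σ j = -1 - j := by
    intro j h0 h1
    have := h.invol (N - 1 - j)
    rw [hv j h0 h1, show (N : ℤ) + j = j + N by ring, h.per] at this
    omega
  have lift : ∀ x : ℤ, ∃ k r : ℤ, x = r + N * k ∧ 0 ≤ r ∧ r < N := fun x =>
    ⟨x / N, x % N, by have := Int.mul_ediv_add_emod x N; omega, Int.emod_nonneg _ (by omega),
      Int.emod_lt_of_pos _ (by omega)⟩
  funext x
  obtain ⟨k, r, rfl, r0, r1⟩ := lift x
  rw [apply_add_mul h.per, add_comm]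
  rcases lt_trichotomy (2 * r + 1) (N : ℤ) with e | e | e
  · rw [add_comm r, nestedFun_of_lt r0 e, hv' r r0 e]; ring
  · rw [add_comm r, nestedFun_of_eq r0 e]
    congr 1
    by_contra hne
    obtain ⟨l, s, hs, s0, s1⟩ := lift (σ r)
    have h1 := h.invol r
    rw [hs, apply_add_mul h.per] at h1
    have hc := cls_apply h.per (cls_eq_iff_exists.2 ⟨l, hs⟩)
    rw [h.invol] at hc
    rcases lt_trichotomy (2 * s + 1) (N : ℤ) with e' | e' | e'
    · rw [hv' s s0 e', ← cls_add_self (-1 - s)] at hc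
      have := eq_of_cls_eq hc (by omega) (by omega)
      omega
    · have : s = r := by omega
      exact h.partner_ne hN hne (by rw [cls_eq_iff_exists]; exact ⟨l, by rw [hs, this]⟩)
    · have h2 := hv (N - 1 - s) (by omega) (by omega)
      rw [show (N : ℤ) - 1 - (N - 1 - s) = s by ring] at h2
      rw [h2, ← cls_add_self] at hc
      have := eq_of_cls_eq hc (by omega) (by omega)
      omega
  · have h2 := hv (N - 1 - r) (by omega) (by omega)
    rw [show (N : ℤ) - 1 - (N - 1 - r) = r by ring] at h2
    rw [add_comm r, nestedFun_of_gt r1 e, h2]; ring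

/-- The fully nested diagram is the only one in which the first and the last marked point are the
only neighbours that may be joined by a little arch. -/
theorem eq_nestedFun_of_no_peak (hN : 0 < N) (h : NC N (fun _ => False) σ)
    (hp : ∀ i : ℤ, 0 ≤ i → i + 1 < N → σ i ≠ i + 1) : σ = nestedFun N := by
  -- every arch passes over the boundary segment between the last and the first point
  have hpk : ∀ a, a < σ a → ∃ k : ℤ, a ≤ N * k - 1 ∧ N * k - 1 < σ a := by
    intro a ha
    obtain ⟨i, i1, i2, i3⟩ := h.exists_peak ha
    obtain ⟨b, b1, b2, b3⟩ := exists_lift hN i 0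
    obtain ⟨k, hk⟩ := cls_eq_iff_exists.1 b1.symm
    have hb : σ b = b + 1 := by rw [apply_of_cls h.per b1, i3]; ring
    have : b = N - 1 := by
      by_contra hne
      exact hp b b2 (by omega) hb
    refine ⟨k + 1, ?_, ?_⟩ <;> rw [mul_add] <;> omega
  have hpk0 : ∀ a b : ℤ, 0 ≤ a → b < N → a < b → σ a ≠ b := by
    rintro a b h0 h1 h2 rfl
    obtain ⟨k, k1, k2⟩ := hpk a h2
    have : 0 < k := by by_contra hk; nlinarith
    nlinarith
  refine eq_nestedFun hN h fun j => ?_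
  obtain ⟨l, hl⟩ : ∃ l : ℕ, j.toNat = l := ⟨_, rfl⟩
  induction l using Nat.strong_induction_on generalizing j with
  | _ l ih =>
    intro j0 j1
    have ih' : ∀ i : ℤ, 0 ≤ i → i < j → σ (N - 1 - i) = N + i := fun i i0 i1 =>
      ih i.toNat (by omega) i rfl i0 (by omega)
    -- the points `N - j, …, N + j - 1` are joined to each other
    have blk : ∀ x, N - j ≤ x → x < N + j → N - j ≤ σ x ∧ σ x < N + j := by
      intro x x1 x2
      rcases lt_or_ge x N with hx | hx
      · have := ih' (N - 1 - x) (by omega) (by omega)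
        rw [show (N : ℤ) - 1 - (N - 1 - x) = x by ring] at this
        omega
      · have h1 := ih' (x - N) (by omega) (by omega)
        have h2 := h.invol (N - 1 - (x - N))
        rw [h1, show (N : ℤ) + (x - N) = x by ring] at h2
        omega
    have out : ∀ x, ¬ (N - j ≤ x ∧ x < N + j) → ¬ (N - j ≤ σ x ∧ σ x < N + j) := by
      intro x hx hs
      have := blk (σ x) hs.1 hs.2
      rw [h.invol] at this
      exact hx this
    obtain ⟨p, hp'⟩ : ∃ p, σ (N - 1 - j) = p := ⟨_, rfl⟩
    have op := out (N - 1 - j) (by omega)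
    have ow := out (N + j) (by omega)
    have lp := h.lt_add hN (N - 1 - j)
    have lp' := h.sub_lt hN (N - 1 - j)
    have lw := h.lt_add hN (N + j)
    have pw := h.per (N + j - N)
    have pN := h.per (N - 1 - j - N)
    rw [sub_add_cancel] at pw pN
    have key := hpk0 (N + j - N) (σ (N + j - N)) (by omega)
    have key' := hpk0 (σ (N - 1 - j)) (N - 1 - j)
    rcases lt_trichotomy (σ (N - 1 - j)) (N - 1 - j) with e | e | e
    · exfalso
      have o2 := out (N - 1 - j + N) (by omega)
      rw [h.per] at o2
      exact key' (by omega) (by omega) e (h.invol _)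
    · exfalso
      have hne : σ (N + j) ≠ N + j := fun e' => by
        have := h.uniq _ _ e e' id id
        have := eq_of_cls_eq this (by omega) (by omega)
        omega
      rcases lt_or_gt_of_ne hne with e' | e'
      · have := h.nc' (x := N + j) (w := N - 1 - j)
        rw [e] at this
        have n1 : σ (N + j) ≠ N - 1 - j := fun e2 => by
          have := h.invol (N + j); rw [e2, e] at this; omega
        exact (this (by omega) (by omega) id).2.2 rfl
      · have o2 := out (N + j - N)
        have : σ (N + j) < 2 * N - j := by
          by_contra hlt
          have b2 := blk (σ (N + j) - N) (by omega) (by omega)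
          have := h.per (σ (N + j) - N)
          rw [sub_add_cancel, h.invol] at this
          omega
        exact key (by omega) (by omega) rfl
    · by_contra hne
      have := h.nc (N - 1 - j) (N + j) (by omega) (by omega) id
      exact key (by omega) (by omega) rfl

/-- The only little arch of the fully nested diagram joins the last point to the first one. -/
theorem nestedFun_ne_succ {i : ℤ} (h0 : 0 ≤ i) (h1 : i + 1 < N) : nestedFun N i ≠ i + 1 := by
  have e : i = N * 0 + i := by ring
  rcases lt_trichotomy (2 * i + 1) (N : ℤ) with h | h | h
  · rw [e, nestedFun_of_lt h0 h]; omega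
  · rw [e, nestedFun_of_eq h0 h]; omega
  · rw [e, nestedFun_of_gt (by omega) h]; omega

theorem pat_apply_of_ne {R : Type} [CommRing R] (K : LinkPattern N) (h : K.1 ≠ σ) : pat R N σ K =
    0 := by
  unfold pat
  split_ifs with hσ
  · exact Finsupp.single_eq_of_ne fun e => h (congrArg Subtype.val e)
  · rfl

/-- The image of a Temperley-Lieb generator is spanned by diagrams with a little arch. -/
theorem eOp_apply_of_ne (hN : 2 ≤ N) {i : ℤ} (K : LinkPattern N) (hK : K.1 i ≠ i + 1)
    (v : LinkModule R N) : eOp R t₄ N i v K = 0 := by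
  have h4 := cls_ne_succ hN i
  have hl : ∀ τ, pat R N (link N i (i + 1) τ) K = 0 := fun τ => by
    refine pat_apply_of_ne K fun e => hK ?_
    rw [e, link_apply, if_pos rfl]; ring
  induction v using Finsupp.induction_linear with
  | zero => simp
  | add f g hf hg => rw [map_add, Finsupp.add_apply, hf, hg, add_zero]
  | single L a =>
    rw [eOp_single, Finsupp.smul_apply]
    suffices eAt t₄ N (pat R N) i L.1 K = 0 by rw [this, smul_zero]
    unfold eAt
    split_ifs with h1 <;> try rw [Finsupp.smul_apply]
    · rw [pat_apply_of_ne K (fun e => hK (by rw [e, h1])), smul_zero]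
    · rw [hl, smul_zero]
    all_goals exact hl _

/-- A diagram with a little arch is an eigenvector of a Temperley-Lieb generator with the nonzero
eigenvalue `loopWeight t₄`, and so is the result of drawing the new line. -/
theorem lineUnder_apply_of_peak (ht : t₄ ≠ 0) (hl : loopWeight t₄ ≠ 0) (hN : 2 ≤ N)
    (h : NCAt N y σ) {i : ℤ} (hi : σ i = i + 1) (K : LinkPattern N) (hK : K.1 i ≠ i + 1) :
    lineUnder R t₄ N σ y K = 0 := by
  have iy : cls N i ≠ cls N y := h.not_mark (by omega)
  have jy : cls N (i + 1) ≠ cls N y := hi ▸ h.ne_of_fix h.fix iy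
  have e := eOp_lineUnder (R := R) ht hN h iy jy
  rw [eAt_peak hi] at e
  have e2 := eOp_apply_of_ne hN K hK (lineUnder R t₄ N σ y) (t₄ := t₄)
  rw [e, Finsupp.smul_apply] at e2
  exact (smul_eq_zero_iff_right hl).1 e2

/-- At each crossing of the nested diagram only the smoothing of weight `t₄⁻¹` contributes to the
nested component; the other smoothing leaves a little arch in the wrong place. Here `m` is the
number of crossings that remain. -/
theorem lineUnder_apply_nested (ht : t₄ ≠ 0) (hl : loopWeight t₄ ≠ 0) (hn : 0 < n) (m : ℕ) :
    ∀ {σ : ℤ → ℤ} {k : ℤ}, k + m = (n / 2 : ℕ) → 0 ≤ k → NCAt (n + 1) (n - k) σ →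
    (∀ j : ℤ, k ≤ j → j < (n / 2 : ℕ) → σ (n - 1 - j) = n + 1 + j) →
    (∀ j : ℤ, 0 ≤ j → j < k → σ (n - j) = n + 1 + j) →
    (n % 2 = 1 → σ (n / 2 : ℕ) = (n / 2 : ℕ)) →
    lineUnder R t₄ (n + 1) σ (n - k) (nested (n + 1)) = algebraMap ℂ R (t₄⁻¹ ^ m) := by
  have hN : 2 ≤ n + 1 := by omega
  have hcN : ((n + 1 : ℕ) : ℤ) = n + 1 := by push_cast; ring
  induction m with
  | zero =>
    intro σ k hk k0 h _ h2 h3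
    have hk' : k = (n / 2 : ℕ) := by omega
    subst hk'
    have h2' : ∀ j : ℤ, 0 ≤ j → j < (n / 2 : ℕ) → σ j = -1 - j := fun j j0 j1 => by
      have := h.invol (n - j)
      rw [h2 j j0 j1, show (n : ℤ) + 1 + j = j + (n + 1 : ℕ) by push_cast; ring, h.per] at this
      push_cast at this; omega
    have hno : NoCross σ (n - (n / 2 : ℕ)) := by
      by_contra hc
      obtain ⟨o, o1, o2, -⟩ := h.exists_inner hc
      have o3 := h.lt_add (by omega) o
      rw [hcN] at o3
      rcases lt_or_ge o 0 with e | e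
      · have := h.per o
        have e2 := h2 (n - (o + (n + 1 : ℕ))) (by omega) (by omega)
        rw [show (n : ℤ) - (n - (o + (n + 1 : ℕ))) = o + (n + 1 : ℕ) by ring] at e2
        omega
      · by_cases e' : o < (n / 2 : ℕ)
        · have := h2' o e e'; omega
        · have : o = (n / 2 : ℕ) := by omega
          rw [this, h3 (by omega)] at o2; omega
    rw [lineUnder_noCross hno, pow_zero, map_one]
    rcases Nat.mod_two_eq_zero_or_one n with hp | hp
    · have hd : ∀ x, σ x = x → cls (n + 1) x = cls (n + 1) (n - (n / 2 : ℕ)) := by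
        intro x hx
        obtain ⟨b, b1, b2, b3⟩ := exists_lift (N := n + 1) (by omega) x 0
        have hb : σ b = b := by rw [apply_of_cls h.per b1, hx]; ring
        rw [← b1]
        congr 1
        by_contra hne
        rcases lt_or_ge b (n / 2 : ℕ) with e | e
        · have := h2' b b2 e; omega
        · have := h2 (n - b) (by omega) (by omega)
          rw [show (n : ℤ) - (n - b) = b by ring] at this; omega
      have hpat := h.isLinkPattern_none (by omega) hno hd
      have : σ = nestedFun (n + 1) := eq_nestedFun (by omega) (NC.of_isLinkPattern (by omega) hpat)
        fun j j0 j1 => by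
          rw [show ((n + 1 : ℕ) : ℤ) - 1 - j = n - j by push_cast; ring, h2 j j0 (by omega)]
          push_cast; ring
      rw [finishAt_none hd, pat_eq_single hpat]
      have e : hpat.toPattern = nested (n + 1) := Subtype.ext this
      rw [e, Finsupp.single_eq_same]
    · have fd := h3 hp
      have hde := cls_add_self (N := n + 1) (n / 2 : ℕ)
      obtain ⟨hdy, p1, p2⟩ := h.isLinkPattern_link (by omega) hno
        (d := (n / 2 : ℕ) + (n + 1 : ℕ)) (by rw [h.per, fd]) (by omega) (by omega)
      have : link (n + 1) (n - (n / 2 : ℕ)) ((n / 2 : ℕ) + (n + 1 : ℕ)) σ = nestedFun (n + 1) :=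
        eq_nestedFun (by omega) (NC.of_isLinkPattern (by omega) p1) fun j j0 j1 => by
          rw [show ((n + 1 : ℕ) : ℤ) - 1 - j = n - j by push_cast; ring]
          rcases eq_or_ne j (n / 2 : ℕ) with e | e
          · rw [e, link_apply, if_pos rfl]; push_cast; ring
          · have n1 : cls (n + 1) (n - j) ≠ cls (n + 1) (n - (n / 2 : ℕ)) := fun e' => by
              have := eq_of_cls_eq e' (by omega) (by omega); omega
            have n2 : cls (n + 1) (n - j) ≠ cls (n + 1) (n / 2 : ℕ) := fun e' => by
              have := eq_of_cls_eq e' (by omega) (by omega); omega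
            rw [link_apply, if_neg n1, if_neg (hde ▸ n2), h2 j j0 (by omega)]
            push_cast; ring
      rw [finishAt_defect h (d := (n / 2 : ℕ) + (n + 1 : ℕ)) (by omega) (by omega)
        (by rw [h.per, fd]), Finsupp.add_apply, Finsupp.smul_apply, pat_eq_single p1]
      have e : p1.toPattern = nested (n + 1) := Subtype.ext this
      rw [e, Finsupp.single_eq_same, pat_apply_of_ne, smul_zero, add_zero]
      -- the other way of joining the two lines gives a little arch in the middle
      intro e'
      refine nestedFun_ne_succ (N := n + 1) (i := (n / 2 : ℕ)) (by omega) (by omega) ?_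
      have : nestedFun (n + 1) = (nested (n + 1)).1 := rfl
      rw [this, e', add_sub_cancel_right, link_apply, if_neg (hde ▸ hdy), if_pos rfl]
      omega
  | succ m ih =>
    intro σ k hk k0 h h1 h2 h3
    have hc := h1 k le_rfl (by omega)
    have hin : Inner σ (n - k) (n - 1 - k) := ⟨by omega, by omega, fun x x1 x2 => by omega⟩
    obtain ⟨f1, f2, f3, f4, f5, f6, f7⟩ := h.innerFacts (by omega) hin hc
    have n1 := h.cut_left (by omega) hin hc
    have n2 := h.cut_right (by omega) hin hc
    have ne : ∀ j : ℤ, k < j → j < n - k → σ (n - j) = link3 (n + 1) (n - k) (n + 1 + k)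
        (n - 1 - k) σ (n - j) ∨ j = k + 1 := by
      intro j j0 j1
      by_cases e : j = k + 1
      · exact Or.inr e
      refine Or.inl (link3_other (fun e' => ?_) (fun e' => ?_) (fun e' => ?_)).symm
      · have := eq_of_cls_eq e' (by omega) (by omega); omega
      · rw [← cls_add_self] at e'
        have := eq_of_cls_eq e' (by omega) (by omega); omega
      · have := eq_of_cls_eq e' (by omega) (by omega); omega
    rw [lineUnder_inner (by omega) h hin hc, Finsupp.add_apply, Finsupp.smul_apply,
      Finsupp.smul_apply, lineUnder_apply_of_peak ht hl hN n1 (i := n - 1 - k)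
        (by rw [link3_right f1.symm f3 rfl]; ring) (nested (n + 1))
        (nestedFun_ne_succ (N := n + 1) (by omega) (by omega)),
      smul_zero, zero_add]
    have := ih (σ := link3 (n + 1) (n - k) (n + 1 + k) (n - 1 - k) σ) (k := k + 1) (by omega)
      (by omega) (by rwa [show (n : ℤ) - (k + 1) = n - 1 - k by ring]) ?_ ?_ ?_
    · rw [show (n : ℤ) - (k + 1) = n - 1 - k by ring] at this
      rw [this, Algebra.smul_def, ← map_mul, pow_succ, mul_comm]
    · intro j j0 j1
      rcases ne (j + 1) (by omega) (by omega) with e | e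
      · rw [show (n : ℤ) - 1 - j = n - (j + 1) by ring, ← e,
          show (n : ℤ) - (j + 1) = n - 1 - j by ring, h1 j (by omega) j1]
      · omega
    · intro j j0 j1
      rcases eq_or_ne j k with e | e
      · rw [e, link3_left f1.symm rfl]; ring
      rw [link3_other (fun e' => ?_) (fun e' => ?_) (fun e' => ?_), h2 j j0 (by omega)]
      · have := eq_of_cls_eq e' (by omega) (by omega); omega
      · rw [← cls_add_self] at e'
        have := eq_of_cls_eq e'.symm (by omega) (by omega); omega
      · have := eq_of_cls_eq e' (by omega) (by omega); omega
    · intro hp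
      rcases ne (n - (n / 2 : ℕ)) (by omega) (by omega) with e | e
      · rw [sub_sub_cancel] at e
        rw [← e, h3 hp]
      · omega

end

section

variable {R : Type} [CommRing R] [Algebra ℂ R] {t₄ : ℂ} {N n m : ℕ} {σ τ : ℤ → ℤ} {y : ℤ}

theorem eq_nested_zero (L : LinkPattern 0) : L = nested 0 := by
  apply Subtype.ext
  funext x
  rw [L.2.empty rfl, (nested 0).2.empty rfl]

theorem phi_zero_single : phi R t₄ 0 (Finsupp.single (nested 0) 1) =
    Finsupp.single (nested 1) 1 := by
  have h : link 1 0 0 (extend 0 (nested 0).1) = (nested 1).1 := by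
    funext x
    have : nestedFun 1 x = x := by simp [nestedFun]
    simp only [nested, this]
    simp [link]
  rw [phi, Finsupp.linearCombination_single, one_smul]
  simp only [crossedArches, List.range_zero, List.reverse_nil, List.filter_nil, List.map_nil,
    resolve, finish, Nat.zero_mod, if_true]
  have h2 : pat R (0 + 1) (link (0 + 1) ((0 : ℕ) : ℤ) ((0 : ℕ) : ℤ) (extend 0 (nested 0).1)) =
      pat R 1 (nested 1).1 := by rw [← h]; rfl
  rw [h2, pat_eq_single (nested 1).2]; rfl

/-- The coefficient of `φₙ(v)` at the fully nested diagram. -/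
theorem phi_apply_nested (ht : t₄ ≠ 0) (hl : loopWeight t₄ ≠ 0) (v : LinkModule R n) :
    phi R t₄ n v (nested (n + 1)) = algebraMap ℂ R (t₄⁻¹ ^ (n / 2)) * v (nested n) := by
  classical
  induction v using Finsupp.induction_linear with
  | zero => simp
  | add f g hf hg => rw [map_add, Finsupp.add_apply, hf, hg, Finsupp.add_apply, mul_add]
  | single L a =>
    rcases Nat.eq_zero_or_pos n with rfl | hn
    · rw [eq_nested_zero L, show (Finsupp.single (nested 0) a : LinkModule R 0) =
        a • Finsupp.single (nested 0) 1 by simp, map_smul, phi_zero_single]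
      simp
    have hL := NC.of_isLinkPattern hn L.2
    have he := ncAt_extend hn hL
    rw [single_eq_smul_pat, map_smul, phi_pat hn L.2, Finsupp.smul_apply, Finsupp.smul_apply]
    by_cases hne : L = nested n
    · subst hne
      have := lineUnder_apply_nested (R := R) ht hl hn (n / 2) (k := 0) (by omega) le_rfl
        (by rwa [sub_zero]) (fun j j0 j1 => ?_) (fun j j0 j1 => by omega) (fun hp => ?_)
      · rw [sub_zero] at this
        rw [this, pat_eq_single (nested n).2]
        have e : (nested n).2.toPattern = nested n := rfl
        rw [e, Finsupp.single_eq_same, smul_eq_mul, smul_eq_mul, mul_one, mul_comm]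
      · have h1 := extend_shiftPoint hn (nested n).1 (n - 1 - j)
        rw [shiftPoint_of_lt (by omega) (by omega)] at h1
        have h2 := nestedFun_of_gt (n := n) (r := n - 1 - j) (k := 0) (by omega) (by omega)
        rw [mul_zero, zero_add, zero_add] at h2
        rw [h1, show (nested n).1 = nestedFun n from rfl, h2, show 2 * (n : ℤ) - 1 - (n - 1 - j) =
            j + n * 1 by ring,
          shiftPoint_add_mul hn, shiftPoint_of_lt j0 (by omega)]
        push_cast; ring
      · have h1 := extend_shiftPoint hn (nested n).1 (n / 2 : ℕ)
        have h2 := nestedFun_of_eq (n := n) (r := (n / 2 : ℕ)) (k := 0) (by omega) (by omega)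
        rw [mul_zero, zero_add] at h2
        rw [shiftPoint_of_lt (by omega) (by omega), show (nested n).1 = nestedFun n from rfl, h2,
          shiftPoint_of_lt (by omega) (by omega)] at h1
        exact h1
    · -- every other diagram has a little arch, which is not affected by the new line
      have : ∃ i : ℤ, 0 ≤ i ∧ i + 1 < n ∧ L.1 i = i + 1 := by
        by_contra hc
        exact hne (Subtype.ext (eq_nestedFun_of_no_peak hn hL fun i i0 i1 e => hc ⟨i, i0, i1, e⟩))
      obtain ⟨i, i0, i1, hi⟩ := this
      have hi' : extend n L.1 i = i + 1 := by
        have := extend_shiftPoint hn L.1 i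
        rwa [hi, shiftPoint_of_lt i0 (by omega), shiftPoint_of_lt (by omega) i1] at this
      rw [lineUnder_apply_of_peak ht hl (by omega) he hi' (nested (n + 1))
        (nestedFun_ne_succ (N := n + 1) i0 (by push_cast; omega)), pat_apply_of_ne (nested n)
          (fun e => hne (Subtype.ext e.symm))]
      simp

/-! ### The area of a diagram -/

/-- The contribution to the area of the arch that opens at a point over the class `c`. -/
def archLength (N : ℕ) (σ : ℤ → ℤ) (c : ZMod N) : ℕ := (σ (c.val : ℤ) - c.val).toNat

/-- The sum of the lengths of the arches of a diagram. -/
def area (N : ℕ) [NeZero N] (σ : ℤ → ℤ) : ℕ := ∑ c : ZMod N, archLength N σ c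

section area

variable [NeZero N]

/-- The length of an arch may be computed at any lift of its opening point. -/
theorem archLength_intCast (hσ : ∀ x, σ (x + N) = σ x + N) (x : ℤ) :
    archLength N σ (x : ZMod N) = (σ x - x).toNat := by
  have : cls N ((x : ZMod N).val : ℤ) = cls N x := by
    show (((x : ZMod N).val : ℤ) : ZMod N) = (x : ZMod N)
    simp
  unfold archLength
  rw [apply_of_cls hσ this]
  congr 1; ring

theorem area_rotate (hσ : ∀ x, σ (x + N) = σ x + N) (k : ℤ) : area N (rotate k σ) = area N σ := by
  unfold area
  refine (Fintype.sum_equiv (Equiv.addRight (k : ZMod N)) _ _ fun c => ?_).symm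
  obtain ⟨x, rfl⟩ := ZMod.intCast_surjective c
  have h1 : Equiv.addRight (k : ZMod N) (x : ZMod N) = ((x + k : ℤ) : ZMod N) := by simp
  rw [h1, archLength_intCast (σ := rotate k σ) (fun z => by
    unfold rotate; rw [show z + (N : ℤ) - k = z - k + N by ring, hσ]; ring), rotate, archLength_intCast hσ]
  congr 1; rw [add_sub_cancel_right]; ring

/-- Two diagrams that differ only in the connections at four points: the difference of their areas
is the difference of the contributions of these points. -/
theorem area_add (hσ : ∀ x, σ (x + N) = σ x + N) (hτ : ∀ x, τ (x + N) = τ x + N) {a b c d : ℤ}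
    (ab : cls N a ≠ cls N b) (ac : cls N a ≠ cls N c)
    (ad : cls N a ≠ cls N d) (bc : cls N b ≠ cls N c) (bd : cls N b ≠ cls N d)
    (cd : cls N c ≠ cls N d) (h : ∀ x, cls N x ≠ cls N a → cls N x ≠ cls N b → cls N x ≠ cls N c →
      cls N x ≠ cls N d → σ x = τ x) :
    area N σ + ((τ a - a).toNat + ((τ b - b).toNat + ((τ c - c).toNat + (τ d - d).toNat))) =
      area N τ + ((σ a - a).toNat + ((σ b - b).toNat + ((σ c - c).toNat + (σ d - d).toNat))) := by
  classical
  let S : Finset (ZMod N) := {(a : ZMod N), (b : ZMod N), (c : ZMod N), (d : ZMod N)}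
  have hS : ∀ (υ : ℤ → ℤ), (∀ x, υ (x + N) = υ x + N) → ∑ c ∈ S, archLength N υ c =
      (υ a - a).toNat + ((υ b - b).toNat + ((υ c - c).toNat + (υ d - d).toNat)) := by
    intro υ hυ
    have e1 : (a : ZMod N) ∉ ({(b : ZMod N), (c : ZMod N), (d : ZMod N)} : Finset (ZMod N)) := by
      simp only [Finset.mem_insert, Finset.mem_singleton, not_or]; exact ⟨ab, ac, ad⟩
    have e2 : (b : ZMod N) ∉ ({(c : ZMod N), (d : ZMod N)} : Finset (ZMod N)) := by
      simp only [Finset.mem_insert, Finset.mem_singleton, not_or]; exact ⟨bc, bd⟩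
    have e3 : (c : ZMod N) ∉ ({(d : ZMod N)} : Finset (ZMod N)) := by
      simp only [Finset.mem_singleton]; exact cd
    rw [Finset.sum_insert e1, Finset.sum_insert e2, Finset.sum_insert e3, Finset.sum_singleton,
      archLength_intCast hυ, archLength_intCast hυ, archLength_intCast hυ, archLength_intCast hυ]
  have hc : ∑ c ∈ Sᶜ, archLength N σ c = ∑ c ∈ Sᶜ, archLength N τ c := by
    refine Finset.sum_congr rfl fun c hc => ?_
    obtain ⟨x, rfl⟩ := ZMod.intCast_surjective c
    simp only [S, Finset.mem_compl, Finset.mem_insert, Finset.mem_singleton, not_or] at hc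
    rw [archLength_intCast hσ, archLength_intCast hτ, h x hc.1 hc.2.1 hc.2.2.1 hc.2.2.2]
  have h1 := Finset.sum_add_sum_compl S (archLength N σ)
  have h2 := Finset.sum_add_sum_compl S (archLength N τ)
  rw [← hS σ hσ, ← hS τ hτ, area, area]
  omega

end area

/-- Every arch has length at most `N`. -/
theorem NC.area_le [NeZero N] {M : Cls N → Prop} (h : NC N M σ) : area N σ ≤ N * N := by
  have hN := Nat.pos_of_ne_zero (NeZero.ne N)
  unfold area
  refine (Finset.sum_le_card_nsmul _ _ N fun c _ => ?_).trans (by simp [ZMod.card])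
  have := h.lt_add hN (c.val : ℤ)
  unfold archLength; omega

end

/-! ### Diagrams and their images under a Temperley-Lieb generator -/

section

variable {R : Type} [CommRing R] [Algebra ℂ R] {t₄ : ℂ} {N n m : ℕ} {σ τ : ℤ → ℤ} {y : ℤ}

/-- `i` and `i + 1` are the inner ends of two neighbouring arches `(p, i)` and `(i + 1, q)` that are
not the same arch of the disc. -/
structure Valley (N : ℕ) (σ : ℤ → ℤ) (p i q : ℤ) : Prop where
  left : σ i = p
  right : σ (i + 1) = q
  lt_left : p < i
  lt_right : i + 1 < q
  lt : q < p + N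

/-- The image of a diagram under the generator that joins the inner ends of two neighbouring
arches. -/
def flip (N : ℕ) (p i q : ℤ) (σ : ℤ → ℤ) : ℤ → ℤ := link N i (i + 1) (link N p q σ)

namespace Valley

variable {p i q : ℤ}

theorem cls_ne (hv : Valley N σ p i q) (a b : ℤ) (h1 : p ≤ a) (h2 : a < b) (h3 : b ≤ q)
    : cls N a ≠ cls N b := fun e => by
  have := add_le_of_cls_eq e h2
  have := hv.lt
  omega

theorem flip_nc (hv : Valley N σ p i q) (h : NC N (fun _ => False) σ)
    (hN : 0 < N) :
    NC N (fun _ => False) (flip N p i q σ) := by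
  obtain ⟨h1, h2, h3, h4, h5⟩ := id hv
  exact h.reconnect_arcs hN h1 h2 id id (by omega) (by omega)
    (hv.cls_ne p (i + 1) le_rfl (by omega) (by omega))
    (hv.cls_ne i (i + 1) (by omega) (by omega) (by omega))

theorem flip_left : flip N p i q σ i = i + 1 := by
  rw [flip, link_apply, if_pos rfl]; ring

theorem flip_right (hv : Valley N σ p i q) : flip N p i q σ (i + 1) = i := by
  obtain ⟨h1, h2, h3, h4, h5⟩ := id hv
  rw [flip, link_apply, if_neg (hv.cls_ne i (i + 1) (by omega) (by omega) (by omega)).symm,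
    if_pos rfl]; ring

theorem flip_out (hv : Valley N σ p i q) : flip N p i q σ p = q := by
  obtain ⟨h1, h2, h3, h4, h5⟩ := id hv
  rw [flip, link_apply, if_neg (hv.cls_ne p i (by omega) (by omega) (by omega)),
    if_neg (hv.cls_ne p (i + 1) (by omega) (by omega) (by omega)), link_apply, if_pos rfl]; ring

theorem flip_out' (hv : Valley N σ p i q) : flip N p i q σ q = p := by
  obtain ⟨h1, h2, h3, h4, h5⟩ := id hv
  rw [flip, link_apply, if_neg (hv.cls_ne i q (by omega) (by omega) (by omega)).symm,
    if_neg (hv.cls_ne (i + 1) q (by omega) (by omega) (by omega)).symm, link_apply,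
    if_neg (hv.cls_ne p q (by omega) (by omega) (by omega)).symm, if_pos rfl]; ring

theorem flip_other {x : ℤ} (h1 : cls N x ≠ cls N p) (h2 : cls N x ≠ cls N i)
    (h3 : cls N x ≠ cls N (i + 1)) (h4 : cls N x ≠ cls N q) : flip N p i q σ x = σ x := by
  rw [flip, link_apply, if_neg h2, if_neg h3, link_apply, if_neg h1, if_neg h4]

/-- The flip replaces the arches `(p, i)` and `(i + 1, q)` by the arches `(i, i + 1)` and `(p, q)`,
the second of which is longer than both of them together. -/
theorem area_flip [NeZero N] (hv : Valley N σ p i q) (h : NC N (fun _ => False) σ) :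
    area N σ < area N (flip N p i q σ) := by
  obtain ⟨h1, h2, h3, h4, h5⟩ := id hv
  have hp : σ p = i := by rw [← h1, h.invol]
  have hq : σ q = i + 1 := by rw [← h2, h.invol]
  have := area_add h.per (hv.flip_nc h (Nat.pos_of_ne_zero (NeZero.ne N))).per
    (hv.cls_ne p i (by omega) (by omega) (by omega))
    (hv.cls_ne p (i + 1) (by omega) (by omega) (by omega))
    (hv.cls_ne p q (by omega) (by omega) (by omega))
    (hv.cls_ne i (i + 1) (by omega) (by omega) (by omega))
    (hv.cls_ne i q (by omega) (by omega) (by omega))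
    (hv.cls_ne (i + 1) q (by omega) (by omega) (by omega))
    (fun x x1 x2 x3 x4 => (flip_other (σ := σ) x1 x2 x3 x4).symm)
  rw [flip_left, hv.flip_right, hv.flip_out, hv.flip_out', h1, h2, hp, hq] at this
  omega

theorem eAt_pat (hv : Valley N σ p i q) :
    eAt t₄ N (pat R N) i σ = pat R N (flip N p i q σ) := by
  obtain ⟨h1, h2, h3, h4, h5⟩ := id hv
  exact eAt_arcs h1 h2 (by omega) (by omega) (hv.cls_ne p (i + 1) (by omega) (by omega) (by omega))

/-- A diagram whose image under the generator contains the image of `σ` is that image, or `σ`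
itself, or has a larger area than the image. -/
theorem preimage [NeZero N] (hv : Valley N σ p i q) (h : NC N (fun _ => False) σ)
    (hN : 2 ≤ N) (K L : LinkPattern N)
    (hL : L.1 = flip N p i q σ) (hK : eAt t₄ N (pat R N) i K.1 L ≠ 0) :
    K = L ∨ K.1 = σ ∨ area N L.1 < area N K.1 := by
  have hN0 : 0 < N := by omega
  obtain ⟨v1, v2, v3, v4, v5⟩ := id hv
  have hk := NC.of_isLinkPattern hN0 K.2
  have hl := NC.of_isLinkPattern hN0 L.2
  have h4 := cls_ne_succ hN i
  have l1 : L.1 i = i + 1 := hL ▸ flip_left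
  have l2 : L.1 (i + 1) = i := hL ▸ hv.flip_right
  have l3 : L.1 p = q := hL ▸ hv.flip_out
  have l4 : L.1 q = p := hL ▸ hv.flip_out'
  have ne := hv.cls_ne
  have pi := ne p i le_rfl v3 (by omega)
  have pj := ne p (i + 1) le_rfl (by omega) (by omega)
  have eqL : ∀ τ, pat R N τ L ≠ 0 → L.1 = τ := fun τ hτ => by
    by_contra hne; exact hτ (pat_apply_of_ne L hne)
  rcases hk.cases_succ hN0 id id h4 with c | c | ⟨c1, c2, c3⟩ | ⟨c1, c2⟩ | ⟨c1, c2⟩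
  · rw [eAt_peak c, Finsupp.smul_apply] at hK
    exact Or.inl (Subtype.ext (eqL _ (right_ne_zero_of_smul hK)).symm)
  · exfalso
    rw [eAt_wrap hN c, Finsupp.smul_apply] at hK
    have e := eqL _ (right_ne_zero_of_smul hK)
    have k1 : K.1 p = q := by rw [← l3, e, link_apply, if_neg pi, if_neg pj]
    have k2 : K.1 (i + 1) = i + N := by
      have := hk.per (K.1 i); rw [hk.invol, c] at this
      rwa [sub_add_cancel] at this
    have := hk.nc (i + 1) (p + N) (by omega) (by omega) id
    rw [hk.per, k1] at this
    omega
  · obtain ⟨p', hp⟩ : ∃ p', K.1 i = p' := ⟨_, rfl⟩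
    obtain ⟨q', hq⟩ : ∃ q', K.1 (i + 1) = q' := ⟨_, rfl⟩
    rw [hp] at c1 c3
    rw [hq] at c2
    rw [eAt_arcs hp hq c1 c2 c3] at hK
    have e := eqL _ hK
    have hp' : K.1 p' = i := by rw [← hp, hk.invol]
    have hq' : K.1 q' = i + 1 := by rw [← hq, hk.invol]
    have p1 : cls N p' ≠ cls N i := hp ▸ hk.partner_ne hN0 (by omega)
    have q1 : cls N q' ≠ cls N (i + 1) := hq ▸ hk.partner_ne hN0 (by omega)
    have q2 : cls N q' ≠ cls N i := fun e' => c3 (by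
      have := cls_apply hk.per e'; rw [hp, hq'] at this; exact this.symm)
    have pq : cls N p' ≠ cls N q' := by rw [← hp, ← hq]; exact hk.cls_ne h4
    have m1 : L.1 p' = q' := by
      rw [e, link_apply, if_neg p1, if_neg c3, link_apply, if_pos rfl]; ring
    have m2 : L.1 q' = p' := by
      rw [e, link_apply, if_neg q2, if_neg q1, link_apply, if_neg pq.symm, if_pos rfl]; ring
    have off : ∀ x, cls N x ≠ cls N p' → cls N x ≠ cls N i → cls N x ≠ cls N (i + 1) →
        cls N x ≠ cls N q' → K.1 x = L.1 x := fun x x1 x2 x3 x4 => by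
      rw [e, link_apply, if_neg x2, if_neg x3, link_apply, if_neg x1, if_neg x4]
    have ar := area_add hk.per hl.per p1 c3 pq h4 q2.symm q1.symm off
    rw [m1, m2, l1, l2, hp, hq, hp', hq'] at ar
    rcases hk.shape hN0 hp hq id id c1 c2 c3 with ⟨s1, s2, s3⟩ | ⟨s1, s2⟩ | ⟨s1, s2⟩
    · refine Or.inr (Or.inl ?_)
      have epp : p' = p := by
        rcases lt_trichotomy p' p with l | l | l
        · exfalso
          have ne' : ∀ a b : ℤ, p' ≤ a → a < b → b ≤ q' → cls N a ≠ cls N b :=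
            fun a b h1 h2 h3 e => by
              have := add_le_of_cls_eq e h2; omega
          have k1 := off p (ne' p' p le_rfl l (by omega)).symm pi pj (ne' p q' (by omega) (by omega)
            le_rfl)
          have := hk.nc p' p l (by omega) id
          omega
        · exact l
        · exfalso
          have := h.nc' (x := i) (w := p') (by omega) (by omega) id
          rw [hL, flip_other (ne p p' le_rfl l (by omega)).symm p1 c3
            (ne p' q (by omega) (by omega) le_rfl)] at m1
          omega
      subst epp
      have eqq : q' = q := by rw [← m1, l3]
      subst eqq
      have hσp : σ p' = i := by rw [← v1, h.invol]
      have hσq : σ q' = i + 1 := by rw [← v2, h.invol]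
      funext x
      by_cases x1 : cls N x = cls N p'
      · rw [apply_of_cls hk.per x1, apply_of_cls h.per x1, hp', hσp]
      by_cases x2 : cls N x = cls N i
      · rw [apply_of_cls hk.per x2, apply_of_cls h.per x2, hp, v1]
      by_cases x3 : cls N x = cls N (i + 1)
      · rw [apply_of_cls hk.per x3, apply_of_cls h.per x3, hq, v2]
      by_cases x4 : cls N x = cls N q'
      · rw [apply_of_cls hk.per x4, apply_of_cls h.per x4, hq', hσq]
      rw [off x x1 x2 x3 x4, hL, flip_other x1 x2 x3 x4]
    · exact Or.inr (Or.inr (by omega))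
    · exact Or.inr (Or.inr (by omega))
  · exfalso
    obtain ⟨q', hq⟩ : ∃ q', K.1 (i + 1) = q' := ⟨_, rfl⟩
    have a1 : cls N q' ≠ cls N i := hq ▸ hk.ne_of_fix c1 h4.symm
    have a2 : cls N q' ≠ cls N (i + 1) := hq ▸ hk.partner_ne hN0 c2
    rw [eAt_left h4 c1 hq a1 a2] at hK
    have e := eqL _ hK
    have pq : cls N p ≠ cls N q' := fun e' => by
      have := apply_of_cls hl.per e'
      rw [l3, e, link3_end rfl] at this; omega
    have k1 : K.1 p = q := by rw [← l3, e, link3_other pi pj pq]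
    exact (hk.nc p i v3 (by omega) id).2.2 c1
  · exfalso
    obtain ⟨p', hp⟩ : ∃ p', K.1 i = p' := ⟨_, rfl⟩
    have a1 : cls N p' ≠ cls N (i + 1) := hp ▸ hk.ne_of_fix c2 h4
    have a2 : cls N p' ≠ cls N i := hp ▸ hk.partner_ne hN0 c1
    rw [eAt_right hp c2 a2 a1] at hK
    have e := eqL _ hK
    have pq : cls N p ≠ cls N p' := fun e' => by
      have := apply_of_cls hl.per e'
      rw [l3, e, link3_end rfl] at this; omega
    have k1 : K.1 p = q := by rw [← l3, e, link3_other pi pj pq]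
    exact (hk.nc p (i + 1) (by omega) (by omega) id).2.2 c2

end Valley

/-- Between two little arches, if there is no defect line, there are two neighbouring points that
are the inner ends of arches. -/
theorem exists_close_open {σ : ℤ → ℤ} {j : ℤ} (hj : σ (j + 1) < j + 1) (k : ℕ)
    (hk : j + 1 + k < σ (j + 1 + k)) (hd : ∀ x, j < x → x ≤ j + 1 + k → σ x ≠ x) :
    ∃ i, j < i ∧ i < j + 1 + k ∧ σ i < i ∧ i + 1 < σ (i + 1) := by
  induction k with
  | zero => simp at hk; omega
  | succ k ih =>
    rcases lt_trichotomy (σ (j + 1 + k)) (j + 1 + k) with e | e | e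
    · refine ⟨j + 1 + k, by omega, by push_cast; omega, e, ?_⟩
      push_cast at hk
      rwa [show j + 1 + (k : ℤ) + 1 = j + 1 + (k + 1) by ring]
    · exact absurd e (hd _ (by omega) (by push_cast; omega))
    · obtain ⟨i, i1, i2, i3⟩ := ih e fun x x1 x2 => hd x x1 (by push_cast; omega)
      exact ⟨i, i1, by push_cast; omega, i3⟩

/-- Between two little arches there are neighbouring inner ends of arches, in any of the two boundary
segments that the defect line does not end in.  If these belong to the same arch of the disc, then
the other boundary segment provides a valley. -/
theorem exists_valley (h : NC N (fun _ => False) σ) (hN : 0 < N) {j k : ℤ} (hj : σ j = j + 1)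
    (hk : σ k = k + 1) (h1 : j < k) (h2 : k < j + N) : ∃ p i q, Valley N σ p i q := by
  have hj' : σ (j + 1) = j := by rw [← hj, h.invol]
  have hk' : σ (k + 1) = k := by rw [← hk, h.invol]
  have hjk : k ≠ j + 1 := fun e => by rw [← e, hk] at hj'; omega
  have hjN : σ (j + N) = j + N + 1 := by rw [h.per, hj]; ring
  have hkj : j + N ≠ k + 1 := fun e => by rw [← e, hjN] at hk'; omega
  -- two neighbouring inner ends of the same arch of the disc leave no room for anything else
  have mk : ∀ i, σ i < i → i + 1 < σ (i + 1) → σ (i + 1) ≠ i + N →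
      ∃ p i q, Valley N σ p i q := fun i i1 i2 i3 => by
    have hc : cls N (σ i) ≠ cls N (i + 1) := fun e => i3 (by
      obtain ⟨l, hl⟩ := cls_eq_iff_exists.1 e
      have h1 := h.sub_lt hN i
      have h2 : l = -1 := by
        have : -2 < l := by by_contra hlt; nlinarith
        have : l < 0 := by by_contra hlt; nlinarith
        omega
      subst h2
      have h3 := h.per (σ i)
      rw [h.invol, hl] at h3
      rw [← h3]; congr 1; ring)
    rcases h.shape hN rfl rfl id id i1.ne i2.ne' hc with s | s | s
    · exact ⟨σ i, i, σ (i + 1), rfl, rfl, i1, i2, by omega⟩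
    · omega
    · omega
  have seg1 := exists_close_open (σ := σ) (j := j) (by omega) (k - (j + 1)).toNat (by
    rw [show j + 1 + ((k - (j + 1)).toNat : ℤ) = k by omega]; omega)
  have seg2 := exists_close_open (σ := σ) (j := k) (by omega) (j + N - (k + 1)).toNat (by
    rw [show k + 1 + ((j + N - (k + 1)).toNat : ℤ) = j + N by omega]; omega)
  rw [show j + 1 + ((k - (j + 1)).toNat : ℤ) = k by omega] at seg1
  rw [show k + 1 + ((j + N - (k + 1)).toNat : ℤ) = j + N by omega] at seg2
  by_cases d1 : ∃ x, j < x ∧ x ≤ k ∧ σ x = x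
  · obtain ⟨x, x1, x2, x3⟩ := d1
    have xk : x ≠ k := fun e => by rw [e] at x3; omega
    obtain ⟨i, i1, i2, i3, i4⟩ := seg2 fun z z1 z2 e => by
      have := h.uniq x z x3 e id id
      have := eq_of_cls_eq this (by omega) (by omega)
      omega
    refine mk i i3 i4 fun e => ?_
    have := h.nc (i + 1) (x + N) (by omega) (by omega) id
    rw [h.per, x3] at this
    exact this.2.2 rfl
  obtain ⟨i, i1, i2, i3, i4⟩ := seg1 fun z z1 z2 e => d1 ⟨z, z1, z2, e⟩
  by_cases e : σ (i + 1) = i + N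
  · obtain ⟨i', k1, k2, k3, k4⟩ := seg2 fun z z1 z2 e' => by
      exact (h.nc (i + 1) z (by omega) (by omega) id).2.2 e'
    refine mk i' k3 k4 fun e' => ?_
    have := h.nc (i + 1) (i' + 1) (by omega) (by omega) id
    omega
  · exact mk i i3 i4 e

/-- A diagram without a valley is a rotation of the fully nested diagram. -/
theorem exists_valley_or_rotate (h : NC N (fun _ => False) σ) (hN : 2 ≤ N) :
    (∃ p i q, Valley N σ p i q) ∨ ∃ k : ℕ, k < N ∧ σ = rotate k (nestedFun N) := by
  have hN0 : 0 < N := by omega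
  by_cases hv : ∃ p i q, Valley N σ p i q
  · exact Or.inl hv
  refine Or.inr ?_
  have ha : ∃ a, a < σ a := by
    by_contra hc
    have hf : ∀ x, σ x = x := fun x => by
      have h1 : ¬ x < σ x := fun e => hc ⟨x, e⟩
      have h2 : ¬ σ x < σ (σ x) := fun e => hc ⟨σ x, e⟩
      rw [h.invol] at h2; omega
    exact cls_ne_succ hN 0 (h.uniq 0 (0 + 1) (hf _) (hf _) id id)
  obtain ⟨a, ha⟩ := ha
  obtain ⟨i, -, -, hi⟩ := h.exists_peak ha
  obtain ⟨k, k1, k2, k3⟩ := exists_lift hN0 (i + 1) 0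
  obtain ⟨l, hl⟩ := cls_eq_iff_exists.1 k1
  lift k to ℕ using k2
  refine ⟨k, by omega, ?_⟩
  have hn := h.rotate (M' := fun _ => False) (-k) fun _ => Iff.rfl
  have hk : σ (k - 1) = k := by
    have : cls N ((k : ℤ) - 1) = cls N i := cls_pred k1
    rw [apply_of_cls h.per this, hi]; ring
  have key := eq_nestedFun_of_no_peak hN0 hn fun x x0 x1 e => by
    unfold rotate at e
    refine hv (exists_valley h hN0 (j := k - 1) (k := x + k) (by rw [hk]; ring) ?_ (by omega)
      (by omega))
    rw [sub_neg_eq_add] at e; omega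
  funext x
  rw [← key]
  simp [rotate]

end

/-! ### Spreading of vanishing components -/

section

variable {R : Type} [CommRing R] {t₄ : ℂ} {N n m : ℕ} {σ τ : ℤ → ℤ} {y : ℤ}

theorem rot_injective : Function.Injective rot := fun σ τ h => by
  funext x
  have := congrFun h (x + 1)
  rw [rot_apply_add, rot_apply_add] at this
  omega

/-- The components of the rotated vector. -/
theorem rhoOp_apply (v : LinkModule R N) {L L' : LinkPattern N}
    (h : L'.1 = rot L.1) : rhoOp R N v L' = v L := by
  classical
  induction v using Finsupp.induction_linear with
  | zero => simp
  | add f g hf hg => rw [map_add, Finsupp.add_apply, hf, hg, Finsupp.add_apply]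
  | single K a =>
    rw [single_eq_smul_pat, map_smul, rhoOp_pat K.2, Finsupp.smul_apply, Finsupp.smul_apply]
    congr 1
    by_cases hK : K = L
    · subst hK
      rw [← h, pat_eq_single L'.2, pat_eq_single K.2]
      have e1 : L'.2.toPattern = L' := rfl
      have e2 : K.2.toPattern = K := rfl
      rw [e1, e2, Finsupp.single_eq_same, Finsupp.single_eq_same]
    · rw [pat_apply_of_ne L fun e => hK (Subtype.ext e.symm), pat_apply_of_ne]
      exact fun e => hK (Subtype.ext (rot_injective (by rw [← e, h])))

variable [Algebra ℂ R]

theorem eOp_apply (v : LinkModule R N) (i : ℤ) (L : LinkPattern N) :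
    eOp R t₄ N i v L = v.sum fun K a => a * eAt t₄ N (pat R N) i K.1 L := by
  rw [eOp, Finsupp.linearCombination_apply]
  unfold Finsupp.sum
  exact Finsupp.finsetSum_apply _ _ _

/-- Vanishing of the components of a vector spreads from the fully nested diagram to all diagrams,
if it spreads along rotations and through the valleys of diagrams. -/
theorem eq_zero_of_nested_eq_zero (hn : 0 < n) (D : LinkModule R (n + 1))
    (hA : ∀ i : ℤ, 0 ≤ i → i + 1 < n → ∀ L, D L = 0 → eOp R t₄ (n + 1) i D L = 0)
    (hB : ∀ L L' : LinkPattern (n + 1), L'.1 = rot L.1 → D L = 0 → D L' = 0 →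
      eOp R t₄ (n + 1) (n - 1) D L = 0)
    (hρ : ∀ L L' : LinkPattern (n + 1), L'.1 = rot L.1 → L.1 (n - 1) ≠ n → D L = 0 → D L' = 0)
    (h0 : D (nested (n + 1)) = 0) : D = 0 := by
  have hN : 2 ≤ n + 1 := by omega
  have hN0 : 0 < n + 1 := by omega
  -- rotations of the fully nested diagram
  have hrot : ∀ k : ℕ, k < n + 1 → ∀ T : LinkPattern (n + 1),
      T.1 = rotate k (nestedFun (n + 1)) → D T = 0 := by
    intro k
    induction k with
    | zero =>
      intro _ T hT
      have : T = nested (n + 1) := Subtype.ext (by rw [hT]; funext x; simp [rotate, nested])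
      rw [this, h0]
    | succ k ih =>
      intro hk T hT
      have hL : IsLinkPattern (n + 1) (rotate k (nestedFun (n + 1))) :=
        ((NC.of_isLinkPattern hN0 (nested (n + 1)).2).rotate k fun _ => Iff.rfl).isLinkPattern hN0
      refine hρ hL.toPattern T ?_ ?_ (ih (by omega) _ rfl)
      · rw [hT]; funext x
        simp only [IsLinkPattern.toPattern, rotate, rot]; push_cast
        rw [show x - (k + 1 : ℤ) = x - 1 - k by ring]; ring
      · simp only [IsLinkPattern.toPattern, rotate]
        have := nestedFun_ne_succ (N := n + 1) (i := n - 1 - k) (by omega) (by push_cast; omega)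
        omega
  -- a diagram with a valley between the points `0, …, n`
  have step : ∀ (T : LinkPattern (n + 1)) (p i q : ℤ), Valley (n + 1) T.1 p i q → 0 ≤ i → i < n →
      (∀ K : LinkPattern (n + 1), area (n + 1) T.1 < area (n + 1) K.1 → D K = 0) → D T = 0 := by
    intro T p i q hv i0 i1 ih
    have hT := NC.of_isLinkPattern hN0 T.2
    have hL := (hv.flip_nc hT hN0).isLinkPattern hN0
    have ha := hv.area_flip hT
    obtain ⟨L, rfl⟩ : ∃ L, L = hL.toPattern := ⟨_, rfl⟩
    have hDL : D hL.toPattern = 0 := ih _ ha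
    have he : eOp R t₄ (n + 1) i D hL.toPattern = 0 := by
      rcases lt_or_ge (i + 1) (n : ℤ) with h | h
      · exact hA i i0 h _ hDL
      · obtain rfl : i = n - 1 := by omega
        have hr := hL.rot hN0
        refine hB hL.toPattern hr.toPattern rfl hDL (ih _ ?_)
        have := area_rotate (NC.of_isLinkPattern hN0 hL).per 1
        have e : area (n + 1) (hr.toPattern).1 =
            area (n + 1) (rotate 1 (flip (n + 1) p (n - 1) q T.1))
          := rfl
        rw [e, this]; exact ha
    -- only the component of `D` at `T` contributes to the component of its image at the flip of `T`
    rw [eOp_apply, Finsupp.sum, Finset.sum_eq_single T] at he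
    · rw [hv.eAt_pat, pat_eq_single hL, Finsupp.single_eq_same, mul_one] at he
      exact he
    · intro K _ hK
      by_contra hne
      rcases hv.preimage hT hN K hL.toPattern rfl (right_ne_zero_of_mul hne) with e | e | e
      · exact left_ne_zero_of_mul hne (by rw [e, hDL])
      · exact hK (Subtype.ext e)
      · exact left_ne_zero_of_mul hne (ih K (ha.trans e))
    · intro h
      rw [Finsupp.notMem_support_iff.1 h, zero_mul]
  have main : ∀ (k : ℕ) (T : LinkPattern (n + 1)), (n + 1) * (n + 1) - area (n + 1) T.1 = k →
      D T = 0 := by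
    intro k
    induction k using Nat.strong_induction_on with
    | _ k ih =>
      intro T hk
      have hT := NC.of_isLinkPattern hN0 T.2
      have ih' : ∀ K : LinkPattern (n + 1), area (n + 1) T.1 < area (n + 1) K.1 → D K = 0 :=
        fun K hK => by
          have := (NC.of_isLinkPattern hN0 K.2).area_le
          exact ih _ (by omega) K rfl
      rcases exists_valley_or_rotate hT hN with ⟨p, i, q, hv⟩ | ⟨k, k1, k2⟩
      · obtain ⟨j, j1, j2, j3⟩ := exists_lift hN0 i 0
        have hv' : Valley (n + 1) T.1 (p + (j - i)) j (q + (j - i)) := by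
          obtain ⟨v1, v2, v3, v4, v5⟩ := hv
          refine ⟨by rw [apply_of_cls hT.per j1, v1], ?_, by omega, by omega, by omega⟩
          rw [apply_of_cls hT.per (cls_add 1 j1), v2]; ring
        rcases lt_or_ge j n with h | h
        · exact step T _ j _ hv' j2 h ih'
        · -- the valley is moved to the points `n - 1`, `n` by a rotation
          obtain rfl : j = n := by push_cast at j3; omega
          have hS : IsLinkPattern (n + 1) (rotate (-1) T.1) :=
            (hT.rotate (-1) fun _ => Iff.rfl).isLinkPattern hN0
          obtain ⟨v1, v2, v3, v4, v5⟩ := hv'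
          have hS' : Valley (n + 1) (rotate (-1) T.1) (p + (n - i) - 1) (n - 1) (q + (n - i) - 1) :=
            ⟨by rw [rotate, sub_neg_eq_add, sub_add_cancel, v1]; ring,
              by rw [rotate, sub_neg_eq_add, sub_add_cancel, v2]; ring,
              by omega, by omega, by omega⟩
          refine hρ hS.toPattern T ?_ ?_ (step hS.toPattern _ _ _ hS' (by omega) (by omega) ?_)
          · funext x; simp [IsLinkPattern.toPattern, rotate, rot]
          · have := hS'.left
            have := hS'.lt_left
            simp only [IsLinkPattern.toPattern]
            omega
          · intro K hK
            refine ih' K ?_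
            have e : area (n + 1) hS.toPattern.1 = area (n + 1) (rotate (-1) T.1) := rfl
            rwa [e, area_rotate hT.per] at hK
      · exact hrot k k1 T k2
  exact Finsupp.ext fun T => main _ T rfl

end

/-! ### Extension of scalars -/

section mapCoeff

variable {R S T : Type} [CommRing R] [CommRing S] [CommRing T] {n : ℕ} {t₄ : ℂ} (F : R →+* S)

theorem mapCoeff_apply (f : LinkModule R n) (L : LinkPattern n) : mapCoeff F f L = F (f L) :=
  Finsupp.mapRange_apply (hf := map_zero F)

theorem mapCoeff_add (f g : LinkModule R n) : mapCoeff F (f + g) = mapCoeff F f + mapCoeff F g := by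
  ext L; simp [mapCoeff_apply]

theorem mapCoeff_zero : mapCoeff F (0 : LinkModule R n) = 0 := by
  ext L; simp [mapCoeff_apply]

theorem mapCoeff_smul (a : R) (f : LinkModule R n) : mapCoeff F (a • f) = F a • mapCoeff F f := by
  ext L; simp [mapCoeff_apply]

theorem mapCoeff_pat (σ : ℤ → ℤ) : mapCoeff F (pat R n σ) = pat S n σ := by
  unfold pat
  split_ifs
  · exact (Finsupp.mapRange_single (hf := map_zero F)).trans (by rw [map_one])
  · exact mapCoeff_zero F

theorem mapCoeff_rhoOp (f : LinkModule R n) :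
    mapCoeff F (rhoOp R n f) = rhoOp S n (mapCoeff F f) := by
  induction f using Finsupp.induction_linear with
  | zero => simp [mapCoeff_zero]
  | add f g hf hg => simp only [map_add, mapCoeff_add, hf, hg]
  | single L a =>
    rw [single_eq_smul_pat, map_smul, mapCoeff_smul, mapCoeff_smul, map_smul, mapCoeff_pat,
      rhoOp_pat L.2, rhoOp_pat L.2, mapCoeff_pat]

theorem mapCoeff_sum {ι : Type} (s : Finset ι) (f : ι → LinkModule R n) :
    mapCoeff F (∑ i ∈ s, f i) = ∑ i ∈ s, mapCoeff F (f i) := by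
  classical
  induction s using Finset.induction_on with
  | empty => simp [mapCoeff_zero]
  | insert a s ha ih => rw [Finset.sum_insert ha, Finset.sum_insert ha, mapCoeff_add, ih]

variable [Algebra ℂ R] [Algebra ℂ S] {F}

theorem mapCoeff_complex_smul (hF : ∀ c : ℂ, F (algebraMap ℂ R c) = algebraMap ℂ S c) (a : ℂ)
    (f : LinkModule R n) : mapCoeff F (a • f) = a • mapCoeff F f := by
  ext L; simp [mapCoeff_apply, Algebra.smul_def, hF]

theorem mapCoeff_eOp (hF : ∀ c : ℂ, F (algebraMap ℂ R c) = algebraMap ℂ S c) (i : ℤ)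
    (f : LinkModule R n) : mapCoeff F (eOp R t₄ n i f) = eOp S t₄ n i (mapCoeff F f) := by
  induction f using Finsupp.induction_linear with
  | zero => simp [mapCoeff_zero]
  | add f g hf hg => simp only [map_add, mapCoeff_add, hf, hg]
  | single L a =>
    rw [single_eq_smul_pat, map_smul, mapCoeff_smul, mapCoeff_smul, map_smul, mapCoeff_pat,
      eOp_pat L.2, eOp_pat L.2]
    congr 1
    unfold eAt
    split_ifs <;> simp only [mapCoeff_complex_smul hF, mapCoeff_pat]

theorem mapCoeff_resolve (hF : ∀ c : ℂ, F (algebraMap ℂ R c) = algebraMap ℂ S c)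
    {fin : (ℤ → ℤ) → ℤ → LinkModule R n} {fin' : (ℤ → ℤ) → ℤ → LinkModule S n}
    (hfin : ∀ τ x, mapCoeff F (fin τ x) = fin' τ x) (l : List (ℤ × ℤ)) (τ : ℤ → ℤ) (x : ℤ) :
    mapCoeff F (resolve R t₄ n fin l τ x) = resolve S t₄ n fin' l τ x := by
  induction l generalizing τ x with
  | nil => exact hfin τ x
  | cons a l ih =>
    obtain ⟨o, c⟩ := a
    rw [resolve, resolve, mapCoeff_add, mapCoeff_complex_smul hF, mapCoeff_complex_smul hF, ih, ih]

theorem mapCoeff_phi (hF : ∀ c : ℂ, F (algebraMap ℂ R c) = algebraMap ℂ S c)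
    (f : LinkModule R n) : mapCoeff F (phi R t₄ n f) = phi S t₄ n (mapCoeff F f) := by
  induction f using Finsupp.induction_linear with
  | zero => simp [mapCoeff_zero]
  | add f g hf hg => simp only [map_add, mapCoeff_add, hf, hg]
  | single L a =>
    have e : mapCoeff F (Finsupp.single L a : LinkModule R n) = Finsupp.single L (F a) := by
      simp [mapCoeff]
    rw [e, phi, Finsupp.linearCombination_single, phi, Finsupp.linearCombination_single,
      mapCoeff_smul, mapCoeff_resolve hF]
    intro τ x
    unfold finish
    split_ifs
    · exact mapCoeff_pat F _
    · rw [mapCoeff_sum]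
      simp only [mapCoeff_add, mapCoeff_complex_smul hF, mapCoeff_pat]

end mapCoeff

/-! ### Substitutions in polynomials -/

section substitutions

variable {m : ℕ} {q : ℂ}

theorem swapVars_algebraMap (i : Fin m) (c : ℂ) : swapVars i (algebraMap ℂ _ c) =
    algebraMap ℂ _ c :=
  AlgHom.commutes _ c

theorem rhoVars_algebraMap (c : ℂ) : rhoVars q m (algebraMap ℂ _ c) = algebraMap ℂ _ c :=
  AlgHom.commutes _ c

theorem lastZero_algebraMap (c : ℂ) : lastZero m (algebraMap ℂ _ c) = algebraMap ℂ _ c :=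
  AlgHom.commutes _ c

@[simp] theorem swapVars_C (i : Fin m) (c : ℂ) : swapVars i (C c) = C c := swapVars_algebraMap i c

@[simp] theorem rhoVars_C (c : ℂ) : rhoVars q m (C c) = C c := rhoVars_algebraMap c

@[simp] theorem lastZero_C (c : ℂ) : lastZero m (C c) = C c := lastZero_algebraMap c

theorem swapVars_X (i : Fin m) (j : Fin (m + 1)) :
    swapVars i (X j) = X (Equiv.swap i.castSucc i.succ j) := by
  simp [swapVars]

@[simp] theorem swapVars_X_castSucc (i : Fin m) : swapVars i (X i.castSucc) = X i.succ := by
  rw [swapVars_X, Equiv.swap_apply_left]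

@[simp] theorem swapVars_X_succ (i : Fin m) : swapVars i (X i.succ) = X i.castSucc := by
  rw [swapVars_X, Equiv.swap_apply_right]

@[simp] theorem rhoVars_X_castSucc (j : Fin m) : rhoVars q m (X j.castSucc) = X j.succ := by
  simp [rhoVars]

@[simp] theorem rhoVars_X_last : rhoVars q m (X (Fin.last m)) = C q⁻¹ * X 0 := by
  simp [rhoVars]

@[simp] theorem lastZero_X_castSucc (j : Fin m) : lastZero m (X j.castSucc) = X j := by
  simp [lastZero]

@[simp] theorem lastZero_X_last : lastZero m (X (Fin.last m)) = 0 := by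
  simp [lastZero]

theorem swapVars_swapVars (i : Fin m) (p : MvPolynomial (Fin (m + 1)) ℂ) :
    swapVars i (swapVars i p) = p := by
  have : (swapVars i).comp (swapVars i) = RingHom.id _ := by
    refine MvPolynomial.ringHom_ext (fun c => by simp) fun j => ?_
    simp [swapVars_X]
  exact congrArg (fun φ => φ p) this

theorem swapVars_injective (i : Fin m) : Function.Injective (swapVars i) :=
  Function.LeftInverse.injective (g := swapVars i) (swapVars_swapVars i)

/-- The substitution is invertible, as `q ≠ 0`. -/
theorem rhoVars_injective (hq : q ≠ 0) : Function.Injective (rhoVars q m) := by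
  let ψ : MvPolynomial (Fin (m + 1)) ℂ →+* MvPolynomial (Fin (m + 1)) ℂ :=
    (aeval (Fin.cons (α := fun _ => MvPolynomial (Fin (m + 1)) ℂ) (C q * X (Fin.last m))
      (fun j : Fin m => X j.castSucc))).toRingHom
  have hψ : ψ.comp (rhoVars q m) = RingHom.id _ := by
    refine MvPolynomial.ringHom_ext (fun c => by simp [ψ]) fun j => ?_
    refine Fin.lastCases ?_ (fun j => ?_) j
    · simp only [RingHom.comp_apply, rhoVars_X_last, map_mul]
      simp [ψ, ← mul_assoc, ← C_mul, hq]
    · simp [ψ]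
  exact Function.LeftInverse.injective (g := ψ) fun p => congrArg (fun φ => φ p) hψ

theorem lastZero_swapVars (i : Fin m) (p : MvPolynomial (Fin (m + 2)) ℂ) :
    lastZero (m + 1) (swapVars i.castSucc p) = swapVars i (lastZero (m + 1) p) := by
  have : (lastZero (m + 1)).comp (swapVars i.castSucc) = (swapVars i).comp (lastZero (m + 1)) := by
    refine MvPolynomial.ringHom_ext (fun c => by simp) fun j => ?_
    refine Fin.lastCases ?_ (fun j => ?_) j
    · simp only [RingHom.comp_apply, swapVars_X, lastZero_X_last, map_zero]
      rw [Equiv.swap_apply_of_ne_of_ne, lastZero_X_last]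
      · exact (Fin.castSucc_lt_last _).ne'
      · rw [← Fin.castSucc_succ]; exact (Fin.castSucc_lt_last _).ne'
    · simp only [RingHom.comp_apply, swapVars_X, lastZero_X_castSucc]
      rw [← Fin.castSucc_succ, (Fin.castSucc_injective _).swap_apply, lastZero_X_castSucc]
  exact congrArg (fun φ => φ p) this

/-- Setting the last variable to zero after the cyclic shift amounts to setting the last but one
variable to zero before it. -/
theorem lastZero_rhoVars (p : MvPolynomial (Fin (m + 2)) ℂ) :
    lastZero (m + 1) (rhoVars q (m + 1) p) =
      rhoVars q m (lastZero (m + 1) (swapVars (Fin.last m) p)) := by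
  have : (lastZero (m + 1)).comp (rhoVars q (m + 1)) =
      ((rhoVars q m).comp (lastZero (m + 1))).comp (swapVars (Fin.last m)) := by
    refine MvPolynomial.ringHom_ext (fun c => by simp) fun j => ?_
    refine Fin.lastCases ?_ (fun j => ?_) j
    · have h1 : swapVars (Fin.last m) (X (Fin.last (m + 1))) = X (Fin.last m).castSucc :=
        swapVars_X_succ (Fin.last m)
      have h2 : lastZero (m + 1) (X 0) = X 0 := lastZero_X_castSucc 0
      simp only [RingHom.comp_apply, rhoVars_X_last, map_mul, lastZero_C, h1, h2,
        lastZero_X_castSucc]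
    · refine Fin.lastCases ?_ (fun j => ?_) j
      · have h1 : lastZero (m + 1) (X (Fin.last m).succ) = 0 := lastZero_X_last
        simp only [RingHom.comp_apply, rhoVars_X_castSucc, swapVars_X_castSucc, h1, map_zero]
      · have h1 : lastZero (m + 1) (X j.castSucc.succ) = X j.succ := by
          rw [← Fin.castSucc_succ, lastZero_X_castSucc]
        have h2 : swapVars (Fin.last m) (X j.castSucc.castSucc) = X j.castSucc.castSucc := by
          rw [swapVars_X, Equiv.swap_apply_of_ne_of_ne]
          · exact fun e => (Fin.castSucc_lt_last j).ne (Fin.castSucc_injective _ e)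
          · rw [Fin.succ_last]; exact (Fin.castSucc_lt_last _).ne
        simp only [RingHom.comp_apply, rhoVars_X_castSucc, h1, h2, lastZero_X_castSucc]
  exact congrArg (fun φ => φ p) this

end substitutions

/-! ### The exchange and rotation relations -/

section relations

variable {m N : ℕ} {t₄ q : ℂ}

theorem X_succ_sub_X_castSucc_ne_zero (i : Fin m) :
    (X i.succ - X i.castSucc : MvPolynomial (Fin (m + 1)) ℂ) ≠ 0 := by
  rw [sub_ne_zero]
  exact fun h => (Fin.castSucc_lt_succ (i := i)).ne' (X_injective h)

/-- The equation `Rᵢ(zᵢ₊₁/zᵢ) D(…, zᵢ₊₁, zᵢ, …) = D` for all neighbouring variables, with the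
denominators cleared.  The number `N` of marked points need not be the number of variables. -/
def ExchangeRel (t₄ : ℂ) (D : LinkModule (MvPolynomial (Fin (m + 1)) ℂ) N) : Prop :=
  ∀ i : Fin m,
    (X i.succ - X i.castSucc : MvPolynomial (Fin (m + 1)) ℂ) •
        mapCoeff (swapVars i) (eOp _ t₄ N ((i : ℕ) : ℤ) D) +
      (C (t₄ ^ 2) * X i.succ - C (t₄ ^ 2)⁻¹ * X i.castSucc : MvPolynomial (Fin (m + 1)) ℂ) •
        mapCoeff (swapVars i) D =
    (C (t₄ ^ 2) * X i.castSucc - C (t₄ ^ 2)⁻¹ * X i.succ : MvPolynomial (Fin (m + 1)) ℂ) • D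

/-- The rotation equation which a vector in `m + 2` variables and its last exchange relation leave
when the last variable is set to zero. -/
def RotationRel (t₄ q κ : ℂ) (D : LinkModule (MvPolynomial (Fin (m + 1)) ℂ) (m + 2)) : Prop :=
  rhoOp _ (m + 2) (mapCoeff (rhoVars q m) (eOp _ t₄ (m + 2) m D + t₄ ^ 2 • D)) = κ • D

/-- A solution satisfies the equations with the denominators cleared, over the polynomials. -/
theorem exchangeRel_of_isSol (ht : t₄ ≠ 0) {c : ℂ}
    {f : LinkModule (MvPolynomial (Fin (m + 1)) ℂ) (m + 1)} (hf : IsSol t₄ q c (m + 1) f) :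
    ExchangeRel t₄ f := by
  intro i
  have hinj : Function.Injective
      (algebraMap (MvPolynomial (Fin (m + 1)) ℂ) (RatFun (m + 1))) := IsFractionRing.injective _ _
  have hx : z i.castSucc ≠ 0 := by
    rw [z, Ne, map_eq_zero_iff _ hinj]; exact X_ne_zero _
  have hC : ∀ a : ℂ, algebraMap ℂ (RatFun (m + 1)) a = algebraMap _ (RatFun (m + 1)) (C a) :=
    fun a => IsScalarTower.algebraMap_apply ℂ (MvPolynomial (Fin (m + 1)) ℂ) (RatFun (m + 1)) a
  have hd : algebraMap ℂ (RatFun (m + 1)) (t₄ ^ 2) * z i.castSucc -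
      algebraMap ℂ (RatFun (m + 1)) (t₄ ^ 2)⁻¹ * z i.succ ≠ 0 := by
    rw [hC, hC, z, z, ← map_mul, ← map_mul, ← map_sub, Ne, map_eq_zero_iff _ hinj]
    intro h
    have := congrArg (MvPolynomial.eval fun j => if j = i.castSucc then (1 : ℂ) else 0) h
    rw [map_sub, map_mul, map_mul, eval_C, eval_C, eval_X, eval_X, if_pos rfl,
      if_neg (Fin.castSucc_lt_succ (i := i)).ne', map_zero, mul_one, mul_zero, sub_zero] at this
    exact pow_ne_zero 2 ht this
  have h := hf.1 i
  rw [toRat, toRat] at h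
  ext1 L
  have hL := DFunLike.congr_fun h L
  rw [rOp, ← mapCoeff_eOp (fun a => (hC a).symm),
    ← mapCoeff_eOp (fun a => swapVars_algebraMap i a)] at hL
  simp only [Finsupp.add_apply, Finsupp.smul_apply, mapCoeff_apply, smul_eq_mul] at hL ⊢
  have hd' : algebraMap ℂ (RatFun (m + 1)) (t₄ ^ 2) -
      algebraMap ℂ (RatFun (m + 1)) (t₄ ^ 2)⁻¹ * (z i.succ / z i.castSucc) ≠ 0 := by
    intro h
    apply hd
    have h1 : z i.succ / z i.castSucc * z i.castSucc = z i.succ := div_mul_cancel₀ _ hx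
    linear_combination z i.castSucc * h + algebraMap ℂ (RatFun (m + 1)) (t₄ ^ 2)⁻¹ * h1
  apply hinj
  simp only [map_add, map_mul, map_sub, ← hC]
  change (z i.succ - z i.castSucc) * _ + (_ * z i.succ - _ * z i.castSucc) * _ =
    (_ * z i.castSucc - _ * z i.succ) * _
  rw [weightA, weightB, div_mul_eq_mul_div, div_mul_eq_mul_div, ← add_div, div_eq_iff hd'] at hL
  have h1 : z i.succ / z i.castSucc * z i.castSucc = z i.succ := div_mul_cancel₀ _ hx
  generalize z i.succ / z i.castSucc = x at hL h1
  rw [← h1]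
  linear_combination z i.castSucc * hL

/-- Setting the last variable to zero respects the exchange relations of the other variables. -/
theorem ExchangeRel.lastZero {f : LinkModule (MvPolynomial (Fin (m + 2)) ℂ) N}
    (hf : ExchangeRel t₄ f) : ExchangeRel t₄ (mapCoeff (lastZero (m + 1)) f) := by
  intro i
  ext1 L
  have h := congrArg (QKZ.lastZero (m + 1)) (DFunLike.congr_fun (hf i.castSucc) L)
  rw [← mapCoeff_eOp (fun a => lastZero_algebraMap a)]
  simp only [Finsupp.add_apply, Finsupp.smul_apply, mapCoeff_apply, smul_eq_mul, map_add, map_mul,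
    map_sub, lastZero_C, lastZero_swapVars, ← Fin.castSucc_succ, lastZero_X_castSucc,
    Fin.val_castSucc] at h ⊢
  exact h

/-- The last exchange relation expresses the result of moving the zero from the last variable to
the last but one. -/
theorem ExchangeRel.lastZero_swap (ht : t₄ ≠ 0) {f : LinkModule (MvPolynomial (Fin (m + 2)) ℂ) N}
    (hf : ExchangeRel t₄ f) :
    mapCoeff (QKZ.lastZero (m + 1)) (mapCoeff (swapVars (Fin.last m)) f) =
      (-t₄ ^ 2) • (eOp _ t₄ N m (mapCoeff (QKZ.lastZero (m + 1)) f) +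
        t₄ ^ 2 • mapCoeff (QKZ.lastZero (m + 1)) f) := by
  ext1 L
  have h := congrArg (fun p => QKZ.lastZero (m + 1) (swapVars (Fin.last m) p))
    (DFunLike.congr_fun (hf (Fin.last m)) L)
  have hX : QKZ.lastZero (m + 1) (X (Fin.last m).succ) = 0 := lastZero_X_last
  rw [← mapCoeff_eOp (fun a => lastZero_algebraMap a)]
  simp only [Finsupp.add_apply, Finsupp.smul_apply, mapCoeff_apply, smul_eq_mul, map_add, map_mul,
    map_sub, lastZero_C, swapVars_C, swapVars_swapVars, swapVars_X_castSucc, swapVars_X_succ, hX,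
    lastZero_X_castSucc, Fin.val_last, smul_eq_C_mul, C_neg] at h ⊢
  have e : (C (t₄ ^ 2) * C (t₄ ^ 2)⁻¹ : MvPolynomial (Fin (m + 1)) ℂ) = 1 := by
    rw [← C_mul, mul_inv_cancel₀ (pow_ne_zero 2 ht), C_1]
  apply mul_left_cancel₀ (X_ne_zero (Fin.last m) : (X (Fin.last m) : MvPolynomial _ ℂ) ≠ 0)
  linear_combination C (t₄ ^ 2) * h - X (Fin.last m) *
    QKZ.lastZero (m + 1) (swapVars (Fin.last m) (f L)) * e

/-- The last exchange relation moves the zero to the last but one variable, from where the rotation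
moves it back to the last one. -/
theorem rotationRel_lastZero (ht : t₄ ≠ 0) {c : ℂ}
    {f : LinkModule (MvPolynomial (Fin (m + 2)) ℂ) (m + 2)} (hf : IsSol t₄ q c (m + 2) f) :
    RotationRel t₄ q (-(t₄ ^ 2)⁻¹ * c) (mapCoeff (lastZero (m + 1)) f) := by
  have h := congrArg (mapCoeff (lastZero (m + 1))) hf.2
  have e : mapCoeff (lastZero (m + 1)) (mapCoeff (rhoVars q (m + 1)) f) =
      mapCoeff (rhoVars q m) (mapCoeff (lastZero (m + 1))
          (mapCoeff (swapVars (Fin.last m)) f)) := by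
    ext1 L
    simp only [mapCoeff_apply, lastZero_rhoVars]
  rw [mapCoeff_rhoOp, e, (exchangeRel_of_isSol ht hf).lastZero_swap ht,
    mapCoeff_complex_smul (fun a => rhoVars_algebraMap a), rhoOp_smul,
    mapCoeff_complex_smul (fun a => lastZero_algebraMap a)] at h
  rw [RotationRel, mul_smul, ← h, smul_smul]
  rw [neg_mul_neg, inv_mul_cancel₀ (pow_ne_zero 2 ht), one_smul]

/-- The exchange and rotation relations determine a vector by its component at the fully nested
diagram. -/
theorem eq_zero_of_relations (hq : q ≠ 0) {κ : ℂ} (hκ : κ ≠ 0)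
    {D : LinkModule (MvPolynomial (Fin (m + 1)) ℂ) (m + 2)} (hE : ExchangeRel t₄ D)
    (hR : RotationRel t₄ q κ D) (h0 : D (nested (m + 2)) = 0) : D = 0 := by
  have hrot : ∀ L L' : LinkPattern (m + 2), L'.1 = rot L.1 →
      rhoVars q m (eOp _ t₄ (m + 2) m D L + C (t₄ ^ 2) * D L) = C κ * D L' := by
    intro L L' h
    have h1 := DFunLike.congr_fun hR L'
    rw [rhoOp_apply _ h] at h1
    simpa only [Finsupp.add_apply, Finsupp.smul_apply, mapCoeff_apply, smul_eq_C_mul] using h1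
  refine eq_zero_of_nested_eq_zero (t₄ := t₄) (Nat.succ_pos m) D (fun i i0 i1 L hL => ?_)
    (fun L L' h hL hL' => ?_) (fun L L' h hp hL => ?_) h0
  · obtain ⟨j, rfl⟩ := Int.eq_ofNat_of_zero_le i0
    have h1 := DFunLike.congr_fun (hE ⟨j, by omega⟩) L
    simp only [Finsupp.add_apply, Finsupp.smul_apply, mapCoeff_apply, smul_eq_mul, hL, map_zero,
      mul_zero, add_zero] at h1
    have h2 := (mul_eq_zero.1 h1).resolve_left (X_succ_sub_X_castSucc_ne_zero _)
    exact (map_eq_zero_iff _ (swapVars_injective _)).1 h2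
  · have h1 := hrot L L' h
    rw [hL, hL', mul_zero, mul_zero, add_zero, map_eq_zero_iff _ (rhoVars_injective hq)] at h1
    simpa using h1
  · have h1 := hrot L L' h
    rw [hL, eOp_apply_of_ne (by omega) L (by simpa using hp), mul_zero, add_zero, map_zero] at h1
    exact (mul_eq_zero.1 h1.symm).resolve_left (by simpa using hκ)

theorem ExchangeRel.sub {D E : LinkModule (MvPolynomial (Fin (m + 1)) ℂ) N}
    (hD : ExchangeRel t₄ D) (hE : ExchangeRel t₄ E) : ExchangeRel t₄ (D - E) := by
  intro i
  ext1 L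
  have h1 := DFunLike.congr_fun (hD i) L
  have h2 := DFunLike.congr_fun (hE i) L
  simp only [Finsupp.add_apply, Finsupp.sub_apply, Finsupp.smul_apply, mapCoeff_apply, smul_eq_mul,
    map_sub] at h1 h2 ⊢
  linear_combination h1 - h2

theorem RotationRel.sub {κ : ℂ} {D E : LinkModule (MvPolynomial (Fin (m + 1)) ℂ) (m + 2)}
    (hD : RotationRel t₄ q κ D) (hE : RotationRel t₄ q κ E) : RotationRel t₄ q κ (D - E) := by
  have e : mapCoeff (rhoVars q m) (eOp _ t₄ (m + 2) m (D - E) + t₄ ^ 2 • (D - E)) =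
      mapCoeff (rhoVars q m) (eOp _ t₄ (m + 2) m D + t₄ ^ 2 • D) -
        mapCoeff (rhoVars q m) (eOp _ t₄ (m + 2) m E + t₄ ^ 2 • E) := by
    ext1 L
    simp only [Finsupp.add_apply, Finsupp.sub_apply, Finsupp.smul_apply, mapCoeff_apply, map_sub,
      map_add, smul_eq_C_mul, map_mul]
    ring
  rw [RotationRel, e, map_sub, hD, hE, smul_sub]

/-- `φ` preserves the exchange relations, since it intertwines the Temperley-Lieb generators. -/
theorem ExchangeRel.smul_phi (ht : t₄ ≠ 0) {f : LinkModule (MvPolynomial (Fin (m + 1)) ℂ) (m + 1)}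
    (hf : ExchangeRel t₄ f) {p : MvPolynomial (Fin (m + 1)) ℂ} (hp : ∀ i, swapVars i p = p) :
    ExchangeRel t₄ (p • phi _ t₄ (m + 1) f) := by
  intro i
  have h := congrArg (fun v => p • phi _ t₄ (m + 1) v) (hf i)
  have hi := i.2
  simp only [map_add, map_smul, ← mapCoeff_phi (fun a => swapVars_algebraMap i a)] at h
  rw [phi_eOp ht (by omega) (by push_cast; omega)] at h
  rw [map_smul, mapCoeff_smul, mapCoeff_smul, hp, smul_comm _ p, smul_comm _ p, smul_comm _ p,
    ← smul_add]
  exact h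

/-- `φ` turns the rotation equation of a solution into the rotation relation, by its skein relation
with the rotation. -/
theorem rotationRel_smul_phi (ht : t₄ ≠ 0) {c lam : ℂ}
    {f : LinkModule (MvPolynomial (Fin (m + 1)) ℂ) (m + 1)} (hf : IsSol t₄ q c (m + 1) f)
    {p : MvPolynomial (Fin (m + 1)) ℂ} (hp : rhoVars q m p = C lam * p) :
    RotationRel t₄ q (t₄ * lam * c) (p • phi _ t₄ (m + 1) f) := by
  have e : eOp _ t₄ (m + 2) m (p • phi _ t₄ (m + 1) f) + t₄ ^ 2 • (p • phi _ t₄ (m + 1) f) =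
      p • t₄ • (t₄ • phi _ t₄ (m + 1) f + t₄⁻¹ • eOp _ t₄ (m + 2) m (phi _ t₄ (m + 1) f)) := by
    ext1 L
    have e1 : (C t₄ * C t₄⁻¹ : MvPolynomial (Fin (m + 1)) ℂ) = 1 := by
      rw [← C_mul, mul_inv_cancel₀ ht, C_1]
    simp only [map_smul, Finsupp.add_apply, Finsupp.smul_apply, smul_eq_mul, smul_eq_C_mul, C_pow]
    linear_combination -(p * eOp _ t₄ (m + 2) m (phi _ t₄ (m + 1) f) L) * e1
  have h := phi_rhoOp ht (Nat.succ_pos m) (mapCoeff (rhoVars q m) f)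
  have hm : ((m.succ : ℕ) : ℤ) - 1 = m := by push_cast; ring
  rw [hf.2, hm] at h
  rw [RotationRel, e, mapCoeff_smul, mapCoeff_complex_smul (fun a => rhoVars_algebraMap a),
    mapCoeff_add, mapCoeff_complex_smul (fun a => rhoVars_algebraMap a),
    mapCoeff_complex_smul (fun a => rhoVars_algebraMap a),
    mapCoeff_eOp (fun a => rhoVars_algebraMap a), mapCoeff_phi (fun a => rhoVars_algebraMap a),
    map_smul, rhoOp_smul, ← h, hp]
  ext1 L
  rw [← algebraMap_smul (MvPolynomial (Fin (m + 1)) ℂ) c f, map_smul]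
  simp only [Finsupp.smul_apply, smul_eq_mul, smul_eq_C_mul, C_mul, algebraMap_eq]
  ring

end relations

/-! ### The component at the fully nested diagram -/

section polynomials

variable {m n : ℕ} {t₄ q : ℂ}

theorem lastZero_nestedComponent (t₄ : ℂ) (n : ℕ) :
    lastZero n (nestedComponent t₄ (n + 1)) =
      nestedComponent t₄ n * (C (-(t₄ ^ 2)⁻¹) ^ n * ∏ i : Fin n, X i) := by
  have h : ∀ i : Fin n, ∏ j ∈ Finset.Ioi i.castSucc,
      lastZero n (C (t₄ ^ 2) * X j - C (t₄ ^ 2)⁻¹ * X i.castSucc) =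
      (∏ j ∈ Finset.Ioi i, (C (t₄ ^ 2) * X j - C (t₄ ^ 2)⁻¹ * X i)) *
        (C (-(t₄ ^ 2)⁻¹) * X i) := by
    intro i
    have e : Finset.Ioi i.castSucc = insert (Fin.last n) ((Finset.Ioi i).map Fin.castSuccEmb) := by
      rw [Fin.map_castSuccEmb_Ioi]
      ext j
      simp only [Finset.mem_Ioi, Finset.mem_insert, Finset.mem_Ioo]
      have := j.le_last
      have h2 := Fin.castSucc_lt_last i
      constructor
      · exact fun h => this.eq_or_lt.imp id fun h' => ⟨h, h'⟩
      · rintro (rfl | h)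
        exacts [h2, h.1]
    rw [e, Finset.prod_insert (by simp [Fin.map_castSuccEmb_Ioi]), Finset.prod_map, mul_comm]
    simp only [map_sub, map_mul, lastZero_C, lastZero_X_last, lastZero_X_castSucc,
      Fin.coe_castSuccEmb, C_neg]
    ring
  rw [nestedComponent, map_prod, Fin.prod_univ_castSucc, nestedComponent]
  simp only [map_prod, h, Finset.prod_mul_distrib, Finset.prod_const, Finset.card_univ,
    Fintype.card_fin]
  rw [show Finset.Ioi (Fin.last n) = ∅ from Finset.Ioi_eq_empty.2 fun _ _ => Fin.le_last _,
    Finset.prod_empty, mul_one]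

theorem nestedComponent_ne_zero (ht : t₄ ≠ 0) (n : ℕ) : nestedComponent t₄ n ≠ 0 := by
  refine Finset.prod_ne_zero_iff.2 fun i _ => Finset.prod_ne_zero_iff.2 fun j hj h => ?_
  have := congrArg (MvPolynomial.eval fun k => if k = j then (1 : ℂ) else 0) h
  rw [map_sub, map_mul, map_mul, eval_C, eval_C, eval_X, eval_X, if_pos rfl,
    if_neg (Finset.mem_Ioi.1 hj).ne, map_zero, mul_one, mul_zero, sub_zero] at this
  exact pow_ne_zero 2 ht this

theorem braidFactor_ne_zero (ht : t₄ ≠ 0) (n : ℕ) : braidFactor t₄ n ≠ 0 :=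
  mul_ne_zero (C_ne_zero.2 (mul_ne_zero (pow_ne_zero _ (by norm_num)) (zpow_ne_zero _ ht)))
    (Finset.prod_ne_zero_iff.2 fun _ _ => X_ne_zero _)

theorem braidFactor_zero (t₄ : ℂ) : braidFactor t₄ 0 = 1 := by
  simp [braidFactor]

/-- `braidFactor` compensates the factor `t₄⁻¹ ^ (n / 2)` by which `φₙ` scales the component at the
fully nested diagram. -/
theorem lastZero_nestedComponent_eq_braidFactor_mul (ht : t₄ ≠ 0) (n : ℕ) :
    lastZero n (nestedComponent t₄ (n + 1)) =
      braidFactor t₄ n * (C (t₄⁻¹ ^ (n / 2)) * nestedComponent t₄ n) := by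
  have h : (-(t₄ ^ 2)⁻¹) ^ n =
      (-1) ^ n * t₄ ^ (((n / 2 : ℕ) : ℤ) - 2 * (n : ℤ)) * t₄⁻¹ ^ (n / 2) := by
    rw [neg_pow, mul_assoc, zpow_sub₀ ht, zpow_natCast, zpow_mul, zpow_natCast]
    have := pow_ne_zero (n / 2) ht
    rw [inv_pow t₄]
    have h2 := pow_ne_zero n (pow_ne_zero 2 ht)
    rw [inv_pow (t₄ ^ 2)]
    field_simp
  rw [lastZero_nestedComponent, braidFactor, ← C_pow, h, C_mul]
  ring

theorem isSymmetric_braidFactor (t₄ : ℂ) (n : ℕ) : (braidFactor t₄ n).IsSymmetric := by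
  intro e
  rw [braidFactor, map_mul, rename_C, map_prod]
  simp only [rename_X]
  rw [Equiv.prod_comp e (fun i => (X i : MvPolynomial (Fin n) ℂ))]

theorem swapVars_eq_self {p : MvPolynomial (Fin (m + 1)) ℂ} (hp : p.IsSymmetric) (i : Fin m) :
    swapVars i p = p := hp _

theorem rhoVars_braidFactor (t₄ q : ℂ) (m : ℕ) :
    rhoVars q m (braidFactor t₄ (m + 1)) = C q⁻¹ * braidFactor t₄ (m + 1) := by
  rw [braidFactor, map_mul, rhoVars_C, map_prod, Fin.prod_univ_castSucc, Fin.prod_univ_succ]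
  simp only [rhoVars_X_castSucc, rhoVars_X_last]
  ring

theorem isRecursionFactor_braidFactor (t₄ : ℂ) (hq : q ≠ 0) (n : ℕ) :
    IsRecursionFactor q (if n = 0 then 1 else q⁻¹) n (braidFactor t₄ n) := by
  cases n with
  | zero => simp [IsRecursionFactor]
  | succ m =>
    exact ⟨by simpa using hq, isSymmetric_braidFactor t₄ _, by simpa using rhoVars_braidFactor t₄ q m⟩

end polynomials

/-! ### Towers of solutions -/

section towers

variable {t₄ q : ℂ} {c : ℕ → ℂ} {g : (n : ℕ) → LinkModule (MvPolynomial (Fin n) ℂ) n}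

theorem IsLinkPattern.eq_nestedFun {n : ℕ} (hn : n ≤ 1) {σ : ℤ → ℤ} (h : IsLinkPattern n σ) :
    σ = nestedFun n := by
  rcases Nat.eq_zero_or_pos n with rfl | h0
  · funext x; rw [h.empty rfl]; simp [nestedFun]
  · exact eq_nestedFun_of_no_peak h0 (NC.of_isLinkPattern h0 h) fun i _ _ => by omega

/-- For at most one marked point, there is only one diagram. -/
theorem linkPattern_eq_nested {n : ℕ} (hn : n ≤ 1) (L : LinkPattern n) : L = nested n :=
  Subtype.ext (L.2.eq_nestedFun hn)

/-- The nested component of the braid recursion with an arbitrary factor `p`. -/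
theorem nested_component_lastZero (ht : t₄ ≠ 0) (hl : loopWeight t₄ ≠ 0) {n : ℕ}
    (h1 : g (n + 1) (nested (n + 1)) = nestedComponent t₄ (n + 1))
    (h0 : g n (nested n) = nestedComponent t₄ n) (p : MvPolynomial (Fin n) ℂ) :
    (mapCoeff (lastZero n) (g (n + 1)) - p • phi _ t₄ n (g n)) (nested (n + 1)) =
      (braidFactor t₄ n - p) * (C (t₄⁻¹ ^ (n / 2)) * nestedComponent t₄ n) := by
  rw [Finsupp.sub_apply, mapCoeff_apply, h1, lastZero_nestedComponent_eq_braidFactor_mul ht,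
    Finsupp.smul_apply, phi_apply_nested ht hl, h0, smul_eq_mul, algebraMap_eq]
  ring

/-- For matching twist parameters, the uniqueness of solutions of the exchange and rotation
relations gives the braid recursion. -/
theorem lastZero_eq_smul_phi (ht : t₄ ≠ 0) (hl : loopWeight t₄ ≠ 0) (hq : q ≠ 0) {n : ℕ}
    (hn : 0 < n) (hc : c (n + 1) ≠ 0) (hcn : c (n + 1) = -t₄ ^ 3 * q⁻¹ * c n)
    (s0 : IsSol t₄ q (c n) n (g n)) (s1 : IsSol t₄ q (c (n + 1)) (n + 1) (g (n + 1)))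
    (h0 : g n (nested n) = nestedComponent t₄ n)
    (h1 : g (n + 1) (nested (n + 1)) = nestedComponent t₄ (n + 1)) :
    mapCoeff (lastZero n) (g (n + 1)) = braidFactor t₄ n • phi _ t₄ n (g n) := by
  obtain ⟨m, rfl⟩ := Nat.exists_eq_succ_of_ne_zero hn.ne'
  have hR := rotationRel_smul_phi ht s0 (rhoVars_braidFactor t₄ q m)
  have e : t₄ * q⁻¹ * c (m + 1) = -(t₄ ^ 2)⁻¹ * c (m + 1 + 1) := by
    rw [hcn]; field_simp
  rw [e] at hR
  refine sub_eq_zero.1 (eq_zero_of_relations hq (κ := -(t₄ ^ 2)⁻¹ * c (m + 1 + 1))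
    (mul_ne_zero (neg_ne_zero.2 (inv_ne_zero (pow_ne_zero 2 ht))) hc)
    ((exchangeRel_of_isSol ht s1).lastZero.sub ((exchangeRel_of_isSol ht s0).smul_phi ht
      (swapVars_eq_self (isSymmetric_braidFactor t₄ _))))
    ((rotationRel_lastZero ht s1).sub hR) ?_)
  rw [nested_component_lastZero ht hl h1 h0, sub_self, zero_mul]

/-- The braid recursion forces the twist parameters to match. -/
theorem twist_succ (ht : t₄ ≠ 0) {n : ℕ} (hn : 0 < n)
    (s0 : IsSol t₄ q (c n) n (g n)) (s1 : IsSol t₄ q (c (n + 1)) (n + 1) (g (n + 1)))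
    (hne : mapCoeff (lastZero n) (g (n + 1)) ≠ 0)
    (hb : mapCoeff (lastZero n) (g (n + 1)) = braidFactor t₄ n • phi _ t₄ n (g n)) :
    c (n + 1) = -t₄ ^ 3 * q⁻¹ * c n := by
  obtain ⟨m, rfl⟩ := Nat.exists_eq_succ_of_ne_zero hn.ne'
  have hR := rotationRel_smul_phi ht s0 (rhoVars_braidFactor t₄ q m)
  have hR' := rotationRel_lastZero ht s1
  rw [← hb] at hR
  have h := smul_left_injective ℂ hne (hR.symm.trans hR')
  have e : c (m + 1 + 1) = -t₄ ^ 2 * (-(t₄ ^ 2)⁻¹ * c (m + 1 + 1)) := by field_simp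
  rw [e, ← h]
  ring

/-- The rotation equation in components. -/
theorem IsSol.rhoVars_apply {κ : ℂ} {m : ℕ} {f : LinkModule (MvPolynomial (Fin (m + 1)) ℂ) (m + 1)}
    (hf : IsSol t₄ q κ (m + 1) f) {L L' : LinkPattern (m + 1)} (h : L'.1 = rot L.1) :
    rhoVars q m (f L) = C κ * f L' := by
  have h1 := DFunLike.congr_fun hf.2 L'
  rwa [rhoOp_apply _ h, mapCoeff_apply, Finsupp.smul_apply, smul_eq_C_mul] at h1

/-- For one point the rotation acts trivially. -/
theorem twist_one {κ : ℂ} {f : LinkModule (MvPolynomial (Fin 1) ℂ) 1} (hf : IsSol t₄ q κ 1 f)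
    (h : f (nested 1) = nestedComponent t₄ 1) : κ = 1 := by
  have h1 := hf.rhoVars_apply (L := nested 1) (L' := nested 1)
    (((nested 1).2.rot one_pos).eq_nestedFun le_rfl).symm
  have e : nestedComponent t₄ 1 = 1 := by simp [nestedComponent]
  rw [h, e, map_one, mul_one, ← C_1] at h1
  exact (C_injective _ _ h1).symm

/-- For two points, the full rotation fixes the nested diagram. -/
theorem twist_two_sq (ht : t₄ ≠ 0) {κ : ℂ} {f : LinkModule (MvPolynomial (Fin 2) ℂ) 2}
    (hf : IsSol t₄ q κ 2 f) (h : f (nested 2) = nestedComponent t₄ 2) : κ ^ 2 = q⁻¹ := by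
  let L : LinkPattern 2 := ⟨rot (nested 2).1, (nested 2).2.rot two_pos⟩
  have h1 := hf.rhoVars_apply (L := nested 2) (L' := L) rfl
  have h2 := hf.rhoVars_apply (L := L) (L' := nested 2) <| by
    funext x
    have := (nested 2).2.periodic (x - 2)
    simp only [L, rot]
    rw [show x - 1 - 1 = x - 2 by ring]
    rw [show x - 2 + ((2 : ℕ) : ℤ) = x by push_cast; ring] at this
    rw [this]; push_cast; ring
  have h3 := congrArg (rhoVars q 1) h1
  rw [map_mul, h2, rhoVars_C, h] at h3
  have e : nestedComponent t₄ 2 =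
      C (t₄ ^ 2) * X (Fin.last 1) - C (t₄ ^ 2)⁻¹ * X (Fin.castSucc 0) := by
    have e1 : Finset.Ioi (0 : Fin 2) = {1} := by decide
    have e2 : Finset.Ioi (1 : Fin 2) = ∅ := by decide
    rw [nestedComponent, Fin.prod_univ_two, e1, e2]
    simp
  have e3 : rhoVars q 1 (X 0) = X (Fin.last 1) := rhoVars_X_castSucc 0
  have e4 : rhoVars q 1 (rhoVars q 1 (nestedComponent t₄ 2)) = C q⁻¹ * nestedComponent t₄ 2 := by
    rw [e]
    simp only [map_sub, map_mul, rhoVars_C, rhoVars_X_last, rhoVars_X_castSucc, e3]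
    have e5 : (X (Fin.succ 0) : MvPolynomial (Fin 2) ℂ) = X (Fin.last 1) := rfl
    have e6 : (X (Fin.castSucc 0) : MvPolynomial (Fin 2) ℂ) = X 0 := rfl
    rw [e5, e6, rhoVars_X_last]
    ring
  rw [e4, ← mul_assoc, ← C_mul] at h3
  rw [sq]
  exact (C_injective _ _ (mul_right_cancel₀ (nestedComponent_ne_zero ht 2) h3)).symm

theorem loopWeight_ne_zero (ht : t₄ ≠ 0) (h : t₄ ^ 4 + 1 ≠ 0) : loopWeight t₄ ≠ 0 := by
  intro h0
  apply h
  rw [loopWeight] at h0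
  have := pow_ne_zero 2 ht
  field_simp at h0
  linear_combination -h0

/-- The braid recursion can only hold with the recursion factors `braidFactor`: compare components
at the fully nested diagram. -/
theorem IsQKZTowerWith.eq_braidFactor (ht : t₄ ≠ 0) (hl : loopWeight t₄ ≠ 0) {lam : ℕ → ℂ}
    {h : (n : ℕ) → MvPolynomial (Fin n) ℂ} (H : IsQKZTowerWith t₄ q c g lam h)
    (hg : ∀ n, g n (nested n) = nestedComponent t₄ n) (n : ℕ) : h n = braidFactor t₄ n := by
  have h1 := nested_component_lastZero ht hl (hg (n + 1)) (hg n) (h n)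
  rw [H.braid n, sub_self, Finsupp.zero_apply, eq_comm, mul_eq_zero] at h1
  refine (sub_eq_zero.1 (h1.resolve_right ?_)).symm
  exact mul_ne_zero (C_ne_zero.2 (pow_ne_zero _ (inv_ne_zero ht))) (nestedComponent_ne_zero ht n)

end towers

end QKZ

end

theorem mainTheorem3 (t₄ q : ℂ) (c : ℕ → ℂ) (ht : t₄ ≠ 0) (hq : q ≠ 0)
    (hc : ∀ n, 1 ≤ n → c n ≠ 0) (hloop : (t₄ ^ 2 + 1) * (t₄ ^ 4 + 1) ≠ 0)
    (g : (n : ℕ) → QKZ.LinkModule (MvPolynomial (Fin n) ℂ) n)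
    (hg0 : g 0 = Finsupp.single (QKZ.nested 0) 1)
    (hsol : ∀ n, 1 ≤ n → QKZ.IsSol t₄ q (c n) n (g n))
    (hnested : ∀ n, 1 ≤ n → g n (QKZ.nested n) = QKZ.nestedComponent t₄ n) :
    (QKZ.IsQKZTower t₄ q c g ↔
      q = t₄ ^ 6 ∧ (∀ n, 1 ≤ n → c n = (-(t₄ ^ 3)⁻¹) ^ (n - 1)) ∧ c 0 = t₄ + t₄⁻¹) ∧
    (∀ (lam : ℕ → ℂ) (h : (n : ℕ) → MvPolynomial (Fin n) ℂ),
      QKZ.IsQKZTowerWith t₄ q c g lam h →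
        lam 0 = 1 ∧ h 0 = 1 ∧ ∀ n, 1 ≤ n → lam n = q⁻¹ ∧ h n = QKZ.braidFactor t₄ n) ∧
    (QKZ.IsQKZTower t₄ q c g →
      ∀ n, QKZ.mapCoeff (QKZ.lastZero n) (g (n + 1)) =
        QKZ.braidFactor t₄ n • QKZ.phi (MvPolynomial (Fin n) ℂ) t₄ n (g n)) := by
  have hl : QKZ.loopWeight t₄ ≠ 0 := QKZ.loopWeight_ne_zero ht (right_ne_zero_of_mul hloop)
  have hg : ∀ n, g n (QKZ.nested n) = QKZ.nestedComponent t₄ n := by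
    intro n
    rcases Nat.eq_zero_or_pos n with rfl | h
    · rw [hg0, Finsupp.single_eq_same]; simp [QKZ.nestedComponent]
    · exact hnested n h
  have hc1 : c 1 = 1 := QKZ.twist_one (hsol 1 le_rfl) (hg 1)
  refine ⟨⟨?_, ?_⟩, ?_, ?_⟩
  · rintro ⟨lam, h, H⟩
    have hsucc : ∀ n, 1 ≤ n → c (n + 1) = -t₄ ^ 3 * q⁻¹ * c n := fun n hn =>
      QKZ.twist_succ ht hn (hsol n hn) (hsol (n + 1) (by omega)) (H.lastZero_ne_zero n)
        (by rw [H.braid n, H.eq_braidFactor ht hl hg])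
    have hq6 : q = t₄ ^ 6 := by
      have h2 := QKZ.twist_two_sq ht (hsol 2 (by omega)) (hg 2)
      rw [hsucc 1 le_rfl, hc1] at h2
      field_simp at h2
      linear_combination -h2
    refine ⟨hq6, fun n hn => ?_, by rw [H.twist_zero, hc1, mul_one, inv_one, mul_one]⟩
    induction n, hn using Nat.le_induction with
    | base => simpa using hc1
    | succ n hn ih =>
      rw [hsucc n hn, ih, hq6]
      obtain ⟨k, rfl⟩ := Nat.exists_eq_succ_of_ne_zero (by omega : n ≠ 0)
      simp only [Nat.succ_eq_add_one, Nat.add_sub_cancel, pow_succ (-(t₄ ^ 3)⁻¹) k]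
      field_simp
  · rintro ⟨hq6, hcn, hc0⟩
    refine ⟨fun n => if n = 0 then 1 else q⁻¹, QKZ.braidFactor t₄, hc, ?_,
      QKZ.isRecursionFactor_braidFactor t₄ hq, fun n h => ?_, fun n => ?_, fun n h => ?_,
      fun n => ?_⟩
    · rw [hc0, hc1, mul_one, inv_one, mul_one]
    · apply QKZ.nestedComponent_ne_zero ht n
      rw [← hg n, h, Finsupp.zero_apply]
    · rcases Nat.eq_zero_or_pos n with rfl | hn
      · rw [QKZ.IsSol, QKZ.punctureLoopWeight, hc0]
      · exact hsol n hn
    · have h1 := QKZ.nested_component_lastZero ht hl (hg (n + 1)) (hg n) 0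
      rw [h, zero_smul, sub_zero, Finsupp.zero_apply, sub_zero, eq_comm] at h1
      exact mul_ne_zero (QKZ.braidFactor_ne_zero ht n)
        (mul_ne_zero (MvPolynomial.C_ne_zero.2 (pow_ne_zero _ (inv_ne_zero ht)))
          (QKZ.nestedComponent_ne_zero ht n)) h1
    · rcases Nat.eq_zero_or_pos n with rfl | hn
      · ext1 L
        rw [QKZ.linkPattern_eq_nested le_rfl L]
        have h1 := QKZ.nested_component_lastZero ht hl (hg 1) (hg 0) (QKZ.braidFactor t₄ 0)
        rw [sub_self, zero_mul, Finsupp.sub_apply] at h1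
        exact sub_eq_zero.1 h1
      · refine QKZ.lastZero_eq_smul_phi ht hl hq hn (hc _ (by omega)) ?_ (hsol n hn)
          (hsol _ (by omega)) (hg n) (hg _)
        rw [hcn _ (by omega), hcn n hn, hq6]
        obtain ⟨k, rfl⟩ := Nat.exists_eq_succ_of_ne_zero hn.ne'
        simp only [Nat.succ_eq_add_one, Nat.add_sub_cancel, pow_succ (-(t₄ ^ 3)⁻¹) k]
        field_simp
  · intro lam h H
    have hb := H.eq_braidFactor ht hl hg
    have h0 : h 0 = 1 := by rw [hb, QKZ.braidFactor_zero]
    refine ⟨?_, h0, fun n hn => ⟨?_, hb n⟩⟩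
    · by_contra h1
      exact one_ne_zero (h0.symm.trans ((H.factor 0).2 h1))
    · obtain ⟨m, rfl⟩ := Nat.exists_eq_succ_of_ne_zero (by omega : n ≠ 0)
      have h1 := (H.factor (m + 1)).2.2
      rw [hb, QKZ.rhoVars_braidFactor] at h1
      exact (MvPolynomial.C_injective _ _ (mul_right_cancel₀ (QKZ.braidFactor_ne_zero ht _)
          h1)).symm
  · rintro ⟨lam, h, H⟩ n
    rw [H.braid n, H.eq_braidFactor ht hl hg]
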